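/- **Setting.** For $n\in\mathbb N=\{1,2,\dots\}$ let $C_n\subseteq\mathbb R^2$ be the circle of radius $1/n$ centred at $(1/n,0)$, $\ell_n(t)=\frac1n(1-\cos 2\pi t,\ \sin 2\pi t)$, and let $\mathbb H=\bigcup_n C_n$ be the Hawaiian Earring with base point $b_0=(0,0)$. Let each $P_n$ be a copy of a fixed pair of pants $D\setminus(D_1^\circ\cup D_2^\circ)$, where $D_1,D_2$ are disjoint disks in the interior of a disk $D\subseteq\mathbb R^2$, with clockwise parametrizations $\alpha_n,\beta_n,\gamma_n$ of $\partial D,\partial D_1,\partial D_2$ starting at $a,b,c$. Concretely (in $\mathbb R^2=\mathbb C$), $D,D_1,D_2$ have centres $0,2i,-2i$ and radii $4,1,1$, and $a=-4$, $b=2i-1$, $c=-2i-1$. The Hawaiian Pants $\mathbb P$ is the quotient space of $\mathbb H\sqcup\coprod_n P_n$ by the identifications $\alpha_n(t)\sim\ell_n(t)$, $\beta_n(t)\sim\ell_{2n}(t)$, $\gamma_n(t)\sim\ell_{2n+1}(t)$. Let $B_{n,1},B_{n,2}\subseteq\mathbb P$ be the images of the segments $[a,b],[a,c]\subseteq P_n$,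 and let $\rho_{n,1},\rho_{n,2}$ be the loops at $b_0$ that traverse them from $a$ to $b$ and from $a$ to $c$, respectively. As subspaces of $\mathbb P$, put $\mathbb H^+_n=\{b_0\}\cup\bigcup_{i<n}(B_{i,1}\cup B_{i,2})\cup\bigcup_{i\ge n}C_i$ and $\mathbb H^+_{n,k}=\{b_0\}\cup\bigcup_{i<n}(B_{i,1}\cup B_{i,2})\cup\bigcup_{n\le i\le k}C_i$. Let $r_{n,k}:\mathbb H^+_n\to\mathbb H^+_{n,k}$ be the retraction that maps all $C_i$ with $i\geqslant n$, $i>k$, to $b_0$, and let $\iota_n:\mathbb H^+_n\hookrightarrow\mathbb P$ be the inclusion. Let $\mathcal W^+_{n,k}$ be the free monoid of finite words over the letters $\rho_{i,j}^{\pm1}$ ($1\le i<n$, $j=1,2$) and $\ell_i^{\pm1}$ ($n\le i\le k$). **Theorem.** 1. For $n\ge1$ and $k\ge n-1$, $\pi_1(\mathbb H^+_{n,k},b_0)$ is free on the classes $[\rho_{i,j}]$ ($i<n$, $j=1,2$) and $[\ell_i]$ ($n\le i\le k$). Hence, for $x\in\pi_1(\mathbb H^+_n,b_0)$, there is a unique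 reduced word $g_{n,k}(x)\in\mathcal W^+_{n,k}$ representing $(r_{n,k})_\#(x)$. 2. For $n\ge1$, $m\ge n-1$ and $x\in\pi_1(\mathbb H^+_n,b_0)$, the words in $\mathcal W^+_{n,m}$ obtained from $g_{n,k}(x)$ by deleting, without any cancellation, all letters $\ell_i^{\pm1}$ with $i>m$ are the same for all sufficiently large $k$; let $\omega_{n,m}(x)\in\mathcal W^+_{n,m}$ be this stabilized word. 3. For every $[\alpha]\in\pi_1(\mathbb P,b_0)$ and all sufficiently large $n$ there is an $x\in\pi_1(\mathbb H^+_n,b_0)$ with $\iota_{n\#}(x)=[\alpha]$. 4. There is exactly one function $$\chi=(\chi_n)_{n\ge1}:\pi_1(\mathbb P,b_0)\to\varprojlim\left(\mathcal W^+_{2,1}\xleftarrow{E_1}\mathcal W^+_{3,2}\xleftarrow{E_2}\mathcal W^+_{4,3}\xleftarrow{E_3}\cdots\right)$$ such that $\chi_{n-1}(\iota_{n\#}(x))=\omega_{n,n-1}(x)$ for all $n\ge2$ and all $x\in\pi_1(\mathbb H^+_n,b_0)$. Here $E_n:\mathcal W^+_{n+2,n+1}\to\mathcal W^+_{n+1,n}$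 is the homomorphism that deletes the letters $\rho_{n+1,1}^{\pm1},\rho_{n+1,2}^{\pm1}$. This function $\chi$ is injective. -/

import Mathlib

noncomputable section

namespace HawaiianPants

open Filter Topology

/-! ### Fundamental groups

Mathlib multiplies loops in the order opposite to concatenation, hence the `ᵐᵒᵖ`:
in `PiOne X x`, the product of the classes of `γ` and `δ` is the class of "first `γ`, then `δ`". -/

/-- The fundamental group of `X` at `x`, the product being induced by concatenation of loops. -/
abbrev PiOne (X : Type*) [TopologicalSpace X] (x : X) : Type _ := (FundamentalGroup X x)ᵐᵒᵖ

/-- The class of a loop. -/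
def loopClass {X : Type*} [TopologicalSpace X] {x : X} (γ : Path x x) : PiOne X x :=
  MulOpposite.op (FundamentalGroup.fromPath (Path.Homotopic.Quotient.mk γ))

theorem loopClass_trans {X : Type*} [TopologicalSpace X] {x : X} (γ δ : Path x x) :
    loopClass (γ.trans δ) = loopClass γ * loopClass δ := rfl

/-- The homomorphism induced by a continuous map `f` with `f x = y`. -/
def PiOne.map {X Y : Type*} [TopologicalSpace X] [TopologicalSpace Y] {x : X} {y : Y}
    (f : C(X, Y)) (h : f x = y) : PiOne X x →* PiOne Y y :=
  MonoidHom.op (FundamentalGroup.mapOfEq f h)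

/-- A path which stays in the subspace `S`, as a path in `S`. -/
def restrictPath {X : Type*} [TopologicalSpace X] {S : Set X} {x y : X} (γ : Path x y)
    (h : ∀ t, γ t ∈ S) (hx : x ∈ S) (hy : y ∈ S) : Path (⟨x, hx⟩ : S) ⟨y, hy⟩ where
  toFun t := ⟨γ t, h t⟩
  continuous_toFun := γ.continuous.subtype_mk h
  source' := Subtype.ext γ.source
  target' := Subtype.ext γ.target

/-! ### The Hawaiian Earring (in `ℂ = ℝ²`) -/

/-- The circle `C_n` of radius `1/n` centred at `(1/n, 0)`. -/
def circ (n : ℕ+) : Set ℂ := Metric.sphere (1 / (n : ℂ)) (1 / (n : ℝ))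

/-- The Hawaiian Earring. -/
def earring : Set ℂ := ⋃ n : ℕ+, circ n

theorem mem_circ (n : ℕ+) (z : ℂ) : z ∈ circ n ↔ (n : ℝ) * (z.re ^ 2 + z.im ^ 2) = 2 * z.re := by
  have hn : (0 : ℝ) < n := by exact_mod_cast n.pos
  have h1 : (1 / (n : ℂ)) = ((1 / (n : ℝ) : ℝ) : ℂ) := by push_cast; rfl
  rw [circ, mem_sphere_iff_norm, ← sq_eq_sq₀ (norm_nonneg _) (by positivity), h1,
    ← Complex.normSq_eq_norm_sq, Complex.normSq_apply]
  simp only [Complex.sub_re, Complex.sub_im, Complex.ofReal_re, Complex.ofReal_im]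
  have h2 : (n : ℝ) * (1 / n) = 1 := by field_simp
  constructor
  · intro h
    linear_combination (n : ℝ) * h + 2 * z.re * h2
  · intro h
    have h3 : (n : ℝ) * ((z.re - 1 / n) * (z.re - 1 / n) + (z.im - 0) * (z.im - 0))
        = n * (1 / (n : ℝ)) ^ 2 := by
      linear_combination h - 2 * z.re * h2
    exact mul_left_cancel₀ hn.ne' h3

/-- `exp (-2πit)`: one clockwise turn along the unit circle. -/
def turn (t : unitInterval) : ℂ := Complex.exp (((-(2 * Real.pi * (t : ℝ)) : ℝ) : ℂ) * Complex.I)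

theorem continuous_turn : Continuous turn := by unfold turn; fun_prop

theorem norm_turn (t : unitInterval) : ‖turn t‖ = 1 := Complex.norm_exp_ofReal_mul_I _

theorem turn_zero : turn 0 = 1 := by simp [turn]

theorem turn_one : turn 1 = 1 := by
  have : ((-(2 * Real.pi * ((1 : unitInterval) : ℝ)) : ℝ) : ℂ) * Complex.I
      = -(2 * Real.pi * Complex.I) := by push_cast [Set.Icc.coe_one]; ring
  rw [turn, this, Complex.exp_neg, Complex.exp_two_pi_mul_I, inv_one]

theorem zero_mem_circ (n : ℕ+) : (0 : ℂ) ∈ circ n := by simp [mem_circ]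

/-- The base point `b₀ = (0, 0)` of the earring. -/
def origin : earring := ⟨0, Set.mem_iUnion.2 ⟨1, zero_mem_circ 1⟩⟩

theorem ell_mem (n : ℕ+) (t : unitInterval) : (1 / (n : ℂ)) * (1 - turn t) ∈ circ n := by
  have hn : (0 : ℝ) < n := by exact_mod_cast n.pos
  rw [circ, mem_sphere_iff_norm]
  have : (1 / (n : ℂ)) * (1 - turn t) - 1 / n = -(1 / n * turn t) := by ring
  rw [this, norm_neg, norm_mul, norm_turn]
  simp

/-- The loop `ℓ_n(t) = ((1 - cos 2πt)/n, (sin 2πt)/n)`, which runs once around `C_n`. -/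
def ell (n : ℕ+) : Path origin origin where
  toFun t := ⟨(1 / (n : ℂ)) * (1 - turn t), Set.mem_iUnion.2 ⟨n, ell_mem n t⟩⟩
  continuous_toFun := by
    have := continuous_turn
    exact Continuous.subtype_mk (by fun_prop) _
  source' := by simp [turn_zero, origin]
  target' := by simp [turn_one, origin]

/-! ### The pair of pants

All `P_n` are copies of the disk of radius `4` around `0` minus the two open disks of radius `1`
around `2i` and `-2i`.  The boundary circles are parametrized clockwise, starting at their
leftmost points `a = -4`, `b = 2i - 1`, `c = -2i - 1`; the arcs are the segments `[a, b]`, `[a, c]`.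
The index `j : Fin 2` stands for `j + 1 ∈ {1, 2}`. -/

/-- The centres `2i`, `-2i` of the two removed disks. -/
def legCenter (j : Fin 2) : ℂ := if j = 0 then 2 * Complex.I else -(2 * Complex.I)

/-- The pair of pants. -/
def pants : Set ℂ := {z | ‖z‖ ≤ 4 ∧ ∀ j, 1 ≤ ‖z - legCenter j‖}

theorem legCenter_re (j : Fin 2) : (legCenter j).re = 0 := by
  unfold legCenter; split_ifs <;> simp

theorem norm_legCenter (j : Fin 2) : ‖legCenter j‖ = 2 := by
  unfold legCenter; split_ifs <;> simp

theorem norm_legCenter_sub {i j : Fin 2} (h : i ≠ j) : ‖legCenter i - legCenter j‖ = 4 := by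
  have e1 : (2 : ℂ) * Complex.I - -(2 * Complex.I) = 4 * Complex.I := by ring
  have e2 : -((2 : ℂ) * Complex.I) - 2 * Complex.I = -(4 * Complex.I) := by ring
  fin_cases i <;> fin_cases j <;> simp_all [legCenter]

/-- `a`, the base point of the outer boundary. -/
def waistPt : pants := ⟨-4, by simp, fun j => by
  refine le_trans ?_ (Complex.abs_re_le_norm _)
  simp [legCenter_re]⟩

theorem leg_mem (j : Fin 2) (w : ℂ) (hw : ‖w‖ = 1) : legCenter j - w ∈ pants := by
  refine ⟨?_, fun i => ?_⟩
  · have := norm_sub_le (legCenter j) w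
    rw [norm_legCenter, hw] at this
    linarith
  · by_cases h : j = i
    · subst h; simp [hw]
    · have h1 := norm_sub_norm_le (legCenter j - legCenter i) w
      rw [norm_legCenter_sub h, hw] at h1
      have h2 : legCenter j - w - legCenter i = legCenter j - legCenter i - w := by ring
      rw [h2]; linarith

theorem waist_mem (w : ℂ) (hw : ‖w‖ = 1) : -(4 * w) ∈ pants := by
  have h4 : ‖-(4 * w)‖ = 4 := by simp [hw]
  refine ⟨h4.le, fun i => ?_⟩
  have h1 := norm_sub_norm_le (-(4 * w)) (legCenter i)
  rw [h4, norm_legCenter] at h1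
  linarith

/-- `b` (for `j = 0`) and `c` (for `j = 1`), the base points of the inner boundary circles. -/
def legPt (j : Fin 2) : pants := ⟨legCenter j - 1, leg_mem j 1 (by simp)⟩

/-- The clockwise parametrization `α` of the outer boundary circle. -/
def waist : Path waistPt waistPt where
  toFun t := ⟨-(4 * turn t), waist_mem _ (norm_turn t)⟩
  continuous_toFun := by
    have := continuous_turn
    exact Continuous.subtype_mk (by fun_prop) _
  source' := by simp [turn_zero, waistPt]
  target' := by simp [turn_one, waistPt]

/-- The clockwise parametrizations `β` (for `j = 0`) and `γ` (for `j = 1`) of the inner boundary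
circles. -/
def leg (j : Fin 2) : Path (legPt j) (legPt j) where
  toFun t := ⟨legCenter j - turn t, leg_mem j _ (norm_turn t)⟩
  continuous_toFun := by
    have := continuous_turn
    exact Continuous.subtype_mk (by fun_prop) _
  source' := by simp [turn_zero, legPt]
  target' := by simp [turn_one, legPt]

theorem arc_mem (j : Fin 2) (s : unitInterval) :
    (-4 : ℂ) + (s : ℝ) * (legCenter j + 3) ∈ pants := by
  obtain ⟨h0, h1⟩ := s.2
  refine ⟨?_, fun i => ?_⟩
  · have e : (-4 : ℂ) + (s : ℝ) * (legCenter j + 3)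
        = ((1 - s : ℝ) : ℂ) * (-4) + (s : ℝ) * (legCenter j - 1) := by push_cast; ring
    have hl : ‖legCenter j - 1‖ ≤ 4 := (legPt j).2.1
    rw [e]
    refine (norm_add_le _ _).trans ?_
    rw [norm_mul, norm_mul, Complex.norm_real, Complex.norm_real, Real.norm_of_nonneg h0,
      Real.norm_of_nonneg (by linarith : (0 : ℝ) ≤ 1 - s)]
    norm_num
    nlinarith
  · refine le_trans ?_ (Complex.abs_re_le_norm _)
    simp only [Complex.sub_re, Complex.add_re, Complex.re_ofReal_mul, legCenter_re]
    rw [abs_of_nonpos] <;> norm_num <;> linarith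

/-- The arcs `A_1` (from `a` to `b`) and `A_2` (from `a` to `c`). -/
def arc (j : Fin 2) : Path waistPt (legPt j) where
  toFun s := ⟨(-4 : ℂ) + (s : ℝ) * (legCenter j + 3), arc_mem j s⟩
  continuous_toFun := Continuous.subtype_mk (by fun_prop) _
  source' := by simp [waistPt]
  target' := by
    apply Subtype.ext
    simp only [legPt, Set.Icc.coe_one]
    push_cast; ring

/-! ### The Hawaiian Pants -/

/-- `2n` for `j = 0` and `2n + 1` for `j = 1`. -/
def legIndex (n : ℕ+) (j : Fin 2) : ℕ+ := ⟨2 * n + j, by have := n.pos; omega⟩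

/-- The identifications `f_n ∘ α_n = ℓ_n`, `f_n ∘ β_n = ℓ_{2n}`, `f_n ∘ γ_n = ℓ_{2n+1}`. -/
inductive Glue : (earring ⊕ (Σ _ : ℕ+, pants)) → (earring ⊕ (Σ _ : ℕ+, pants)) → Prop
  | waist (n : ℕ+) (t : unitInterval) : Glue (Sum.inr ⟨n, waist t⟩) (Sum.inl (ell n t))
  | leg (n : ℕ+) (j : Fin 2) (t : unitInterval) :
      Glue (Sum.inr ⟨n, leg j t⟩) (Sum.inl (ell (legIndex n j) t))

/-- The Hawaiian Pants `ℙ`: the quotient of the disjoint union of the earring and of countably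
many pairs of pants by the above identifications, with the quotient topology. -/
def PantsSpace : Type := Quot Glue

instance : TopologicalSpace PantsSpace := inferInstanceAs (TopologicalSpace (Quot Glue))

/-- The canonical map of the earring into `ℙ`. -/
def ofEarring (p : earring) : PantsSpace := Quot.mk Glue (Sum.inl p)

/-- The canonical map of the `n`-th pair of pants into `ℙ`. -/
def ofPants (n : ℕ+) (z : pants) : PantsSpace := Quot.mk Glue (Sum.inr ⟨n, z⟩)

theorem continuous_ofEarring : Continuous ofEarring :=
  continuous_quot_mk.comp continuous_inl

theorem continuous_ofPants (n : ℕ+) : Continuous (ofPants n) :=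
  continuous_quot_mk.comp (continuous_inr.comp continuous_sigmaMk)

/-- The base point `b₀` of `ℙ`. -/
def base : PantsSpace := ofEarring origin

theorem ofPants_waistPt (n : ℕ+) : ofPants n waistPt = base := by
  have h := Quot.sound (Glue.waist n 0)
  rw [waist.source, (ell n).source] at h
  exact h

theorem ofPants_legPt (n : ℕ+) (j : Fin 2) : ofPants n (legPt j) = base := by
  have h := Quot.sound (Glue.leg n j 0)
  rw [(leg j).source, (ell _).source] at h
  exact h

/-- The loop `ℓ_n` in `ℙ`. -/
def ellLoop (n : ℕ+) : Path base base := (ell n).map continuous_ofEarring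

/-- The loop `ρ_{n,j+1}` in `ℙ`, which runs once along the image of the arc `A_{n,j+1}`. -/
def rhoLoop (n : ℕ+) (j : Fin 2) : Path base base :=
  ((arc j).map (continuous_ofPants n)).cast (ofPants_waistPt n).symm (ofPants_legPt n j).symm

/-- The image in `ℙ` of the circle `C_n`. -/
def circle (n : ℕ+) : Set PantsSpace := {x | ∃ p : earring, (p : ℂ) ∈ circ n ∧ ofEarring p = x}

/-- The image `B_{n,j+1}` in `ℙ` of the arc `A_{n,j+1}`. -/
def arcCircle (n : ℕ+) (j : Fin 2) : Set PantsSpace := ofPants n '' Set.range (arc j)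

/-- The union of the base point, the `B_{i,1}` and `B_{i,2}` with `i < n`, and the `C_i` with
`i ∈ J`. -/
def bouquet (n : ℕ) (J : Set ℕ+) : Set PantsSpace :=
  {base} ∪ (⋃ i : ℕ+, ⋃ _ : (i : ℕ) < n, ⋃ j : Fin 2, arcCircle i j) ∪ ⋃ i ∈ J, circle i

/-- `ℍ⁺_n`, the union of the `B_{i,j}` with `i < n` and of the `C_i` with `i ≥ n`. -/
def HPlus (n : ℕ) : Set PantsSpace := bouquet n {i | n ≤ (i : ℕ)}

/-- `ℍ⁺_{n,k}`, the union of the `B_{i,j}` with `i < n` and of the `C_i` with `n ≤ i ≤ k`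
(and of `{b₀}`). -/
def HPlusFin (n k : ℕ) : Set PantsSpace := bouquet n {i | n ≤ (i : ℕ) ∧ (i : ℕ) ≤ k}

theorem base_mem_bouquet (n : ℕ) (J : Set ℕ+) : base ∈ bouquet n J := Or.inl (Or.inl rfl)

/-- The base point of `ℍ⁺_n`. -/
def HPlus.base (n : ℕ) : HPlus n := ⟨HawaiianPants.base, base_mem_bouquet _ _⟩

/-- The base point of `ℍ⁺_{n,k}`. -/
def HPlusFin.base (n k : ℕ) : HPlusFin n k := ⟨HawaiianPants.base, base_mem_bouquet _ _⟩

/-- `ι_{n#}`, induced by the inclusion of `ℍ⁺_n` into `ℙ`. -/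
def inclHom (n : ℕ) : PiOne (HPlus n) (HPlus.base n) →* PiOne PantsSpace base :=
  PiOne.map ⟨Subtype.val, continuous_subtype_val⟩ rfl

/-! ### The retractions `r_{n,k}` -/

/-- The preimage, in the disjoint union of the earring and the pairs of pants, of the union of the
image of `S ⊆ ℍ` (with `b₀ ∈ S`) and of the `B_{i,j}` with `i < n`. -/
def MemAux (n : ℕ) (S : Set earring) : (earring ⊕ (Σ _ : ℕ+, pants)) → Prop
  | Sum.inl p => p ∈ S
  | Sum.inr ⟨m, z⟩ => ((m : ℕ) < n ∧ ∃ j, z ∈ Set.range (arc j)) ∨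
      (∃ t, waist t = z ∧ ell m t ∈ S) ∨ ∃ j t, leg j t = z ∧ ell (legIndex m j) t ∈ S

theorem arc_eq_waist {j : Fin 2} {s t : unitInterval} (h : arc j s = waist t) : turn t = 1 := by
  have h' : (-4 : ℂ) + (s : ℝ) * (legCenter j + 3) = -(4 * turn t) := congrArg Subtype.val h
  obtain ⟨h0, h1⟩ := s.2
  have hs : (s : ℝ) = 0 := by
    have hn : Complex.normSq ((-4 : ℂ) + (s : ℝ) * (legCenter j + 3)) = 16 := by
      rw [h', Complex.normSq_eq_norm_sq, norm_neg, norm_mul, norm_turn]; norm_num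
    have him : (legCenter j).im ^ 2 = 4 := by
      have := Complex.normSq_apply (legCenter j)
      rw [Complex.normSq_eq_norm_sq, norm_legCenter, legCenter_re] at this
      linarith
    rw [Complex.normSq_apply] at hn
    simp only [Complex.add_re, Complex.add_im, Complex.re_ofReal_mul, Complex.im_ofReal_mul,
      legCenter_re] at hn
    norm_num at hn
    by_contra hs
    have hpos : 0 < (s : ℝ) := lt_of_le_of_ne h0 (Ne.symm hs)
    nlinarith
  rw [hs] at h'
  push_cast at h'
  linear_combination (1 / 4 : ℂ) * h'

theorem arc_eq_leg {i j : Fin 2} {s t : unitInterval} (h : arc i s = leg j t) : turn t = 1 := by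
  have h' : (-4 : ℂ) + (s : ℝ) * (legCenter i + 3) = legCenter j - turn t :=
    congrArg Subtype.val h
  obtain ⟨h0, h1⟩ := s.2
  have hre := congrArg Complex.re h'
  simp only [Complex.add_re, Complex.sub_re, Complex.re_ofReal_mul, legCenter_re] at hre
  norm_num at hre
  have hn : (turn t).re ^ 2 + (turn t).im ^ 2 = 1 := by
    have := Complex.normSq_apply (turn t)
    rw [Complex.normSq_eq_norm_sq, norm_turn] at this
    linarith
  have h1' : 1 ≤ (turn t).re := by linarith
  apply Complex.ext
  · simp; nlinarith [sq_nonneg (turn t).im]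
  · simp; nlinarith [sq_nonneg (turn t).im]

theorem waist_ne_leg (j : Fin 2) (s t : unitInterval) : waist s ≠ leg j t := by
  intro h
  have h' : -(4 * turn s) = legCenter j - turn t := congrArg Subtype.val h
  have h1 : ‖-(4 * turn s)‖ = 4 := by simp [norm_turn]
  have h2 := norm_sub_le (legCenter j) (turn t)
  rw [← h', h1, norm_legCenter, norm_turn] at h2
  linarith

theorem waist_eq {s t : unitInterval} (h : waist s = waist t) : turn s = turn t := by
  have h' : -(4 * turn s) = -(4 * turn t) := congrArg Subtype.val h
  linear_combination (-1 / 4 : ℂ) * h'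

theorem leg_eq {i j : Fin 2} {s t : unitInterval} (h : leg i s = leg j t) :
    i = j ∧ turn s = turn t := by
  have h' : legCenter i - turn s = legCenter j - turn t := congrArg Subtype.val h
  by_cases hij : i = j
  · subst hij
    exact ⟨rfl, by linear_combination -h'⟩
  · have h1 : legCenter i - legCenter j = turn s - turn t := by linear_combination h'
    have h2 := norm_sub_le (turn s) (turn t)
    rw [← h1, norm_legCenter_sub hij, norm_turn, norm_turn] at h2
    norm_num at h2

theorem ell_congr (n : ℕ+) {s t : unitInterval} (h : turn s = turn t) : ell n s = ell n t :=
  Subtype.ext (by change (1 / (n : ℂ)) * (1 - turn s) = (1 / (n : ℂ)) * (1 - turn t); rw [h])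

theorem ell_eq_origin (n : ℕ+) {t : unitInterval} (h : turn t = 1) : ell n t = origin :=
  Subtype.ext (by change (1 / (n : ℂ)) * (1 - turn t) = 0; rw [h]; ring)

theorem memAux_glue (n : ℕ) (S : Set earring) (hS : origin ∈ S)
    (x y : earring ⊕ (Σ _ : ℕ+, pants)) (h : Glue x y) : MemAux n S x = MemAux n S y := by
  apply propext
  cases h with
  | waist m t =>
    constructor
    · rintro (⟨-, j, s, hs⟩ | ⟨s, hs, hS'⟩ | ⟨j, s, hs, -⟩)
      · exact (ell_eq_origin m (arc_eq_waist hs)).symm ▸ hS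
      · exact ell_congr m (waist_eq hs) ▸ hS'
      · exact absurd hs.symm (waist_ne_leg j t s)
    · exact fun h => Or.inr (Or.inl ⟨t, rfl, h⟩)
  | leg m j t =>
    constructor
    · rintro (⟨-, i, s, hs⟩ | ⟨s, hs, -⟩ | ⟨i, s, hs, hS'⟩)
      · exact (ell_eq_origin _ (arc_eq_leg hs)).symm ▸ hS
      · exact absurd hs (waist_ne_leg j s t)
      · obtain ⟨rfl, hst⟩ := leg_eq hs
        exact ell_congr _ hst ▸ hS'
    · exact fun h => Or.inr (Or.inr ⟨j, t, rfl, h⟩)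

/-- The union of the image of `S ⊆ ℍ` and of the `B_{i,j}`, `i < n`. -/
def unionArcs (n : ℕ) (S : Set earring) : Set PantsSpace :=
  ofEarring '' S ∪ ⋃ i : ℕ+, ⋃ _ : (i : ℕ) < n, ⋃ j : Fin 2, arcCircle i j

theorem mk_mem_union (n : ℕ) (S : Set earring) (hS : origin ∈ S)
    (x : earring ⊕ (Σ _ : ℕ+, pants)) : Quot.mk Glue x ∈ unionArcs n S ↔ MemAux n S x := by
  have key : ∀ x y, (Quot.mk Glue x : PantsSpace) = Quot.mk Glue y → (MemAux n S x ↔ MemAux n S y) :=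
    fun x y h => iff_of_eq (congrArg (Quot.lift (MemAux n S) (memAux_glue n S hS)) h)
  constructor
  · rintro (⟨p, hp, h⟩ | h)
    · exact (key _ _ h).1 hp
    · replace h : Quot.mk Glue x ∈ ⋃ i : ℕ+, ⋃ _ : (i : ℕ) < n, ⋃ j : Fin 2, arcCircle i j := h
      obtain ⟨i, h⟩ := Set.mem_iUnion.1 h
      obtain ⟨hi, h⟩ := Set.mem_iUnion.1 h
      obtain ⟨j, z, hz, h⟩ := Set.mem_iUnion.1 h
      exact (key _ _ h).1 (Or.inl ⟨hi, j, hz⟩)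
  · match x with
    | Sum.inl p => exact fun h => Or.inl ⟨p, h, rfl⟩
    | Sum.inr ⟨m, z⟩ =>
      rintro (⟨hm, j, hz⟩ | ⟨t, rfl, h⟩ | ⟨j, t, rfl, h⟩)
      · exact Or.inr (Set.mem_iUnion.2 ⟨m, Set.mem_iUnion.2 ⟨hm, Set.mem_iUnion.2 ⟨j, z, hz, rfl⟩⟩⟩)
      · exact Or.inl ⟨_, h, (Quot.sound (Glue.waist m t)).symm⟩
      · exact Or.inl ⟨_, h, (Quot.sound (Glue.leg m j t)).symm⟩

theorem ofEarring_mem_union {n : ℕ} {S : Set earring} (hS : origin ∈ S) {p : earring} :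
    ofEarring p ∈ unionArcs n S ↔ p ∈ S := mk_mem_union n S hS (Sum.inl p)

theorem isClosed_union (n : ℕ) (S : Set earring) (hS : origin ∈ S) (hc : IsClosed S) :
    IsClosed (unionArcs n S) := by
  have hq : IsClosed (Quot.mk Glue ⁻¹' (unionArcs n S)) := by
    have he : Quot.mk Glue ⁻¹' (unionArcs n S) = {x | MemAux n S x} :=
      Set.ext fun x => mk_mem_union n S hS x
    rw [he, isClosed_sum_iff]
    refine ⟨hc, ?_⟩
    rw [isClosed_sigma_iff]
    intro m
    have hpath : ∀ {a b : pants} (γ : Path a b) (T : Set unitInterval), IsClosed T →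
        IsClosed (γ '' T) := fun γ T hT => (hT.isCompact.image γ.continuous).isClosed
    have e : ((fun z : pants => (⟨m, z⟩ : Σ _ : ℕ+, pants)) ⁻¹' (Sum.inr ⁻¹' {x | MemAux n S x}) :
        Set pants)
        = {z | (m : ℕ) < n ∧ z ∈ ⋃ j : Fin 2, arc j '' Set.univ} ∪
          (waist '' (ell m ⁻¹' S) ∪ ⋃ j : Fin 2, leg j '' (ell (legIndex m j) ⁻¹' S)) := by
      ext z
      simp only [Set.mem_preimage, Set.mem_ofPred_eq, MemAux, Set.mem_union, Set.mem_iUnion,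
        Set.mem_image, Set.mem_range, Set.mem_univ, true_and]
      refine or_congr Iff.rfl (or_congr ?_ ?_)
      · exact exists_congr fun t => and_comm
      · exact exists_congr fun j => exists_congr fun t => and_comm
    rw [e]
    refine IsClosed.union ?_ (IsClosed.union ?_ ?_)
    · by_cases hm : (m : ℕ) < n
      · simp only [hm, true_and]
        exact isClosed_iUnion_of_finite fun j => hpath (arc j) _ isClosed_univ
      · simp [hm]
    · exact hpath waist _ (hc.preimage (ell m).continuous)
    · exact isClosed_iUnion_of_finite fun j => hpath (leg j) _ (hc.preimage (ell _).continuous)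
  exact isQuotientMap_quot_mk.isClosed_preimage.1 hq

theorem bouquet_eq_union (n : ℕ) (J : Set ℕ+) :
    bouquet n J = unionArcs n {p | p = origin ∨ ∃ i ∈ J, (p : ℂ) ∈ circ i} := by
  ext x
  simp only [bouquet, unionArcs, circle, base, Set.mem_union, Set.mem_singleton_iff, Set.mem_iUnion,
    Set.mem_image, Set.mem_ofPred_eq, exists_prop]
  constructor
  · rintro ((rfl | h) | ⟨i, hi, p, hp, rfl⟩)
    · exact Or.inl ⟨origin, Or.inl rfl, rfl⟩
    · exact Or.inr h
    · exact Or.inl ⟨p, Or.inr ⟨i, hi, hp⟩, rfl⟩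
  · rintro (⟨p, rfl | ⟨i, hi, hp⟩, rfl⟩ | h)
    · exact Or.inl (Or.inl rfl)
    · exact Or.inr ⟨i, hi, p, hp, rfl⟩
    · exact Or.inl (Or.inr h)

theorem isClosed_HPlusFin (n k : ℕ) : IsClosed (HPlusFin n k) := by
  rw [HPlusFin, bouquet_eq_union]
  refine isClosed_union _ _ (Or.inl rfl) ?_
  have hfin : {i : ℕ+ | n ≤ (i : ℕ) ∧ (i : ℕ) ≤ k}.Finite :=
    (Set.finite_Iic k).preimage PNat.coe_injective.injOn |>.subset fun i hi => hi.2
  have e : {p : earring | p = origin ∨ ∃ i ∈ {i : ℕ+ | n ≤ (i : ℕ) ∧ (i : ℕ) ≤ k},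
      (p : ℂ) ∈ circ i} = {origin} ∪ ⋃ i ∈ {i : ℕ+ | n ≤ (i : ℕ) ∧ (i : ℕ) ≤ k},
        (Subtype.val ⁻¹' circ i) := by
    ext p; simp
  rw [e]
  exact isClosed_singleton.union (hfin.isClosed_biUnion fun i _ =>
    Metric.isClosed_sphere.preimage continuous_subtype_val)

/-- The part of the earring that lies on the circles `C_i` with `i ≥ N`. -/
def tailSet (N : ℕ) : Set earring :=
  {p | (N : ℝ) * ((p : ℂ).re ^ 2 + (p : ℂ).im ^ 2) ≤ 2 * (p : ℂ).re}

theorem mem_tail_of_mem_circ {N : ℕ} {i : ℕ+} (hi : N ≤ (i : ℕ)) {p : earring}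
    (hp : (p : ℂ) ∈ circ i) : p ∈ tailSet N := by
  rw [mem_circ] at hp
  have : (N : ℝ) ≤ i := by exact_mod_cast hi
  change (N : ℝ) * ((p : ℂ).re ^ 2 + (p : ℂ).im ^ 2) ≤ 2 * (p : ℂ).re
  rw [← hp]
  gcongr

theorem eq_origin_of_mem_tail {N : ℕ} {i : ℕ+} (hi : (i : ℕ) < N) {p : earring}
    (hp : (p : ℂ) ∈ circ i) (ht : p ∈ tailSet N) : p = origin := by
  rw [mem_circ] at hp
  have h1 : (i : ℝ) < N := by exact_mod_cast hi
  have h2 : (N : ℝ) * ((p : ℂ).re ^ 2 + (p : ℂ).im ^ 2) ≤ 2 * (p : ℂ).re := ht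
  have h3 : (p : ℂ).re ^ 2 + (p : ℂ).im ^ 2 = 0 := by
    have : 0 ≤ (p : ℂ).re ^ 2 + (p : ℂ).im ^ 2 := by positivity
    rw [← hp] at h2
    nlinarith
  apply Subtype.ext
  apply Complex.ext
  · change (p : ℂ).re = 0; nlinarith [sq_nonneg (p : ℂ).re, sq_nonneg (p : ℂ).im]
  · change (p : ℂ).im = 0; nlinarith [sq_nonneg (p : ℂ).re, sq_nonneg (p : ℂ).im]

theorem origin_mem_tail (N : ℕ) : origin ∈ tailSet N :=
  show (N : ℝ) * ((0 : ℂ).re ^ 2 + (0 : ℂ).im ^ 2) ≤ 2 * (0 : ℂ).re by simp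

theorem isClosed_tail (N : ℕ) : IsClosed (tailSet N) := by
  unfold tailSet
  exact isClosed_le (by fun_prop) (by fun_prop)

open Classical in
/-- The underlying function of `r_{n,k}`. -/
def retrFun (n k : ℕ) (x : HPlus n) : HPlusFin n k :=
  if h : (x : PantsSpace) ∈ HPlusFin n k then ⟨x, h⟩ else HPlusFin.base n k

theorem continuous_retrFun (n k : ℕ) : Continuous (retrFun n k) := by
  set A : Set (HPlus n) := Subtype.val ⁻¹' HPlusFin n k with hA
  set B : Set (HPlus n) := Subtype.val ⁻¹' unionArcs 0 (tailSet (max n (k + 1))) with hB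
  have hAc : IsClosed A := (isClosed_HPlusFin n k).preimage continuous_subtype_val
  have hBc : IsClosed B :=
    (isClosed_union _ _ (origin_mem_tail _) (isClosed_tail _)).preimage continuous_subtype_val
  have hcov : A ∪ B = Set.univ := by
    refine Set.eq_univ_of_forall fun ⟨x, hx⟩ => ?_
    rcases hx with hx | hx
    · exact Or.inl (Or.inl hx)
    · simp only [Set.mem_iUnion, Set.mem_ofPred_eq, exists_prop] at hx
      obtain ⟨i, hi, hx⟩ := hx
      by_cases hk : (i : ℕ) ≤ k
      · exact Or.inl (Or.inr (Set.mem_biUnion (show i ∈ {i : ℕ+ | _} from ⟨hi, hk⟩) hx))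
      · obtain ⟨p, hp, rfl⟩ := hx
        exact Or.inr (Or.inl ⟨p, mem_tail_of_mem_circ (max_le hi (by omega)) hp, rfl⟩)
  have hBval : ∀ x ∈ B, retrFun n k x = HPlusFin.base n k := by
    rintro ⟨x, hx⟩ hxB
    unfold retrFun
    split_ifs with h
    · apply Subtype.ext
      change x = base
      change x ∈ HPlusFin n k at h
      change x ∈ unionArcs 0 _ at hxB
      rcases hxB with ⟨p, hp, rfl⟩ | hxB
      · rw [HPlusFin, bouquet_eq_union, ofEarring_mem_union (Or.inl rfl)] at h
        rcases h with rfl | ⟨i, hi, hpi⟩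
        · rfl
        · rw [eq_origin_of_mem_tail (lt_max_of_lt_right (Nat.lt_succ_of_le hi.2)) hpi hp]
          rfl
      · simp at hxB
    · rfl
  have hcA : ContinuousOn (retrFun n k) A := by
    rw [continuousOn_iff_continuous_domRestrict, continuous_induced_rng]
    have : Subtype.val ∘ A.domRestrict (retrFun n k) = fun x : A => ((x : HPlus n) : PantsSpace) := by
      funext ⟨x, hx⟩
      have hx' : (x : PantsSpace) ∈ HPlusFin n k := hx
      simp [retrFun, hx']
    rw [this]
    fun_prop
  have hcB : ContinuousOn (retrFun n k) B := continuousOn_const.congr hBval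
  rw [← continuousOn_univ, ← hcov]
  exact hcA.union_of_isClosed hcB hAc hBc

/-- The retraction `r_{n,k} : ℍ⁺_n → ℍ⁺_{n,k}`, which is the identity on `ℍ⁺_{n,k}` and maps the
remaining circles to `b₀`. -/
def retr (n k : ℕ) : C(HPlus n, HPlusFin n k) := ⟨retrFun n k, continuous_retrFun n k⟩

theorem retr_base (n k : ℕ) : retr n k (HPlus.base n) = HPlusFin.base n k := by
  change retrFun n k _ = _
  unfold retrFun
  split_ifs <;> rfl

/-- `r_{n,k#}`. -/
def retrHom (n k : ℕ) :
    PiOne (HPlus n) (HPlus.base n) →* PiOne (HPlusFin n k) (HPlusFin.base n k) :=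
  PiOne.map (retr n k) (retr_base n k)

/-! ### Words -/

/-- The symbols `ρ_{i,j+1}` and `ℓ_i`. -/
inductive Gen : Type
  | rho (i : ℕ+) (j : Fin 2) : Gen
  | ell (i : ℕ+) : Gen
  deriving DecidableEq

/-- The symbols available at level `(n, k)`: `ρ_{i,j}` with `i < n` and `ℓ_i` with `n ≤ i ≤ k`. -/
def Gen.Mem (n k : ℕ) : Gen → Prop
  | .rho i _ => (i : ℕ) < n
  | .ell i => n ≤ (i : ℕ) ∧ (i : ℕ) ≤ k

/-- The set of symbols available at level `(n, k)`. -/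
abbrev Symb (n k : ℕ) : Type := {g : Gen // g.Mem n k}

/-- The free monoid `W⁺_{n,k}` of all finite words in the letters `g^{±1}`, where
`(g, true)` is the letter `g` and `(g, false)` is the letter `g⁻¹`. -/
abbrev Word (n k : ℕ) : Type := FreeMonoid (Symb n k × Bool)

open Classical in
/-- The homomorphism `W⁺_{n,k} → W⁺_{n',k'}` that deletes from a word every letter which is not
available at level `(n', k')`. -/
def deleteLetters (n k n' k' : ℕ) : Word n k →* Word n' k' :=
  FreeMonoid.lift fun a =>
    if h : a.1.1.Mem n' k' then FreeMonoid.of (⟨a.1.1, h⟩, a.2) else 1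

/-- The loop in `ℙ` denoted by a symbol. -/
def Gen.loop : Gen → Path base base
  | .rho i j => rhoLoop i j
  | .ell i => ellLoop i

theorem Gen.loop_mem {n k : ℕ} (g : Symb n k) (t : unitInterval) :
    g.1.loop t ∈ HPlusFin n k := by
  obtain ⟨g, hg⟩ := g
  cases g with
  | rho i j =>
    exact Or.inl (Or.inr (Set.mem_iUnion.2 ⟨i, Set.mem_iUnion.2 ⟨hg, Set.mem_iUnion.2
      ⟨j, arc j t, ⟨t, rfl⟩, rfl⟩⟩⟩))
  | ell i =>
    exact Or.inr (Set.mem_biUnion (show i ∈ {i : ℕ+ | _} from hg) ⟨HawaiianPants.ell i t, ell_mem i t, rfl⟩)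

/-- The class in `π₁(ℍ⁺_{n,k}, b₀)` of the loop denoted by a symbol. -/
def genClass {n k : ℕ} (g : Symb n k) : PiOne (HPlusFin n k) (HPlusFin.base n k) :=
  loopClass (restrictPath g.1.loop (Gen.loop_mem g) _ _)

/-- The homomorphism from the free group on the symbols `ρ_{i,j}` (`i < n`) and `ℓ_i`
(`n ≤ i ≤ k`) to `π₁(ℍ⁺_{n,k}, b₀)` with `ρ_{i,j} ↦ [ρ_{i,j}]` and `ℓ_i ↦ [ℓ_i]`. -/
def evalHom (n k : ℕ) : FreeGroup (Symb n k) →* PiOne (HPlusFin n k) (HPlusFin.base n k) :=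
  FreeGroup.lift genClass

open Classical in
/-- `h_{n,k}`, the inverse of the (bijective) homomorphism `evalHom n k`, with reduced words as
values. -/
def reducedWord (n k : ℕ) (y : PiOne (HPlusFin n k) (HPlusFin.base n k)) : Word n k :=
  FreeMonoid.ofList (FreeGroup.toWord (Function.invFun (evalHom n k) y))

/-- `g_{n,k} = h_{n,k} ∘ r_{n,k#}`, with reduced words as values. -/
def gWord (n k : ℕ) (x : PiOne (HPlus n) (HPlus.base n)) : Word n k :=
  reducedWord n k (retrHom n k x)

/-- The stabilized word `ω_{n,m}(x)`: the eventual value, as `k → ∞`, of the word that arises from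
the reduced word `g_{n,k}(x)` by deleting (without any cancellation) all letters `ℓ_i^{±1}` with
`m < i ≤ k`. -/
def omega (n m : ℕ) (x : PiOne (HPlus n) (HPlus.base n)) : Word n m :=
  Classical.epsilon fun w => ∀ᶠ k in atTop, deleteLetters n k n m (gWord n k x) = w

/-- The bond `E_n : W⁺_{n+2,n+1} → W⁺_{n+1,n}`, which deletes the letters `ρ_{n+1,j}^{±1}`. -/
def bond (n : ℕ+) : Word ((n + 1 : ℕ+) + 1 : ℕ) (n + 1 : ℕ+) →* Word (n + 1 : ℕ) n :=
  deleteLetters _ _ _ _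

/-- The inverse limit of `W⁺_{2,1} ← W⁺_{3,2} ← W⁺_{4,3} ← ⋯` along the bonds `E_1, E_2, …`. -/
def WordLimit : Type :=
  {w : (n : ℕ+) → Word (n + 1 : ℕ) n // ∀ n : ℕ+, bond n (w (n + 1)) = w n}

/-- `χ_n(ι_{n+1#}(x)) = ω_{n+1,n}(x)` for all `n ≥ 1` and all `x ∈ π₁(ℍ⁺_{n+1}, b₀)`. -/
def IsLabelling (χ : PiOne PantsSpace base → WordLimit) : Prop :=
  ∀ (n : ℕ+) (x : PiOne (HPlus (n + 1)) (HPlus.base (n + 1))),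
    (χ (inclHom (n + 1) x)).1 n = omega (n + 1) n x

end HawaiianPants

end

open HawaiianPants Filter

/-! ### Null-homotopies from trees, and the lifting criterion for bouquets of circles -/

noncomputable section

namespace HawaiianPants

open Filter Topology

/-! ### Loops coded by a height function -/

/-! Everything is read off from lifts of loops to Cayley trees. The Cayley tree of the free group on
the circles of a finite bouquet covers that bouquet, so the class of a loop determines the endpoint
of its lift (`lift_endpoint`); conversely a loop whose lift closes up is null-homotopic, and the
fundamental group is free (`bijective_lift_loopClass`).

The core is `nullhomotopic_of_lifts`: a loop in a countable bouquet is null-homotopic if its lifts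
over arbitrarily large finite sub-bouquets are closed. By compactness a loop reads each letter a
bounded number of times, whatever finite sub-bouquet is used (`IsCoord.exists_bound`). Edge weights
that remain summable after multiplication by these bounds make the lifts bounded and equicontinuous.
An ultralimit of the tree distances is then a tree pseudometric on the unit interval through which
the loop factors, and a tree contracts to its root. Hence π₁(ℍ⁺_n) embeds into the inverse limit of
the free groups of its finite sub-bouquets (`eq_one_of_redHom`). The same bound gives stabilization:
as k grows, the letters of a fixed level form longer and longer sublists of bounded length
(`exists_keep_eq`).

In ℙ a compact set meets the interiors of only finitely many pairs of pants
(`exists_subset_partialPants`), and a pair of pants deformation retracts onto its arcs and legs.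
Collapsing P_1, …, P_N for large N therefore pushes a loop, or a homotopy, into ℍ⁺_{N+1}. On words
the collapse of P_n is the substitution ℓ_n ↦ ρ_{n,1} ℓ_{2n} ρ_{n,1}⁻¹ ρ_{n,2} ℓ_{2n+1} ρ_{n,2}⁻¹
(`redHom_collapseHom`). The words to which it is applied contain no ρ_{n,j}, so nothing cancels.
Hence collapses are injective on π₁, so is ι_n (`inclHom_injective`), and the letters ρ_{i,j}
already present survive, which makes χ well defined and compatible with the bonds.

For the injectivity of χ, the substitution can be decoded from left to right even after the circles
beyond a level have been deleted (`omega_eq_of_collapseHom_eq`). If x represents an element at level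
m + 1, its labels at the levels q ≥ m thus determine ω_{m+1,q}(x), hence all late reduced words of
x, hence x. -/

/-- The last time before `s` at which the height is at most `u`. -/
theorem exists_last_low {f : unitInterval → ℝ} (hf : Continuous f) (h0 : f 0 = 0)
    (s : unitInterval) {u : ℝ} (hu : 0 ≤ u) :
    ∃ g, IsGreatest {r : unitInterval | r ≤ s ∧ f r ≤ u} g := by
  apply IsCompact.exists_isGreatest
  · exact ((isClosed_le continuous_id continuous_const).inter
      (isClosed_le hf continuous_const)).isCompact
  · exact ⟨0, bot_le, by rw [h0]; exact hu⟩

/-- The time `g` codes the point of the branch from the root to `s` whose height is `u`, cut off at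
the height of `s`: by the intermediate value theorem the height cannot jump over `u` after the last
low time. -/
theorem last_low_height {f : unitInterval → ℝ} (hf : Continuous f) {s g : unitInterval} {u : ℝ}
    (hg : IsGreatest {r : unitInterval | r ≤ s ∧ f r ≤ u} g) :
    f g = min u (f s) ∧ ∀ r, g ≤ r → r ≤ s → min u (f s) ≤ f r := by
  obtain ⟨⟨h1, h2⟩, h3⟩ := hg
  have key : f g = min u (f s) := by
    rcases le_or_gt (f s) u with h | h
    · have : g = s := le_antisymm h1 (h3 ⟨le_rfl, h⟩)
      rw [this, min_eq_right h]
    · rw [min_eq_left h.le]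
      obtain ⟨r, hr, hru⟩ := intermediate_value_Icc h1 hf.continuousOn ⟨h2, h.le⟩
      have : r = g := le_antisymm (h3 ⟨hr.2, hru.le⟩) hr.1
      rw [← this, hru]
  refine ⟨key, fun r hr hrs => ?_⟩
  rcases hr.eq_or_lt with rfl | hr
  · exact key.ge
  · refine (min_le_left _ _).trans (le_of_lt ?_)
    by_contra hc
    exact absurd (h3 ⟨hrs, not_lt.1 hc⟩) (not_le.2 hr)

/-- A loop which factors through the tree coded by a height function is null-homotopic. -/
theorem nullhomotopic_of_height {X : Type*} [TopologicalSpace X] {x : X} (γ : Path x x)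
    {f : unitInterval → ℝ} (hf : Continuous f) (hpos : ∀ t, 0 ≤ f t) (h0 : f 0 = 0) (h1 : f 1 = 0)
    (hγ : ∀ s t, s ≤ t → f s = f t → (∀ r, s ≤ r → r ≤ t → f s ≤ f r) → γ s = γ t) :
    γ.Homotopic (Path.refl x) := by
  obtain ⟨M, hM⟩ : ∃ M, ∀ t, f t ≤ M := by
    obtain ⟨t, -, ht⟩ := isCompact_univ.exists_isMaxOn Set.univ_nonempty hf.continuousOn
    exact ⟨f t, fun s => ht (Set.mem_univ s)⟩
  have hM0 : 0 ≤ M := (hpos 0).trans (hM 0)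
  have hu : ∀ τ : unitInterval, 0 ≤ M * (τ : ℝ) := fun τ => mul_nonneg hM0 τ.2.1
  -- The homotopy slides every point down its branch: at time `τ` the point `s` is replaced by its
  -- ancestor at height `min (M * τ) (f s)`.
  choose g hg using fun p : unitInterval × unitInterval => exists_last_low hf h0 p.2 (hu p.1)
  have hgh := fun p => last_low_height hf (hg p)
  -- Two times before `s` of equal height `m`, with nothing lower than `m` between them and `s`,
  -- code the same ancestor of `s`.
  have hcomp : ∀ s a b, a ≤ s → b ≤ s → ∀ m, f a = m → f b = m → (∀ r, a ≤ r → r ≤ s → m ≤ f r) →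
      (∀ r, b ≤ r → r ≤ s → m ≤ f r) → γ a = γ b := by
    intro s a b ha hb m fa fb h1 h2
    rcases le_total a b with h | h
    · exact hγ a b h (fa.trans fb.symm) fun r hr hr' => fa.symm ▸ h1 r hr (hr'.trans hb)
    · exact (hγ b a h (fb.trans fa.symm) fun r hr hr' => fb.symm ▸ h2 r hr (hr'.trans ha)).symm
  -- The function `g` may jump, but `γ ∘ g` does not: each ultrafilter limit `a` of values of `g`
  -- codes the same ancestor as `g p`.
  have hcont : Continuous fun p => γ (g p) := by
    rw [continuous_iff_ultrafilter]
    intro p F hF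
    obtain ⟨a, -, ha⟩ := isCompact_univ.ultrafilter_le_nhds (F.map g) (by simp)
    have hga : Tendsto g F (𝓝 a) := ha
    have hs : Tendsto (fun q : unitInterval × unitInterval => q.2) F (𝓝 p.2) :=
      (continuous_snd.tendsto p).mono_left hF
    have hm : Tendsto (fun q : unitInterval × unitInterval => min (M * (q.1 : ℝ)) (f q.2)) F
        (𝓝 (min (M * (p.1 : ℝ)) (f p.2))) := by
      have : Continuous fun q : unitInterval × unitInterval => min (M * (q.1 : ℝ)) (f q.2) := by
        fun_prop
      exact (this.tendsto p).mono_left hF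
    have hfa : f a = min (M * (p.1 : ℝ)) (f p.2) := by
      refine tendsto_nhds_unique ((hf.tendsto a).comp hga) (hm.congr fun q => ?_)
      exact (hgh q).1.symm
    have has : a ≤ p.2 := le_of_tendsto_of_tendsto' hga hs fun q => (hg q).1.1
    have : γ a = γ (g p) := by
      refine hcomp p.2 a (g p) has (hg p).1.1 _ hfa (hgh p).1 (fun r hr hr' => ?_) (hgh p).2
      rcases hr.eq_or_lt with rfl | hr
      · exact hfa.ge
      rcases hr'.eq_or_lt with rfl | hr'
      · exact min_le_right _ _
      refine le_of_tendsto hm ?_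
      filter_upwards [hga.eventually (gt_mem_nhds hr), hs.eventually (lt_mem_nhds hr')] with q h1 h2
      exact (hgh q).2 r h1.le h2.le
    rw [← this]
    exact (γ.continuous.tendsto a).comp hga
  -- The cap `M * τ` rises from 0 to a bound for all heights, so the homotopy starts at the constant
  -- loop.
  symm
  refine ⟨⟨⟨⟨fun p => γ (g p), hcont⟩, fun s => ?_, fun s => ?_⟩, ?_⟩⟩
  · have h := (hgh (0, s)).1
    have h' : f (g (0, s)) = 0 := by
      rw [h]; simp [hpos s]
    have := hγ 0 (g (0, s)) bot_le (h0.trans h'.symm) fun r _ _ => h0.symm ▸ hpos r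
    change γ (g (0, s)) = x
    rw [← this, γ.source]
  · have : g (1, s) = s := le_antisymm (hg (1, s)).1.1 ((hg (1, s)).2 ⟨le_rfl, by simpa using hM s⟩)
    change γ (g (1, s)) = γ s
    rw [this]
  · rintro τ s (rfl | hs)
    · have : g (τ, 0) = 0 := le_antisymm (hg (τ, 0)).1.1 bot_le
      change γ (g (τ, 0)) = x
      rw [this, γ.source]
    · obtain rfl : s = 1 := hs
      have : g (τ, 1) = 1 :=
        le_antisymm (hg (τ, 1)).1.1 ((hg (τ, 1)).2 ⟨le_rfl, by rw [h1]; exact hu τ⟩)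
      change γ (g (τ, 1)) = x
      rw [this, γ.target]

/-- A loop which factors through a real tree is null-homotopic. Here `f` is the distance from the
root and `G` is the Gromov product. -/
theorem nullhomotopic_of_gromov {X : Type*} [TopologicalSpace X] {x : X} (γ : Path x x)
    {f : unitInterval → ℝ} {G : unitInterval → unitInterval → ℝ}
    (hpos : ∀ t, 0 ≤ f t) (h0 : f 0 = 0) (h1 : f 1 = 0)
    (hsymm : ∀ s t, G s t = G t s) (hle : ∀ s t, G s t ≤ f s)
    (hultra : ∀ r s t, min (G r s) (G s t) ≤ G r t)
    (hcont : ∀ s, ∀ ε > 0, ∀ᶠ t in 𝓝 s, f s + f t - 2 * G s t < ε)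
    (hγ : ∀ s t, f s + f t - 2 * G s t = 0 → γ s = γ t) :
    γ.Homotopic (Path.refl x) := by
  have hle' : ∀ s t, G s t ≤ f t := fun s t => hsymm s t ▸ hle t s
  have hf : Continuous f := by
    rw [continuous_iff_continuousAt]
    intro s
    rw [ContinuousAt, Metric.tendsto_nhds]
    intro ε hε
    filter_upwards [hcont s ε hε] with t ht
    rw [Real.dist_eq, abs_lt]
    constructor <;> linarith [hle s t, hle' s t]
  refine nullhomotopic_of_height γ hf hpos h0 h1 fun s t hst hfst hmin => hγ s t ?_
  -- Between `s` and `t` the heights stay above `f s`, so points close to each other have Gromov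
  -- product at least `f s - ε`. Connectedness and the ultrametric inequality chain these estimates
  -- from `s` to `t`.
  have key : ∀ ε > 0, f s - ε ≤ G s t := by
    intro ε hε
    refine isPreconnected_Icc.induction₂ (s := Set.Icc s t) (fun a b => f s - ε ≤ G a b) ?_ ?_ ?_
      (Set.left_mem_Icc.2 hst) (Set.right_mem_Icc.2 hst)
    · intro a ha
      filter_upwards [nhdsWithin_le_nhds (hcont a ε hε), self_mem_nhdsWithin] with b hb hb'
      linarith [hmin a ha.1 ha.2, hmin b hb'.1 hb'.2]
    · intro a b c _ _ _ hab hbc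
      exact (le_min hab hbc).trans (hultra a b c)
    · intro a b _ _ h
      rwa [hsymm b a]
  have h2 : f s ≤ G s t := le_of_forall_pos_le_add fun ε hε => by linarith [key ε hε]
  linarith [hle s t]

end HawaiianPants

end

noncomputable section

namespace HawaiianPants

open Filter Topology

/-! ### The tree of weighted words -/

section Lists

variable {S : Type*} {a : S → ℝ}

variable (a) in
/-- The total weight of a word. -/
def wordWeight (L : List (S × Bool)) : ℝ := (L.map fun l => a l.1).sum

@[simp] theorem wordWeight_nil : wordWeight a [] = 0 := rfl

@[simp] theorem wordWeight_cons (x : S × Bool) (L : List (S × Bool)) :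
    wordWeight a (x :: L) = a x.1 + wordWeight a L := by simp [wordWeight]

@[simp] theorem wordWeight_append (L M : List (S × Bool)) :
    wordWeight a (L ++ M) = wordWeight a L + wordWeight a M := by simp [wordWeight]

theorem wordWeight_nonneg (ha : ∀ g, 0 ≤ a g) (L : List (S × Bool)) : 0 ≤ wordWeight a L := by
  induction L with
  | nil => simp
  | cons x L ih => rw [wordWeight_cons]; linarith [ha x.1]

variable [DecidableEq S]

variable (a) in
/-- The weight of the longest common prefix of two words. -/
def commonWeight : List (S × Bool) → List (S × Bool) → ℝ
  | x :: xs, y :: ys => if x = y then a x.1 + commonWeight xs ys else 0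
  | [], _ => 0
  | _ :: _, [] => 0

variable (a) in
/-- The Gromov product in the tree of words; `(L, h)` stands for the point at height `h` on the
branch `L`. -/
def treeProd (P Q : List (S × Bool) × ℝ) : ℝ := min (min P.2 Q.2) (commonWeight a P.1 Q.1)

variable (a) in
/-- The distance in the tree of words. -/
def treeDist (P Q : List (S × Bool) × ℝ) : ℝ := P.2 + Q.2 - 2 * treeProd a P Q

theorem commonWeight_nonneg (ha : ∀ g, 0 ≤ a g) (L M : List (S × Bool)) :
    0 ≤ commonWeight a L M := by
  induction L generalizing M with
  | nil => simp [commonWeight]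
  | cons x L ih =>
    cases M with
    | nil => simp [commonWeight]
    | cons y M =>
      rw [commonWeight]
      split_ifs
      · linarith [ha x.1, ih M]
      · exact le_rfl

theorem commonWeight_comm (L M : List (S × Bool)) : commonWeight a L M = commonWeight a M L := by
  induction L generalizing M with
  | nil => cases M <;> simp [commonWeight]
  | cons x L ih =>
    cases M with
    | nil => simp [commonWeight]
    | cons y M =>
      rw [commonWeight, commonWeight, ih M]
      by_cases h : x = y
      · simp [h]
      · simp [h, Ne.symm h]

theorem commonWeight_append (L M : List (S × Bool)) :
    commonWeight a L (L ++ M) = wordWeight a L := by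
  induction L with
  | nil => simp [commonWeight]
  | cons x L ih => simp [commonWeight, ih]

theorem commonWeight_self (L : List (S × Bool)) : commonWeight a L L = wordWeight a L := by
  simpa using commonWeight_append (a := a) L []

/-- Of the two prefixes that `L` and `N` share with `M`, the shorter one is common to all three
words. This is the source of 0-hyperbolicity. -/
theorem commonWeight_ultra (ha : ∀ g, 0 ≤ a g) (L M N : List (S × Bool)) :
    min (commonWeight a L M) (commonWeight a M N) ≤ commonWeight a L N := by
  induction L generalizing M N with
  | nil => simp [commonWeight]
  | cons x L ih =>
    cases M with
    | nil => exact (min_le_left _ _).trans (commonWeight_nonneg ha _ _)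
    | cons y M =>
      cases N with
      | nil => exact (min_le_right _ _).trans (commonWeight_nonneg ha _ _)
      | cons z N =>
        by_cases hxy : x = y
        · by_cases hyz : y = z
          · subst hxy hyz
            simp only [commonWeight, if_true, min_add_add_left]
            linarith [ih M N]
          · refine (min_le_right _ _).trans ?_
            rw [commonWeight, if_neg hyz]
            exact commonWeight_nonneg ha _ _
        · refine (min_le_left _ _).trans ?_
          rw [commonWeight, if_neg hxy]
          exact commonWeight_nonneg ha _ _

/-- To collect more weight than that of `L`, the comparison must have reached and matched the letter
`x`. -/
theorem prefix_of_lt_commonWeight {L M : List (S × Bool)} {x : S × Bool} (ha : ∀ g, 0 ≤ a g)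
    (h : wordWeight a L < commonWeight a (L ++ [x]) M) : L ++ [x] <+: M := by
  induction L generalizing M with
  | nil =>
    cases M with
    | nil => simp [commonWeight] at h
    | cons y M =>
      rw [List.nil_append, commonWeight] at h
      split_ifs at h with hxy
      · simp [hxy]
      · simp at h
  | cons z L ih =>
    cases M with
    | nil =>
      rw [List.cons_append, commonWeight] at h
      exact absurd h (not_lt.2 (wordWeight_nonneg ha _))
    | cons y M =>
      rw [List.cons_append, commonWeight] at h
      split_ifs at h with hzy
      · subst hzy
        rw [List.cons_append, List.cons_prefix_cons]
        refine ⟨rfl, ih ?_⟩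
        simpa using h
      · exact absurd h (not_lt.2 (wordWeight_nonneg ha _))

theorem treeProd_comm (P Q : List (S × Bool) × ℝ) : treeProd a P Q = treeProd a Q P := by
  rw [treeProd, treeProd, min_comm P.2, commonWeight_comm]

theorem treeProd_le_left (P Q : List (S × Bool) × ℝ) : treeProd a P Q ≤ P.2 :=
  (min_le_left _ _).trans (min_le_left _ _)

theorem treeProd_le_right (P Q : List (S × Bool) × ℝ) : treeProd a P Q ≤ Q.2 :=
  (min_le_left _ _).trans (min_le_right _ _)

theorem treeProd_ultra (ha : ∀ g, 0 ≤ a g) (P Q R : List (S × Bool) × ℝ) :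
    min (treeProd a P Q) (treeProd a Q R) ≤ treeProd a P R := by
  refine le_min (le_min ?_ ?_) (le_trans ?_ (commonWeight_ultra ha P.1 Q.1 R.1))
  · exact (min_le_left _ _).trans (treeProd_le_left P Q)
  · exact (min_le_right _ _).trans (treeProd_le_right Q R)
  · exact min_le_min (min_le_right _ _) (min_le_right _ _)

theorem treeDist_comm (P Q : List (S × Bool) × ℝ) : treeDist a P Q = treeDist a Q P := by
  rw [treeDist, treeDist, treeProd_comm]; ring

theorem treeDist_triangle (ha : ∀ g, 0 ≤ a g) (P Q R : List (S × Bool) × ℝ) :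
    treeDist a P R ≤ treeDist a P Q + treeDist a Q R := by
  have h := treeProd_ultra ha P Q R
  have h1 := treeProd_le_right (a := a) P Q
  have h2 := treeProd_le_left (a := a) Q R
  unfold treeDist
  rcases min_le_iff.1 h with h | h <;> linarith

theorem treeDist_same (L : List (S × Bool)) {s t : ℝ} (hs : s ≤ wordWeight a L)
    (_ : t ≤ wordWeight a L) : treeDist a (L, s) (L, t) = |s - t| := by
  unfold treeDist treeProd
  rw [commonWeight_self, min_eq_left ((min_le_left s t).trans hs)]
  rcases le_total s t with h | h
  · simp only [min_eq_left h]; rw [abs_of_nonpos (by linarith)]; ring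
  · simp only [min_eq_right h]; rw [abs_of_nonneg (by linarith)]; ring

theorem treeDist_prefix (L : List (S × Bool)) (x : S × Bool) {t : ℝ} (ht : wordWeight a L ≤ t) :
    treeDist a (L, wordWeight a L) (L ++ [x], t) = t - wordWeight a L := by
  unfold treeDist treeProd
  rw [commonWeight_append, min_eq_left ht, min_self]; ring

end Lists

/-! ### The Cayley tree of a free group -/

section Tree

variable {S : Type*} [DecidableEq S] {a : S → ℝ}

/-- The last letter either cancels against `g` or leaves the extended word reduced. Hence one end of
each edge of the Cayley tree extends the other by one letter, and the edge lies on the branch of the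
longer end. -/
theorem toWord_mul_of (w : FreeGroup S) (g : S) :
    (w * FreeGroup.of g).toWord = w.toWord ++ [(g, true)] ∨
      w.toWord = (w * FreeGroup.of g).toWord ++ [(g, false)] := by
  rcases List.eq_nil_or_concat w.toWord with h | ⟨L, x, h⟩
  · left; rw [h, FreeGroup.toWord_mul, h]; simp
  · have hr : FreeGroup.IsReduced (L ++ [x]) := by
      rw [← List.concat_eq_append, ← h]; exact FreeGroup.isReduced_toWord
    rw [List.concat_eq_append] at h
    by_cases hx : x = (g, false)
    · right
      have : w * FreeGroup.of g = FreeGroup.mk L := by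
        rw [← FreeGroup.mk_toWord (x := w), h, hx, FreeGroup.of, FreeGroup.mul_mk,
          List.append_assoc]
        have : FreeGroup.Red (L ++ ([(g, false)] ++ [(g, true)])) (L ++ []) :=
          FreeGroup.Red.append_append_left_iff L |>.2
            (FreeGroup.Red.Step.to_red (FreeGroup.Red.Step.cons_not (x := g) (b := false)))
        simpa using FreeGroup.Red.exact.2 ⟨_, this, Relation.ReflTransGen.refl⟩
      rw [this, FreeGroup.toWord_mk, h, hx,
        (hr.infix (List.prefix_append L [x]).isInfix).reduce_eq]
    · left
      rw [FreeGroup.toWord_mul, FreeGroup.toWord_of, h]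
      apply FreeGroup.IsReduced.reduce_eq
      rw [FreeGroup.IsReduced, List.isChain_append]
      refine ⟨hr, List.isChain_singleton _, ?_⟩
      intro y hy z hz hyz
      simp at hy hz
      subst hy hz
      obtain ⟨x1, x2⟩ := x
      cases x2 <;> simp_all

variable (a) in
/-- The vertex of the Cayley tree given by an element of the free group. -/
def vertPt (w : FreeGroup S) : List (S × Bool) × ℝ := (w.toWord, wordWeight a w.toWord)

variable (a) in
/-- The point which divides the edge from `w` to `w * g` in the ratio `φ : 1 - φ`. -/
def edgePt (w : FreeGroup S) (g : S) (φ : ℝ) : List (S × Bool) × ℝ :=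
  (if w.toWord.length < (w * FreeGroup.of g).toWord.length then (w * FreeGroup.of g).toWord
    else w.toWord,
   (1 - φ) * wordWeight a w.toWord + φ * wordWeight a (w * FreeGroup.of g).toWord)

variable (a) in
theorem edgePt_cases (w : FreeGroup S) (g : S) :
    (∀ φ, edgePt a w g φ = (w.toWord ++ [(g, true)], wordWeight a w.toWord + φ * a g)) ∧
        (w * FreeGroup.of g).toWord = w.toWord ++ [(g, true)] ∨
    (∀ φ, edgePt a w g φ = ((w * FreeGroup.of g).toWord ++ [(g, false)],
      wordWeight a (w * FreeGroup.of g).toWord + (1 - φ) * a g)) ∧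
        w.toWord = (w * FreeGroup.of g).toWord ++ [(g, false)] := by
  rcases toWord_mul_of w g with h | h
  · refine Or.inl ⟨fun φ => ?_, h⟩
    rw [edgePt, h]
    simp
    ring
  · refine Or.inr ⟨fun φ => ?_, h⟩
    rw [edgePt, h]
    simp
    ring

theorem treeDist_edgePt (ha : ∀ g, 0 ≤ a g) (w : FreeGroup S) (g : S) {s t : ℝ}
    (hs0 : 0 ≤ s) (hs : s ≤ 1) (ht0 : 0 ≤ t) (ht : t ≤ 1) :
    treeDist a (edgePt a w g s) (edgePt a w g t) = a g * |s - t| := by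
  have e : ∀ x : ℝ, a g * |x| = |a g * x| := fun x => by rw [abs_mul, abs_of_nonneg (ha g)]
  rcases edgePt_cases a w g with ⟨h, -⟩ | ⟨h, -⟩
  · rw [h, h, treeDist_same, e]
    · congr 1; ring
    · simp; nlinarith [ha g]
    · simp; nlinarith [ha g]
  · rw [h, h, treeDist_same, abs_sub_comm, e]
    · congr 1; ring
    · simp; nlinarith [ha g]
    · simp; nlinarith [ha g]

theorem treeDist_vertPt_edgePt (ha : ∀ g, 0 ≤ a g) (w : FreeGroup S) (g : S) {s : ℝ}
    (hs0 : 0 ≤ s) (_ : s ≤ 1) :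
    treeDist a (vertPt a w) (edgePt a w g s) = a g * s := by
  rcases edgePt_cases a w g with ⟨h, -⟩ | ⟨h, h'⟩
  · rw [h, vertPt, treeDist_prefix]
    · ring
    · nlinarith [ha g]
  · rw [h, vertPt, h', treeDist_same, abs_of_nonneg]
    · simp; ring
    · simp; nlinarith [ha g]
    · simp
    · simp; nlinarith [ha g]

theorem treeDist_vertPt_mul_edgePt (ha : ∀ g, 0 ≤ a g) (w : FreeGroup S) (g : S) {s : ℝ}
    (_ : 0 ≤ s) (hs : s ≤ 1) :
    treeDist a (vertPt a (w * FreeGroup.of g)) (edgePt a w g s) = a g * (1 - s) := by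
  rcases edgePt_cases a w g with ⟨h, h'⟩ | ⟨h, h'⟩
  · rw [h, vertPt, h', treeDist_same, abs_of_nonneg]
    · simp; ring
    · simp; nlinarith [ha g]
    · simp
    · simp; nlinarith [ha g]
  · rw [h, vertPt, treeDist_prefix]
    · ring
    · nlinarith [ha g]

theorem treeDist_vertPt_step (ha : ∀ g, 0 ≤ a g) (w : FreeGroup S) (g : S) :
    treeDist a (vertPt a w) (vertPt a (w * FreeGroup.of g)) ≤ a g := by
  refine (treeDist_triangle ha _ (edgePt a w g 1) _).trans ?_
  rw [treeDist_comm (edgePt a w g 1), treeDist_vertPt_edgePt ha w g zero_le_one le_rfl,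
    treeDist_vertPt_mul_edgePt ha w g zero_le_one le_rfl]
  simp

theorem treeDist_vertPt_self (w : FreeGroup S) : treeDist a (vertPt a w) (vertPt a w) = 0 := by
  rw [vertPt, treeDist_same] <;> simp

/-- Walk from `w` to `w * z` along the letters of `z`; an inverse letter crosses its edge backwards
at the same cost. -/
theorem treeDist_vertPt_le (ha : ∀ g, 0 ≤ a g) (w z : FreeGroup S) :
    treeDist a (vertPt a w) (vertPt a (w * z)) ≤ wordWeight a z.toWord := by
  have : ∀ L : List (S × Bool), ∀ w, treeDist a (vertPt a w) (vertPt a (w * FreeGroup.mk L))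
      ≤ wordWeight a L := by
    intro L
    induction L with
    | nil => intro w; rw [← FreeGroup.one_eq_mk, mul_one, treeDist_vertPt_self]; simp
    | cons x L ih =>
      intro w
      obtain ⟨g, b⟩ := x
      have e : FreeGroup.mk ((g, b) :: L) = FreeGroup.mk [(g, b)] * FreeGroup.mk L := by
        rw [FreeGroup.mul_mk]; rfl
      rw [e, ← mul_assoc, wordWeight_cons]
      refine (treeDist_triangle ha _ (vertPt a (w * FreeGroup.mk [(g, b)])) _).trans ?_
      refine add_le_add ?_ (ih _)
      cases b with
      | true => exact treeDist_vertPt_step ha w g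
      | false =>
        rw [treeDist_comm]
        have e2 : FreeGroup.mk [(g, false)] = (FreeGroup.of g)⁻¹ := by
          rw [FreeGroup.of, FreeGroup.inv_mk]; rfl
        have := treeDist_vertPt_step ha (w * FreeGroup.mk [(g, false)]) g
        rwa [mul_assoc, e2, inv_mul_cancel, mul_one, ← e2] at this
  simpa [FreeGroup.mk_toWord] using this z.toWord w

/-- Treats both orientations of an edge at once: `L` is the end nearer to the root, and `b` records
whether the direction of `g` points away from the root. -/
theorem edgePt_branch (w : FreeGroup S) (g : S) (s : ℝ) : ∃ L b, edgePt a w g s = (L ++ [(g, b)], wordWeight a L +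
      (if b then s else 1 - s) * a g) := by
  rcases edgePt_cases a w g with ⟨h, -⟩ | ⟨h, -⟩
  · exact ⟨w.toWord, true, by rw [h]; simp⟩
  · exact ⟨(w * FreeGroup.of g).toWord, false, by rw [h]; simp⟩

/-- Points close to an inner point of an edge lie on that edge. -/
theorem treeDist_edgePt_lower (ha : ∀ g, 0 < a g) (w : FreeGroup S) (g : S) {s : ℝ}
    (hs0 : 0 < s) (hs : s < 1) {w' : FreeGroup S} {g' : S} {t : ℝ} (ht0 : 0 ≤ t) (ht : t ≤ 1)
    (hlt : treeDist a (edgePt a w g s) (edgePt a w' g' t) < a g * min s (1 - s)) :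
    g = g' ∧ treeDist a (edgePt a w g s) (edgePt a w' g' t) = a g * |s - t| := by
  have ha' := fun g => (ha g).le
  obtain ⟨L, b, h⟩ := edgePt_branch (a := a) w g s
  obtain ⟨L', b', h'⟩ := edgePt_branch (a := a) w' g' t
  rw [h, h'] at hlt ⊢
  set G := treeProd a (L ++ [(g, b)], wordWeight a L + (if b then s else 1 - s) * a g)
    (L' ++ [(g', b')], wordWeight a L' + (if b' then t else 1 - t) * a g') with hG
  have h1 : G ≤ wordWeight a L + (if b then s else 1 - s) * a g := treeProd_le_left _ _
  have h2 : G ≤ wordWeight a L' + (if b' then t else 1 - t) * a g' := treeProd_le_right _ _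
  have h3 : G ≤ commonWeight a (L ++ [(g, b)]) (L' ++ [(g', b')]) := min_le_right _ _
  have hd : (wordWeight a L + (if b then s else 1 - s) * a g) +
      (wordWeight a L' + (if b' then t else 1 - t) * a g') - 2 * G < a g * min s (1 - s) := hlt
  -- The quantity `a g * min s (1 - s)` is the distance to the nearer end of the edge; `m1` compares
  -- it with the way down and `m2` with the way up.
  have m1 : a g * min s (1 - s) ≤ (if b then s else 1 - s) * a g := by
    rw [mul_comm]
    refine mul_le_mul_of_nonneg_right ?_ (ha' g)
    split_ifs
    · exact min_le_left _ _
    · exact min_le_right _ _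
  have m2 : a g * min s (1 - s) ≤ (1 - if b then s else 1 - s) * a g := by
    rw [mul_comm]
    refine mul_le_mul_of_nonneg_right ?_ (ha' g)
    split_ifs
    · exact min_le_right _ _
    · simp
  have m3 : 0 ≤ (if b' then t else 1 - t) * a g' := by
    refine mul_nonneg ?_ (ha' g')
    split_ifs <;> linarith
  -- The Gromov product exceeds the weight of `L`, so the other branch passes through the letter of
  -- this edge.
  have hp : L ++ [(g, b)] <+: L' ++ [(g', b')] :=
    prefix_of_lt_commonWeight ha' (by linarith)
  have hL : L ++ [(g, b)] = L' ++ [(g', b')] := by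
    rw [List.prefix_concat_iff] at hp
    rcases hp with hp | hp
    · exact hp
    -- A branch that continues further would place the second point at or above the upper end of the
    -- edge, against `m2`.
    · exfalso
      obtain ⟨R, rfl⟩ := hp
      simp only [wordWeight_append, wordWeight_cons, wordWeight_nil] at hd h2
      have := wordWeight_nonneg ha' R
      nlinarith
  obtain ⟨rfl, hx⟩ := List.append_inj' hL rfl
  obtain ⟨rfl, rfl⟩ : g = g' ∧ b = b' := by simpa using hx
  refine ⟨rfl, ?_⟩
  have hb : ∀ r : ℝ, 0 ≤ r → r ≤ 1 → wordWeight a L + (if b then r else 1 - r) * a g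
      ≤ wordWeight a (L ++ [(g, b)]) := by
    intro r h0 h1
    simp only [wordWeight_append, wordWeight_cons, wordWeight_nil]
    have := ha g
    split_ifs <;> nlinarith
  rw [treeDist_same _ (hb s hs0.le hs.le) (hb t ht0 ht)]
  rw [show a g * |s - t| = |a g * (s - t)| by rw [abs_mul, abs_of_pos (ha g)]]
  split_ifs
  · congr 1; ring
  · rw [abs_sub_comm]; congr 1; ring

theorem treeDist_edgePt_vertPt_lower (ha : ∀ g, 0 < a g) (w : FreeGroup S) (g : S) {s : ℝ}
    (hs0 : 0 < s) (hs : s < 1) (w' : FreeGroup S) :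
    a g * min s (1 - s) ≤ treeDist a (edgePt a w g s) (vertPt a w') := by
  by_contra hc
  push Not at hc
  -- The vertex is the point with parameter 0 on the `g`-edge issuing from it, so being too close
  -- would force the distance to be `a g * s`, which is not small enough.
  have e : treeDist a (edgePt a w' g 0) (vertPt a w') = 0 := by
    rw [treeDist_comm, treeDist_vertPt_edgePt (fun g => (ha g).le) w' g le_rfl zero_le_one]; simp
  have e' : treeDist a (vertPt a w') (edgePt a w' g 0) = 0 := by rw [treeDist_comm, e]
  have t1 := treeDist_triangle (fun g => (ha g).le) (edgePt a w g s) (vertPt a w')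
    (edgePt a w' g 0)
  obtain ⟨-, h⟩ := treeDist_edgePt_lower ha w g hs0 hs le_rfl zero_le_one (w' := w') (g' := g)
    (by linarith)
  rw [sub_zero, abs_of_pos hs0] at h
  have : a g * min s (1 - s) ≤ a g * s := mul_le_mul_of_nonneg_left (min_le_left _ _) (ha g).le
  linarith

end Tree

end HawaiianPants

end

noncomputable section

namespace HawaiianPants

open Filter Topology

/-! ### Counting letters -/

section Count

variable {S : Type*} [DecidableEq S]

/-- The number of occurrences of `g^{±1}` in the reduced word of `w`. -/
def letterCount (g : S) (w : FreeGroup S) : ℕ := w.toWord.countP fun l => l.1 = g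

@[simp] theorem letterCount_one (g : S) : letterCount g (1 : FreeGroup S) = 0 := by
  simp [letterCount]

/-- Reduction only deletes letters. -/
theorem letterCount_mul_le (g : S) (w z : FreeGroup S) :
    letterCount g (w * z) ≤ letterCount g w + letterCount g z := by
  rw [letterCount, letterCount, letterCount, ← List.countP_append, FreeGroup.toWord_mul]
  exact FreeGroup.reduce.red.sublist.countP_le

@[simp] theorem letterCount_inv (g : S) (w : FreeGroup S) :
    letterCount g w⁻¹ = letterCount g w := by
  rw [letterCount, FreeGroup.toWord_inv, FreeGroup.invRev, List.countP_reverse, List.countP_map]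
  rfl

theorem letterCount_of (g h : S) : letterCount g (FreeGroup.of h) = if h = g then 1 else 0 := by
  simp [letterCount, List.countP_cons]

theorem letterCount_inv_mul_comm (g : S) (w z : FreeGroup S) :
    letterCount g (w⁻¹ * z) = letterCount g (z⁻¹ * w) := by
  rw [← letterCount_inv]; simp

theorem letterCount_inv_mul_le (g : S) (w y z : FreeGroup S) :
    letterCount g (w⁻¹ * z) ≤ letterCount g (w⁻¹ * y) + letterCount g (y⁻¹ * z) := by
  have := letterCount_mul_le g (w⁻¹ * y) (y⁻¹ * z)
  rwa [mul_assoc, mul_inv_cancel_left] at this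

theorem wordWeight_eq_sum (a : S → ℝ) (L : List (S × Bool)) :
    wordWeight a L = ∑ g ∈ (L.map Prod.fst).toFinset, (L.countP fun l => l.1 = g) * a g := by
  have h := Finset.sum_list_map_count (L.map Prod.fst) a
  rw [List.map_map] at h
  rw [wordWeight, show (fun l : S × Bool => a l.1) = a ∘ Prod.fst from rfl, h]
  refine Finset.sum_congr rfl fun g _ => ?_
  rw [nsmul_eq_mul, List.count, List.countP_map]
  congr 2

/-- Passes from bounds for single letters to a bound for the weight. Recording that only letters
which occur are summed allows small tails of a summable `e` to be exploited. -/
theorem wordWeight_le_sum {a e : S → ℝ} (z : FreeGroup S)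
    (h : ∀ g, letterCount g z * a g ≤ e g) :
    ∃ T : Finset S, (∀ g ∈ T, letterCount g z ≠ 0) ∧ wordWeight a z.toWord ≤ ∑ g ∈ T, e g := by
  refine ⟨(z.toWord.map Prod.fst).toFinset, fun g hg => ?_, ?_⟩
  · simp only [List.mem_toFinset, List.mem_map] at hg
    obtain ⟨l, hl, rfl⟩ := hg
    rw [letterCount]
    exact (List.countP_pos_iff.2 ⟨l, hl, by simp⟩).ne'
  · rw [wordWeight_eq_sum]
    exact Finset.sum_le_sum fun g _ => h g

end Count

/-! ### Lifts to Cayley trees -/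

section Lift

variable {S : Type*}

/-- The two ends of the edge `1 → g`, according to the half circle in which `z` lies. -/
def jump (g : S) (z : ℂ) : FreeGroup S := if z.im ≤ 0 then 1 else FreeGroup.of g

/-- A monotone parameter on the clockwise circle minus the point `1`, with values in `(0, 1)`. -/
def frac (z : ℂ) : ℝ := if z.im ≤ 0 then (1 - z.re) / 4 else 1 - (1 - z.re) / 4

/-- The coordinates of a path in a bouquet of circles. -/
structure IsCoord (c : S → unitInterval → ℂ) : Prop where
  cont : ∀ g, Continuous (c g)
  norm : ∀ g t, ‖c g t‖ = 1
  disj : ∀ t g h, g ≠ h → c g t = 1 ∨ c h t = 1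

/-- The vertices of the Cayley tree closest to the points of a lift of the path with coordinates
`c`, only the circles indexed by `A` being taken into account. -/
def IsLift (A : Finset S) (c : S → unitInterval → ℂ) (v : unitInterval → FreeGroup S) : Prop :=
  ∀ t, ((∀ g ∈ A, c g t = 1) → ∀ᶠ s in 𝓝 t, v s = v t) ∧
    ∀ g ∈ A, c g t ≠ 1 → ∃ w, ∀ᶠ s in 𝓝 t, v s = w * jump g (c g s)

theorem unit_eq {z : ℂ} (hz : ‖z‖ = 1) : z.re ^ 2 + z.im ^ 2 = 1 := by
  have := Complex.normSq_apply z
  rw [Complex.normSq_eq_norm_sq, hz] at this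
  linarith

theorem unit_im_ne {z : ℂ} (hz : ‖z‖ = 1) (h1 : z ≠ 1) (h2 : z ≠ -1) : z.im ≠ 0 := by
  intro h
  have := unit_eq hz
  rw [h] at this
  have h3 : (z.re - 1) * (z.re + 1) = 0 := by linarith
  rcases mul_eq_zero.1 h3 with h3 | h3
  · exact h1 (Complex.ext (by simp; linarith) (by simpa using h))
  · exact h2 (Complex.ext (by simp; linarith) (by simpa using h))

theorem unit_re_lt {z : ℂ} (hz : ‖z‖ = 1) (h1 : z ≠ 1) : z.re < 1 := by
  have := unit_eq hz
  by_contra hc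
  have h3 : z.im = 0 := by nlinarith
  exact h1 (Complex.ext (by simp; nlinarith) (by simpa using h3))

theorem frac_pos {z : ℂ} (hz : ‖z‖ = 1) (h1 : z ≠ 1) : 0 < frac z := by
  have := unit_re_lt hz h1
  have h2 := unit_eq hz
  unfold frac
  split_ifs
  · linarith
  · nlinarith [sq_nonneg z.im]

theorem frac_lt_one {z : ℂ} (hz : ‖z‖ = 1) (h1 : z ≠ 1) : frac z < 1 := by
  have := unit_re_lt hz h1
  have h2 := unit_eq hz
  unfold frac
  split_ifs
  · nlinarith [sq_nonneg z.im]
  · linarith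

theorem frac_injOn {z w : ℂ} (hz : ‖z‖ = 1) (hw : ‖w‖ = 1)
    (h : frac z = frac w) : z = w := by
  have z2 := unit_eq hz
  have w2 := unit_eq hw
  have hz1 : -1 ≤ z.re := by nlinarith [sq_nonneg z.im]
  have hw1 : -1 ≤ w.re := by nlinarith [sq_nonneg w.im]
  unfold frac at h
  split_ifs at h with h1 h2 h2
  · have hr : z.re = w.re := by linarith
    refine Complex.ext hr ?_
    rw [hr] at z2
    have : (z.im - w.im) * (z.im + w.im) = 0 := by nlinarith
    rcases mul_eq_zero.1 this with h | h <;> linarith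
  · have hr : w.re = -1 := by linarith
    rw [hr] at w2
    nlinarith
  · have hr : z.re = -1 := by linarith
    rw [hr] at z2
    nlinarith
  · have hr : z.re = w.re := by linarith
    refine Complex.ext hr ?_
    rw [hr] at z2
    have : (z.im - w.im) * (z.im + w.im) = 0 := by nlinarith
    rcases mul_eq_zero.1 this with h | h <;> linarith

theorem abs_frac_sub_half {z : ℂ} (hz : ‖z‖ = 1) : |frac z - 1 / 2| = (1 + z.re) / 4 := by
  have z2 := unit_eq hz
  have hz1 : -1 ≤ z.re := by nlinarith [sq_nonneg z.im]
  unfold frac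
  split_ifs
  · rw [abs_of_nonpos] <;> linarith
  · rw [abs_of_nonneg] <;> linarith

theorem IsCoord.continuousAt_frac {c : S → unitInterval → ℂ} (hc : IsCoord c) {g : S}
    {t : unitInterval} (h : c g t ≠ 1) : ContinuousAt (fun s => frac (c g s)) t := by
  have hre : Continuous fun s => (c g s).re := Complex.continuous_re.comp (hc.cont g)
  have him : Continuous fun s => (c g s).im := Complex.continuous_im.comp (hc.cont g)
  rcases lt_trichotomy (c g t).im 0 with hi | hi | hi
  · have : (fun s => (1 - (c g s).re) / 4) =ᶠ[𝓝 t] fun s => frac (c g s) := by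
      filter_upwards [him.continuousAt.eventually (gt_mem_nhds hi)] with s hs
      rw [frac, if_pos hs.le]
    exact ContinuousAt.congr ((continuous_const.sub hre).div_const 4).continuousAt this
  · have hm : c g t = -1 := by
      by_contra h2
      exact unit_im_ne (hc.norm g t) h h2 hi
    have e : frac (c g t) = 1 / 2 := by simp [frac, hm]; norm_num
    rw [ContinuousAt, e, tendsto_iff_dist_tendsto_zero]
    have : (fun s => dist (frac (c g s)) (1 / 2)) = fun s => (1 + (c g s).re) / 4 := by
      funext s
      rw [Real.dist_eq, abs_frac_sub_half (hc.norm g s)]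
    rw [this]
    have hh : Tendsto (fun s => (1 + (c g s).re) / 4) (𝓝 t) (𝓝 ((1 + (c g t).re) / 4)) := by
      have : Continuous fun s => (1 + (c g s).re) / 4 := by fun_prop
      exact this.tendsto t
    simpa [hm] using hh
  · have : (fun s => 1 - (1 - (c g s).re) / 4) =ᶠ[𝓝 t] fun s => frac (c g s) := by
      filter_upwards [him.continuousAt.eventually (lt_mem_nhds hi)] with s hs
      rw [frac, if_neg (not_le.2 hs)]
    exact ContinuousAt.congr
      (continuous_const.sub ((continuous_const.sub hre).div_const 4)).continuousAt this

/-- The nearest vertex can change only at the midpoint of an edge, where a coordinate equals -1. -/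
theorem IsLift.eventually_eq {A : Finset S} {c : S → unitInterval → ℂ}
    {v : unitInterval → FreeGroup S} (hv : IsLift A c v) (hc : IsCoord c) {t : unitInterval}
    (h : ∀ g ∈ A, c g t ≠ -1) : ∀ᶠ s in 𝓝 t, v s = v t := by
  by_cases h1 : ∀ g ∈ A, c g t = 1
  · exact (hv t).1 h1
  push Not at h1
  obtain ⟨g, hg, hg1⟩ := h1
  obtain ⟨w, hw⟩ := (hv t).2 g hg hg1
  have him : Continuous fun s => (c g s).im := Complex.continuous_im.comp (hc.cont g)
  have hj : ∀ᶠ s in 𝓝 t, jump g (c g s) = jump g (c g t) := by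
    rcases (unit_im_ne (hc.norm g t) hg1 (h g hg)).lt_or_gt with hi | hi
    · filter_upwards [him.continuousAt.eventually (gt_mem_nhds hi)] with s hs
      rw [jump, jump, if_pos hs.le, if_pos hi.le]
    · filter_upwards [him.continuousAt.eventually (lt_mem_nhds hi)] with s hs
      rw [jump, jump, if_neg (not_le.2 hs), if_neg (not_le.2 hi)]
  filter_upwards [hw, hj] with s h1 h2
  rw [h1, hw.self_of_nhds, h2]

/-- A lift which stays inside an edge determines that edge. -/
theorem IsLift.mul_jump_inv_eq {A : Finset S} {c : S → unitInterval → ℂ}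
    {v : unitInterval → FreeGroup S} (hv : IsLift A c v) {g : S} (hgA : g ∈ A)
    {J : Set unitInterval} (hJ : IsPreconnected J) (hg : ∀ t ∈ J, c g t ≠ 1)
    {s t : unitInterval} (hs : s ∈ J) (ht : t ∈ J) :
    v s * (jump g (c g s))⁻¹ = v t * (jump g (c g t))⁻¹ := by
  refine hJ.induction₂ (fun s t => v s * (jump g (c g s))⁻¹ = v t * (jump g (c g t))⁻¹) ?_ ?_ ?_
    hs ht
  · intro x hx
    refine nhdsWithin_le_nhds ?_
    obtain ⟨w, hw⟩ := (hv x).2 g hgA (hg x hx)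
    filter_upwards [hw] with y hy
    rw [hy, hw.self_of_nhds]; simp
  · intro x y z _ _ _ h1 h2
    exact h1.trans h2
  · intro x y _ _ h
    exact h.symm

section Decidable

variable [DecidableEq S]

theorem letterCount_jump_le (g h : S) (y z : ℂ) :
    letterCount g ((jump h y)⁻¹ * jump h z) ≤ if h = g then 1 else 0 := by
  unfold jump
  split_ifs <;> simp_all [letterCount_of]

/-- A lift which avoids the midpoints of the edges with label `g` crosses no such edge. -/
theorem IsLift.letterCount_eq_zero {A : Finset S} {c : S → unitInterval → ℂ}
    {v : unitInterval → FreeGroup S} (hv : IsLift A c v) (hc : IsCoord c) {g : S}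
    {J : Set unitInterval} (hJ : IsPreconnected J) (hg : ∀ t ∈ J, c g t ≠ -1)
    {s t : unitInterval} (hs : s ∈ J) (ht : t ∈ J) : letterCount g ((v s)⁻¹ * v t) = 0 := by
  refine hJ.induction₂ (fun s t => letterCount g ((v s)⁻¹ * v t) = 0) ?_ ?_ ?_ hs ht
  · intro x hx
    refine nhdsWithin_le_nhds ?_
    by_cases h : ∀ h ∈ A, c h x ≠ -1
    · filter_upwards [hv.eventually_eq hc h] with y hy
      rw [hy]; simp
    · push Not at h
      obtain ⟨h, hA, hh⟩ := h
      -- The path is at the midpoint of an edge with another label, and crossing it contributes no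
      -- letter `g`.
      have hne : h ≠ g := by rintro rfl; exact hg x hx hh
      obtain ⟨w, hw⟩ := (hv x).2 h hA (by rw [hh]; norm_num)
      filter_upwards [hw] with y hy
      rw [hy, hw.self_of_nhds]
      have := letterCount_jump_le g h (c h x) (c h y)
      rw [if_neg hne] at this
      rw [mul_inv_rev, mul_assoc, inv_mul_cancel_left]
      exact Nat.le_zero.1 this
  · intro x y z _ _ _ h1 h2
    have := letterCount_inv_mul_le g (v x) (v y) (v z)
    omega
  · intro x y _ _ h
    rw [letterCount_inv_mul_comm, h]

/-- Inside the circle of `g` the lift stays on one edge with that label. If `g` is not in `A`, the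
circles of `A` see the base point only, and the lift is constant. -/
theorem IsLift.letterCount_le_one {A : Finset S} {c : S → unitInterval → ℂ}
    {v : unitInterval → FreeGroup S} (hv : IsLift A c v) (hc : IsCoord c) {g : S}
    {J : Set unitInterval} (hJ : IsPreconnected J) (hg : ∀ t ∈ J, c g t ≠ 1)
    {s t : unitInterval} (hs : s ∈ J) (ht : t ∈ J) : letterCount g ((v s)⁻¹ * v t) ≤ 1 := by
  by_cases hgA : g ∈ A
  · have h := hv.mul_jump_inv_eq hgA hJ hg hs ht
    have e : (v s)⁻¹ * v t = (jump g (c g s))⁻¹ * jump g (c g t) := by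
      rw [mul_inv_eq_iff_eq_mul] at h
      rw [h]; simp [mul_assoc]
    rw [e]
    simpa using letterCount_jump_le g g (c g s) (c g t)
  · have h : v s = v t := by
      refine hJ.induction₂ (fun s t => v s = v t) ?_ ?_ ?_ hs ht
      · intro x hx
        refine nhdsWithin_le_nhds ?_
        have h1 : ∀ h ∈ A, c h x = 1 := fun h hh =>
          (hc.disj x g h (by rintro rfl; exact hgA hh)).resolve_left (hg x hx)
        filter_upwards [(hv x).1 h1] with y hy
        exact hy.symm
      · intro x y z _ _ _ h1 h2
        exact h1.trans h2
      · intro x y _ _ h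
        exact h.symm
    rw [h]; simp

/-- The number of `g`-letters read along a path is bounded independently of the lift. -/
theorem IsCoord.exists_bound {c : S → unitInterval → ℂ} (hc : IsCoord c) (g : S) :
    ∃ N : ℕ, ∀ (A : Finset S) (v : unitInterval → FreeGroup S), IsLift A c v →
      ∀ s t, letterCount g ((v s)⁻¹ * v t) ≤ N := by
  -- A Lebesgue subdivision into `n` pieces, on each of which the coordinate avoids 1 or avoids -1.
  -- Each piece reads at most one letter `g`, and the subdivision depends neither on `A` nor on the
  -- lift.
  obtain ⟨τ, hτ0, hτm, ⟨n, hn⟩, hτ⟩ := exists_monotone_Icc_subset_open_cover_unitInterval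
    (c := fun b : Bool => if b then {t | c g t ≠ -1} else {t | c g t ≠ 1}) (by
      intro b
      cases b
      · exact isOpen_ne_fun (hc.cont g) continuous_const
      · exact isOpen_ne_fun (hc.cont g) continuous_const) (by
      intro t _
      by_cases h : c g t = 1
      · exact Set.mem_iUnion.2 ⟨true, by simp [h]; norm_num⟩
      · exact Set.mem_iUnion.2 ⟨false, by simp [h]⟩)
  -- Both times are compared with time 0, at a cost of `n` each.
  refine ⟨2 * n, fun A v hv => ?_⟩
  have step : ∀ k, ∀ s ∈ Set.Icc (τ k) (τ (k + 1)),
      letterCount g ((v (τ k))⁻¹ * v s) ≤ 1 := by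
    intro k s hs
    have hl : τ k ∈ Set.Icc (τ k) (τ (k + 1)) := Set.left_mem_Icc.2 (hτm (Nat.le_succ k))
    obtain ⟨b, hb⟩ := hτ k
    cases b
    · exact hv.letterCount_le_one hc isPreconnected_Icc (fun t ht => by simpa using hb ht) hl hs
    · exact (hv.letterCount_eq_zero hc isPreconnected_Icc
        (fun t ht => by simpa using hb ht) hl hs).le.trans zero_le_one
  have main : ∀ k, ∀ s ∈ Set.Icc (τ 0) (τ k), letterCount g ((v (τ 0))⁻¹ * v s) ≤ k := by
    intro k
    induction k with
    | zero =>
      intro s hs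
      obtain rfl : s = τ 0 := le_antisymm hs.2 hs.1
      simp
    | succ k ih =>
      intro s hs
      rcases le_total s (τ k) with h | h
      · exact (ih s ⟨hs.1, h⟩).trans (Nat.le_succ k)
      · have h1 := ih (τ k) ⟨hτm (Nat.zero_le k), le_rfl⟩
        have h2 := step k s ⟨h, hs.2⟩
        have := letterCount_inv_mul_le g (v (τ 0)) (v (τ k)) (v s)
        omega
  have all : ∀ s, letterCount g ((v (τ 0))⁻¹ * v s) ≤ n := fun s =>
    main n s ⟨by rw [hτ0]; exact s.2.1, by rw [hn n le_rfl]; exact s.2.2⟩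
  intro s t
  have h1 := letterCount_inv_mul_le g (v s) (v (τ 0)) (v t)
  rw [letterCount_inv_mul_comm g (v s) (v (τ 0))] at h1
  have := all s
  have := all t
  omega

open Classical in
/-- The point of the Cayley tree on a lift. -/
def treePos (a : S → ℝ) (A : Finset S) (c : S → unitInterval → ℂ)
    (v : unitInterval → FreeGroup S) (t : unitInterval) : List (S × Bool) × ℝ :=
  if h : ∃ g, g ∈ A ∧ c g t ≠ 1 then
    edgePt a (v t * (jump h.choose (c h.choose t))⁻¹) h.choose (frac (c h.choose t))
  else vertPt a (v t)

theorem treePos_edge (a : S → ℝ) {A : Finset S} {c : S → unitInterval → ℂ} (hc : IsCoord c)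
    (v : unitInterval → FreeGroup S) {t : unitInterval} {g : S} (hg : g ∈ A) (h : c g t ≠ 1) :
    treePos a A c v t = edgePt a (v t * (jump g (c g t))⁻¹) g (frac (c g t)) := by
  have hex : ∃ g, g ∈ A ∧ c g t ≠ 1 := ⟨g, hg, h⟩
  have : hex.choose = g := by
    by_contra hne
    exact (hc.disj t _ _ hne).elim hex.choose_spec.2 h
  rw [treePos, dif_pos hex, this]

theorem treePos_vert (a : S → ℝ) {A : Finset S} {c : S → unitInterval → ℂ}
    (v : unitInterval → FreeGroup S) {t : unitInterval} (h : ∀ g ∈ A, c g t = 1) :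
    treePos a A c v t = vertPt a (v t) := by
  rw [treePos, dif_neg]
  push Not
  exact h

theorem treeDist_treePos_vertPt {a : S → ℝ} (ha : ∀ g, 0 ≤ a g) {A : Finset S}
    {c : S → unitInterval → ℂ} (hc : IsCoord c) (v : unitInterval → FreeGroup S)
    (t : unitInterval) {e : ℝ} (he0 : 0 ≤ e) (he : ∀ g ∈ A, a g * ((1 - (c g t).re) / 4) ≤ e) :
    treeDist a (vertPt a (v t)) (treePos a A c v t) ≤ e := by
  by_cases h : ∀ g ∈ A, c g t = 1
  · rw [treePos_vert a v h, treeDist_vertPt_self]; exact he0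
  · push Not at h
    obtain ⟨g, hg, h1⟩ := h
    have f0 := (frac_pos (hc.norm g t) h1).le
    have f1 := (frac_lt_one (hc.norm g t) h1).le
    rw [treePos_edge a hc v hg h1]
    refine le_trans (le_of_eq ?_) (he g hg)
    by_cases hi : (c g t).im ≤ 0
    · rw [jump, if_pos hi, inv_one, mul_one, treeDist_vertPt_edgePt ha _ _ f0 f1, frac, if_pos hi]
    -- On the upper half circle the nearest vertex is the far end of the edge.
    · have e2 : v t = v t * (jump g (c g t))⁻¹ * FreeGroup.of g := by
        rw [jump, if_neg hi]; group
      have e3 : vertPt a (v t) = vertPt a (v t * (jump g (c g t))⁻¹ * FreeGroup.of g) :=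
        congrArg _ e2
      rw [e3, treeDist_vertPt_mul_edgePt ha _ _ (by simpa using f0) (by simpa using f1), frac, if_neg hi]
      ring

theorem treePos_nonneg {a : S → ℝ} (ha : ∀ g, 0 ≤ a g) {A : Finset S}
    {c : S → unitInterval → ℂ} (hc : IsCoord c) (v : unitInterval → FreeGroup S)
    (t : unitInterval) : 0 ≤ (treePos a A c v t).2 := by
  by_cases h : ∀ g ∈ A, c g t = 1
  · rw [treePos_vert a v h]; exact wordWeight_nonneg ha _
  · push Not at h
    obtain ⟨g, hg, h1⟩ := h
    have f0 := (frac_pos (hc.norm g t) h1).le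
    have f1 := (frac_lt_one (hc.norm g t) h1).le
    rw [treePos_edge a hc v hg h1]
    exact add_nonneg (mul_nonneg (by linarith) (wordWeight_nonneg ha _))
      (mul_nonneg f0 (wordWeight_nonneg ha _))

end Decidable

end Lift

end HawaiianPants

end

noncomputable section

namespace HawaiianPants

open Filter Topology

/-! ### Loops all of whose lifts are closed -/

section Shape

variable {S : Type*} [DecidableEq S]

theorem eventually_uIcc_subset {t : unitInterval} {p : unitInterval → Prop}
    (h : ∀ᶠ s in 𝓝 t, p s) : ∀ᶠ s in 𝓝 t, ∀ r ∈ Set.uIcc t s, p r :=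
  Set.ordConnectedComponent_mem_nhds.2 h

/-- If the weights are small enough, then the positions on the lifts are equicontinuous. -/
theorem eventually_treeDist_le {c : S → unitInterval → ℂ} (hc : IsCoord c) {a e : S → ℝ}
    (ha : ∀ g, 0 < a g) (hae : ∀ g, a g ≤ e g) (he : Summable e)
    (hbound : ∀ g A v, IsLift A c v → ∀ s t, letterCount g ((v s)⁻¹ * v t) * a g ≤ e g)
    (t : unitInterval) {ε : ℝ} (hε : 0 < ε) :
    ∃ B : Finset S, ∀ᶠ s in 𝓝 t, ∀ A v, IsLift A c v → B ⊆ A →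
      treeDist a (treePos a A c v t) (treePos a A c v s) ≤ 3 * ε := by
  have ha' := fun g => (ha g).le
  have he' : ∀ g, 0 ≤ e g := fun g => (ha' g).trans (hae g)
  -- Finite sets of letters outside `B` have total weight below `ε`.
  obtain ⟨B, hB⟩ := summable_iff_vanishing_norm.1 he ε hε
  refine ⟨B, ?_⟩
  -- If the circles of `B` see the base point at time `t`, then near `t` the path makes only short
  -- excursions into them and crosses no midpoint of their edges; all other letters are light. The
  -- three terms of the triangle inequality give `3 * ε`.
  by_cases h : ∀ g ∈ B, c g t = 1
  · have h1 : ∀ᶠ s in 𝓝 t, ∀ g ∈ B, c g s ≠ -1 ∧ a g * ((1 - (c g s).re) / 4) < ε := by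
      rw [B.eventually_all]
      intro g hg
      have hre : Continuous fun s => (c g s).re := Complex.continuous_re.comp (hc.cont g)
      refine ((hc.cont g).continuousAt.eventually_ne (by rw [h g hg]; norm_num)).and ?_
      have : Continuous fun s => a g * ((1 - (c g s).re) / 4) :=
        continuous_const.mul ((continuous_const.sub hre).div_const 4)
      exact this.continuousAt.eventually (gt_mem_nhds (by simpa [h g hg] using hε))
    filter_upwards [eventually_uIcc_subset h1] with s hs A v hv _
    have short : ∀ r ∈ Set.uIcc t s, ∀ g ∈ A, a g * ((1 - (c g r).re) / 4) ≤ ε := by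
      intro r hr g _
      by_cases hg : g ∈ B
      · exact (hs r hr g hg).2.le
      · have h2 := hB {g} (by simpa using hg)
        rw [Finset.sum_singleton, Real.norm_of_nonneg (he' g)] at h2
        have h3 := unit_eq (hc.norm g r)
        have h4 : -1 ≤ (c g r).re := by nlinarith [sq_nonneg (c g r).im]
        nlinarith [ha g, hae g]
    have hvert : treeDist a (vertPt a (v t)) (vertPt a (v s)) ≤ ε := by
      have h2 := treeDist_vertPt_le ha' (v t) ((v t)⁻¹ * v s)
      rw [mul_inv_cancel_left] at h2
      obtain ⟨T, hT, hle⟩ := wordWeight_le_sum ((v t)⁻¹ * v s)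
        fun g => hbound g A v hv t s
      have h3 := hB T (by
        rw [Finset.disjoint_left]
        intro g hgT hgB
        exact hT g hgT (hv.letterCount_eq_zero hc isPreconnected_uIcc
          (fun r hr => (hs r hr g hgB).1) Set.left_mem_uIcc Set.right_mem_uIcc))
      exact h2.trans (hle.trans ((le_abs_self _).trans h3.le))
    have d1 := treeDist_triangle ha' (treePos a A c v t) (vertPt a (v t)) (treePos a A c v s)
    have d2 := treeDist_triangle ha' (vertPt a (v t)) (vertPt a (v s)) (treePos a A c v s)
    have d3 := treeDist_treePos_vertPt ha' hc v t hε.le (short t Set.left_mem_uIcc)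
    have d4 := treeDist_treePos_vertPt ha' hc v s hε.le (short s Set.right_mem_uIcc)
    rw [treeDist_comm] at d3
    linarith
  -- Otherwise the path is inside a circle of `B`, and both positions lie on one edge.
  · push Not at h
    obtain ⟨g, hg, h1⟩ := h
    have h2 : ∀ᶠ s in 𝓝 t, a g * |frac (c g t) - frac (c g s)| < ε := by
      have : ContinuousAt (fun s => a g * |frac (c g t) - frac (c g s)|) t :=
        continuousAt_const.mul (continuousAt_const.sub (hc.continuousAt_frac h1)).abs
      exact this.eventually (gt_mem_nhds (by simpa using hε))
    filter_upwards [eventually_uIcc_subset ((hc.cont g).continuousAt.eventually_ne h1), h2]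
      with s hs hs2 A v hv hBA
    have hs1 := hs s Set.right_mem_uIcc
    rw [treePos_edge a hc v (hBA hg) h1, treePos_edge a hc v (hBA hg) hs1,
      hv.mul_jump_inv_eq (hBA hg) isPreconnected_uIcc hs Set.left_mem_uIcc Set.right_mem_uIcc,
      treeDist_edgePt ha' _ _ (frac_pos (hc.norm g t) h1).le (frac_lt_one (hc.norm g t) h1).le
        (frac_pos (hc.norm g s) hs1).le (frac_lt_one (hc.norm g s) hs1).le]
    linarith

/-- Points with different coordinates have different positions on the lifts, uniformly. -/
theorem exists_treeDist_ge {c : S → unitInterval → ℂ} (hc : IsCoord c) {a : S → ℝ}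
    (ha : ∀ g, 0 < a g) {g : S} {s t : unitInterval} (hs : c g s ≠ 1) (hst : c g s ≠ c g t) :
    ∃ δ > 0, ∀ A v, g ∈ A → δ ≤ treeDist a (treePos a A c v s) (treePos a A c v t) := by
  have f0 := frac_pos (hc.norm g s) hs
  have f1 := frac_lt_one (hc.norm g s) hs
  have hfrac : 0 < |frac (c g s) - frac (c g t)| := by
    rw [abs_pos, sub_ne_zero]
    exact fun h => hst (frac_injOn (hc.norm g s) (hc.norm g t) h)
  -- Either the second position is on the same edge, and then the distance is given by `frac`, or it
  -- is at least as far away as the nearer end of the edge.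
  refine ⟨min (a g * min (frac (c g s)) (1 - frac (c g s)))
    (a g * |frac (c g s) - frac (c g t)|), ?_, fun A v hg => ?_⟩
  · exact lt_min (mul_pos (ha g) (lt_min f0 (by linarith))) (mul_pos (ha g) hfrac)
  rw [treePos_edge a hc v hg hs]
  by_cases h : ∀ h ∈ A, c h t = 1
  · rw [treePos_vert a v h]
    exact (min_le_left _ _).trans (treeDist_edgePt_vertPt_lower ha _ g f0 f1 _)
  · push Not at h
    obtain ⟨h, hA, h1⟩ := h
    rw [treePos_edge a hc v hA h1]
    by_contra hlt
    push Not at hlt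
    obtain ⟨rfl, hd⟩ := treeDist_edgePt_lower ha _ g f0 f1 (frac_pos (hc.norm h t) h1).le
      (frac_lt_one (hc.norm h t) h1).le (hlt.trans_le (min_le_left _ _))
    rw [hd] at hlt
    exact absurd (hlt.trans_le (min_le_right _ _)) (lt_irrefl _)

theorem exists_ultralimit {ι : Type*} (U : Ultrafilter ι) {φ : ι → ℝ} {M : ℝ}
    (h : ∀ᶠ i in U, φ i ∈ Set.Icc 0 M) : ∃ x, Tendsto φ U (𝓝 x) := by
  obtain ⟨x, -, hx⟩ := (isCompact_Icc (a := (0 : ℝ)) (b := M)).ultrafilter_le_nhds (U.map φ)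
    (le_principal_iff.2 h)
  exact ⟨x, hx⟩

/-- A loop in a bouquet of countably many circles is null-homotopic if its lifts to the Cayley
trees of sufficiently many finite subbouquets are closed. -/
theorem nullhomotopic_of_lifts [Countable S] {X : Type*} [TopologicalSpace X] {x : X}
    (γ : Path x x) {c : S → unitInterval → ℂ} (hc : IsCoord c) (hc0 : ∀ g, c g 0 = 1)
    (hc1 : ∀ g, c g 1 = 1) (hγ : ∀ s t, (∀ g, c g s = c g t) → γ s = γ t)
    (hlift : ∃ᶠ A in atTop, ∃ v, IsLift A c v ∧ v 0 = 1 ∧ v 1 = 1) :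
    γ.Homotopic (Path.refl x) := by
  have := Encodable.ofCountable S
  choose N hN using hc.exists_bound
  obtain ⟨e, he0, E, hE, hE1⟩ := posSumOfEncodable one_pos S
  -- Division by the bound for the number of letters makes the total weight of the letters `g` read
  -- between any two times at most `e g`, for every lift.
  set a : S → ℝ := fun g => e g / (N g + 1) with hadef
  have ha : ∀ g, 0 < a g := fun g => div_pos (he0 g) (by positivity)
  have ha' := fun g => (ha g).le
  have haN : ∀ g, (N g + 1) * a g = e g := fun g => by
    rw [hadef]; field_simp
  have hae : ∀ g, a g ≤ e g := fun g => by
    rw [← haN]; nlinarith [ha g, (N g).cast_nonneg (α := ℝ)]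
  have hbound : ∀ g A v, IsLift A c v → ∀ s t, letterCount g ((v s)⁻¹ * v t) * a g ≤ e g := by
    intro g A v hv s t
    have h1 : (letterCount g ((v s)⁻¹ * v t) : ℝ) ≤ N g := by exact_mod_cast hN g A v hv s t
    rw [← haN]
    nlinarith [ha g]
  have he1 : ∀ T : Finset S, ∑ g ∈ T, e g ≤ 1 := fun T =>
    (sum_le_hasSum T (fun g _ => (he0 g).le) hE).trans hE1
  set Q : Set (Finset S) := {A | ∃ v, IsLift A c v ∧ v 0 = 1 ∧ v 1 = 1} with hQ
  have hne : (atTop ⊓ 𝓟 Q).NeBot := frequently_mem_iff_neBot.1 hlift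
  set U := Ultrafilter.of (atTop ⊓ 𝓟 Q) with hU
  have hUle : (U : Filter (Finset S)) ≤ atTop ⊓ 𝓟 Q := Ultrafilter.of_le _
  have hUQ : ∀ᶠ A in U, A ∈ Q := hUle.trans inf_le_right (mem_principal_self Q)
  have hUtop : ∀ B : Finset S, ∀ᶠ A in U, B ⊆ A := fun B =>
    hUle.trans inf_le_left (eventually_ge_atTop B)
  have hv : ∀ A : Finset S, ∃ v, A ∈ Q → IsLift A c v ∧ v 0 = 1 ∧ v 1 = 1 := by
    intro A
    by_cases h : A ∈ Q
    · exact ⟨h.choose, fun _ => h.choose_spec⟩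
    · exact ⟨fun _ => 1, fun h' => absurd h' h⟩
  choose v hv using hv
  set P : Finset S → unitInterval → List (S × Bool) × ℝ := fun A t => treePos a A c (v A) t
    with hP
  have hP0 : ∀ A t, 0 ≤ (P A t).2 := fun A t => treePos_nonneg ha' hc (v A) t
  -- A total of 1 for the nearest vertex, since the `e g` sum to at most 1, and another 1 for the
  -- remaining piece of an edge.
  have hP2 : ∀ A ∈ Q, ∀ t, (P A t).2 ≤ 2 := by
    intro A hA t
    obtain ⟨hl, h0, -⟩ := hv A hA
    have d1 := treeDist_triangle ha' (vertPt a 1) (vertPt a (v A t)) (P A t)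
    have d2 : treeDist a (vertPt a 1) (P A t) = (P A t).2 := by
      have : commonWeight a [] (P A t).1 = 0 := by rw [commonWeight]
      rw [treeDist, treeProd, vertPt, FreeGroup.toWord_one, wordWeight_nil, this,
        min_eq_left (hP0 A t)]
      simp
    have d3 : treeDist a (vertPt a 1) (vertPt a (v A t)) ≤ 1 := by
      have h2 := treeDist_vertPt_le ha' 1 (v A t)
      rw [one_mul] at h2
      obtain ⟨T, -, hle⟩ := wordWeight_le_sum ((v A 0)⁻¹ * v A t)
        fun g => hbound g A (v A) hl 0 t
      rw [h0, inv_one, one_mul] at hle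
      exact h2.trans (hle.trans (he1 T))
    have d4 : treeDist a (vertPt a (v A t)) (P A t) ≤ 1 := by
      refine treeDist_treePos_vertPt ha' hc (v A) t zero_le_one fun g _ => ?_
      have h1 := he1 {g}
      rw [Finset.sum_singleton] at h1
      have h3 := unit_eq (hc.norm g t)
      have h4 : -1 ≤ (c g t).re := by nlinarith [sq_nonneg (c g t).im]
      nlinarith [ha g, hae g]
    linarith
  have hP00 : ∀ A ∈ Q, (P A 0).2 = 0 := by
    intro A hA
    obtain ⟨-, h0, -⟩ := hv A hA
    simp only [hP]
    rw [treePos_vert a _ fun g _ => hc0 g, h0, vertPt, FreeGroup.toWord_one, wordWeight_nil]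
  have hP01 : ∀ A ∈ Q, (P A 1).2 = 0 := by
    intro A hA
    obtain ⟨-, -, h1⟩ := hv A hA
    simp only [hP]
    rw [treePos_vert a _ fun g _ => hc1 g, h1, vertPt, FreeGroup.toWord_one, wordWeight_nil]
  have hf : ∀ t, ∃ y, Tendsto (fun A => (P A t).2) U (𝓝 y) := fun t =>
    exists_ultralimit U (M := 2) (hUQ.mono fun A hA => ⟨hP0 A t, hP2 A hA t⟩)
  choose f hf using hf
  have hprod0 : ∀ A s t, 0 ≤ treeProd a (P A s) (P A t) := fun A s t =>
    le_min (le_min (hP0 A s) (hP0 A t)) (commonWeight_nonneg ha' _ _)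
  have hG : ∀ s t, ∃ y, Tendsto (fun A => treeProd a (P A s) (P A t)) U (𝓝 y) := fun s t =>
    exists_ultralimit U (M := 2) (hUQ.mono fun A hA =>
      ⟨hprod0 A s t, (treeProd_le_left _ _).trans (hP2 A hA s)⟩)
  choose G hG using hG
  have hD : ∀ s t, Tendsto (fun A => treeDist a (P A s) (P A t)) U (𝓝 (f s + f t - 2 * G s t)) :=
    fun s t => ((hf s).add (hf t)).sub ((hG s t).const_mul 2)
  -- The limits of heights and Gromov products inherit the tree inequalities.
  refine nullhomotopic_of_gromov γ (f := f) (G := G) ?_ ?_ ?_ ?_ ?_ ?_ ?_ ?_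
  · exact fun t => ge_of_tendsto' (hf t) fun A => hP0 A t
  · exact tendsto_nhds_unique (hf 0) (tendsto_const_nhds.congr' (hUQ.mono fun A hA =>
      (hP00 A hA).symm))
  · exact tendsto_nhds_unique (hf 1) (tendsto_const_nhds.congr' (hUQ.mono fun A hA =>
      (hP01 A hA).symm))
  · exact fun s t => tendsto_nhds_unique (hG s t) ((hG t s).congr fun A => treeProd_comm _ _)
  · exact fun s t => le_of_tendsto_of_tendsto' (hG s t) (hf s) fun A => treeProd_le_left _ _
  · exact fun r s t => le_of_tendsto_of_tendsto' ((hG r s).min (hG s t)) (hG r t) fun A =>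
      treeProd_ultra ha' _ _ _
  · intro s ε hε
    obtain ⟨B, hB⟩ := eventually_treeDist_le hc ha hae hE.summable hbound s
      (show (0 : ℝ) < ε / 4 by linarith)
    filter_upwards [hB] with t ht
    have : f s + f t - 2 * G s t ≤ 3 * (ε / 4) := by
      refine le_of_tendsto (hD s t) ?_
      filter_upwards [hUQ, hUtop B] with A hA hBA
      exact ht A (v A) (hv A hA).1 hBA
    linarith
  -- Different coordinates keep the positions a fixed distance apart on all large lifts, so limit
  -- distance 0 forces all coordinates to agree.
  · have key : ∀ s t g, c g s ≠ 1 → c g s ≠ c g t → f s + f t - 2 * G s t ≠ 0 := by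
      intro s t g h1 h2 h0
      obtain ⟨δ, hδ, h⟩ := exists_treeDist_ge hc ha h1 h2
      have : δ ≤ f s + f t - 2 * G s t := by
        refine ge_of_tendsto (hD s t) ?_
        filter_upwards [hUtop {g}] with A hA
        exact h A (v A) (Finset.singleton_subset_iff.1 hA)
      linarith
    intro s t hst
    refine hγ s t fun g => ?_
    by_contra hne
    by_cases h1 : c g s = 1
    · refine key t s g (fun h => hne (h1.trans h.symm)) (Ne.symm hne) ?_
      have : G t s = G s t :=
        tendsto_nhds_unique (hG t s) ((hG s t).congr fun A => treeProd_comm _ _)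
      rw [this]; linarith
    · exact key s t g h1 hne hst

end Shape

end HawaiianPants

end

/-! ### Covering theory of finite bouquets -/

noncomputable section

namespace HawaiianPants

open Filter Topology

/-! ### Fundamental groups of finite bouquets -/

section PiOne

variable {X : Type*} [TopologicalSpace X] {x : X}

theorem exists_loopClass (y : PiOne X x) : ∃ γ : Path x x, loopClass γ = y := by
  obtain ⟨γ, hγ⟩ := Quotient.exists_rep (MulOpposite.unop y)
  exact ⟨γ, congrArg MulOpposite.op hγ⟩

theorem loopClass_eq_iff {γ δ : Path x x} : loopClass γ = loopClass δ ↔ γ.Homotopic δ := by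
  constructor
  · intro h
    exact Quotient.exact (MulOpposite.op_injective h)
  · intro h
    exact congrArg MulOpposite.op (Quotient.sound h)

theorem loopClass_refl : loopClass (Path.refl x) = 1 := rfl

theorem loopClass_symm (γ : Path x x) : loopClass γ.symm = (loopClass γ)⁻¹ := rfl

theorem PiOne.map_loopClass {Y : Type*} [TopologicalSpace Y] (f : C(X, Y)) (γ : Path x x) :
    PiOne.map f rfl (loopClass γ) = loopClass (γ.map f.continuous) := by
  change MulOpposite.op (FundamentalGroup.mapOfEq f rfl _) = _
  rw [FundamentalGroup.mapOfEq_apply]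
  rfl

theorem PiOne.map_loopClass_cast {Y : Type*} [TopologicalSpace Y] (f : C(X, Y)) {y : Y}
    (h : f x = y) (γ : Path x x) :
    PiOne.map f h (loopClass γ) = loopClass ((γ.map f.continuous).cast h.symm h.symm) := by
  subst h
  exact PiOne.map_loopClass f γ

end PiOne

section LiftLemmas

variable {S : Type*}

theorem IsLift.comp {A : Finset S} {c : S → unitInterval → ℂ} {v : unitInterval → FreeGroup S}
    (hv : IsLift A c v) {σ : unitInterval → unitInterval} (hσ : Continuous σ) :
    IsLift A (fun g t => c g (σ t)) (v ∘ σ) := by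
  intro t
  refine ⟨fun h => hσ.continuousAt.eventually ((hv (σ t)).1 h), fun g hg h => ?_⟩
  obtain ⟨w, hw⟩ := (hv (σ t)).2 g hg h
  exact ⟨w, hσ.continuousAt.eventually hw⟩

/-- Locally both lifts change by the same right factors, so whether they agree is a locally constant
property. -/
theorem IsLift.unique {A : Finset S} {c : S → unitInterval → ℂ} {v v' : unitInterval → FreeGroup S}
    (hv : IsLift A c v) (hv' : IsLift A c v') {s : unitInterval} (h0 : v s = v' s)
    (t : unitInterval) : v t = v' t := by
  have := isPreconnected_univ.induction₂ (s := Set.univ) (fun s t => v s = v' s ↔ v t = v' t)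
    ?_ ?_ ?_ (Set.mem_univ s) (Set.mem_univ t)
  · exact this.1 h0
  · intro r _
    rw [nhdsWithin_univ]
    by_cases h : ∀ g ∈ A, c g r = 1
    · filter_upwards [(hv r).1 h, (hv' r).1 h] with s h1 h2
      rw [h1, h2]
    · push Not at h
      obtain ⟨g, hg, h⟩ := h
      obtain ⟨w, hw⟩ := (hv r).2 g hg h
      obtain ⟨w', hw'⟩ := (hv' r).2 g hg h
      filter_upwards [hw, hw'] with s h1 h2
      rw [h1, h2, hw.self_of_nhds, hw'.self_of_nhds, mul_left_inj, mul_left_inj]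
  · intro _ _ _ _ _ _ h1 h2
    exact h1.trans h2
  · intro _ _ _ _ h
    exact h.symm

theorem isLift_const {A : Finset S} {c : S → unitInterval → ℂ} (h : ∀ g ∈ A, ∀ t, c g t = 1)
    (w : FreeGroup S) : IsLift A c fun _ => w :=
  fun t => ⟨fun _ => Eventually.of_forall fun _ => rfl, fun g hg h' => absurd (h g hg t) h'⟩

/-- The turn is clockwise, so its first half runs through the lower half circle, in accordance with
the convention of `jump`. -/
theorem turn_im_nonpos_iff {t : unitInterval} (h : turn t ≠ 1) :
    (turn t).im ≤ 0 ↔ (t : ℝ) ≤ 1 / 2 := by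
  have h0 : (t : ℝ) ≠ 0 := by
    intro h0
    exact h (by rw [show t = 0 from Subtype.ext h0, turn_zero])
  have h1 : (t : ℝ) ≠ 1 := by
    intro h0
    exact h (by rw [show t = 1 from Subtype.ext h0, turn_one])
  have t0 : 0 < (t : ℝ) := lt_of_le_of_ne t.2.1 (Ne.symm h0)
  have t1 : (t : ℝ) < 1 := lt_of_le_of_ne t.2.2 h1
  have e : (turn t).im = -Real.sin (2 * Real.pi * t) := by
    rw [turn, Complex.exp_ofReal_mul_I_im, Real.sin_neg]
  rw [e]
  have hpi := Real.pi_pos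
  constructor
  · intro h2
    by_contra hc
    push Not at hc
    have : Real.sin (2 * Real.pi * t - 2 * Real.pi) < 0 :=
      Real.sin_neg_of_neg_of_neg_pi_lt (by nlinarith) (by nlinarith)
    rw [Real.sin_sub_two_pi] at this
    linarith
  · intro h2
    have := Real.sin_nonneg_of_nonneg_of_le_pi (x := 2 * Real.pi * t) (by positivity)
      (by nlinarith)
    linarith

open Classical in
/-- The lift of a loop which runs once around one circle. -/
theorem isLift_turn {A : Finset S} {c : S → unitInterval → ℂ} {g : S} (hgA : g ∈ A)
    (hg : ∀ t, c g t = turn t) (hne : ∀ h, h ≠ g → ∀ t, c h t = 1) (w : FreeGroup S) :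
    IsLift A c fun t => w * if (t : ℝ) ≤ 1 / 2 then 1 else FreeGroup.of g := by
  intro t
  constructor
  · intro h
    have h1 : turn t = 1 := (hg t).symm.trans (h g hgA)
    have hne2 : (t : ℝ) ≠ 1 / 2 := by
      intro h2
      rw [turn, h2] at h1
      have h3 := congrArg Complex.re h1
      rw [Complex.exp_ofReal_mul_I_re, Real.cos_neg,
        show 2 * Real.pi * (1 / 2) = Real.pi by ring, Real.cos_pi] at h3
      norm_num at h3
    rcases hne2.lt_or_gt with h2 | h2
    · filter_upwards [continuous_subtype_val.continuousAt.eventually (gt_mem_nhds h2)] with s hs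
      rw [if_pos hs.le, if_pos h2.le]
    · filter_upwards [continuous_subtype_val.continuousAt.eventually (lt_mem_nhds h2)] with s hs
      rw [if_neg (not_le.2 hs), if_neg (not_le.2 h2)]
  · intro h hA h1
    obtain rfl : h = g := by
      by_contra h2
      exact h1 (hne h h2 t)
    refine ⟨w, ?_⟩
    rw [hg] at h1
    filter_upwards [continuous_turn.continuousAt.eventually_ne h1] with s hs
    rw [jump, hg, if_congr (turn_im_nonpos_iff hs) rfl rfl]

/-- Lifts of a concatenation are restricted to its two halves by composing with these
reparametrizations. -/
theorem exists_halves {X : Type*} [TopologicalSpace X] {x y z : X} (γ₁ : Path x y)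
    (γ₂ : Path y z) : ∃ σ₁ σ₂ : unitInterval → unitInterval, Continuous σ₁ ∧ Continuous σ₂ ∧
      (∀ t, (γ₁.trans γ₂) (σ₁ t) = γ₁ t) ∧ (∀ t, (γ₁.trans γ₂) (σ₂ t) = γ₂ t) ∧
      σ₁ 0 = 0 ∧ σ₁ 1 = σ₂ 0 ∧ σ₂ 1 = 1 := by
  set σ₁ : unitInterval → unitInterval := fun t => ⟨(t : ℝ) / 2, by
    have := t.2.1; have := t.2.2; constructor <;> linarith⟩ with hσ₁
  set σ₂ : unitInterval → unitInterval := fun t => ⟨(1 + (t : ℝ)) / 2, by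
    have := t.2.1; have := t.2.2; constructor <;> linarith⟩ with hσ₂
  have c1 : Continuous σ₁ := Continuous.subtype_mk (by fun_prop) _
  have c2 : Continuous σ₂ := Continuous.subtype_mk (by fun_prop) _
  have e1 : ∀ t, (γ₁.trans γ₂) (σ₁ t) = γ₁ t := by
    intro t
    rw [Path.trans_apply, dif_pos (by simp only [hσ₁]; linarith [t.2.2])]
    congr 1; apply Subtype.ext; simp only [hσ₁]; ring
  have e2 : ∀ t, (γ₁.trans γ₂) (σ₂ t) = γ₂ t := by
    intro t
    rw [Path.trans_apply]
    split_ifs with h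
    · have ht : t = 0 := by
        apply Subtype.ext
        simp only [hσ₂] at h
        have := t.2.1
        simp only [Set.Icc.coe_zero]
        linarith
      subst ht
      rw [γ₂.source]
      convert γ₁.target
      simp [hσ₂]
    · congr 1; apply Subtype.ext; simp only [hσ₂]; ring
  exact ⟨σ₁, σ₂, c1, c2, e1, e2, Subtype.ext (by simp [hσ₁]), Subtype.ext (by simp [hσ₁, hσ₂]),
    Subtype.ext (by simp [hσ₂])⟩

end LiftLemmas

section Cover

variable {S : Type*} {X : Type*} [TopologicalSpace X]

/-- Coordinates of a subspace of a bouquet of circles. -/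
structure IsBouquetCoord (θ : S → X → ℂ) : Prop where
  cont : ∀ g, Continuous (θ g)
  norm : ∀ g x, ‖θ g x‖ = 1
  disj : ∀ x g h, g ≠ h → θ g x = 1 ∨ θ h x = 1

theorem IsBouquetCoord.isCoord {θ : S → X → ℂ} (hθ : IsBouquetCoord θ) {x y : X}
    (γ : Path x y) : IsCoord fun g t => θ g (γ t) :=
  ⟨fun g => (hθ.cont g).comp γ.continuous, fun g _ => hθ.norm g _, fun _ => hθ.disj _⟩

open Classical in
/-- The transition function of the Cayley covering. -/
def totalJump (θ : S → X → ℂ) (x : X) : FreeGroup S :=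
  if h : ∃ g, θ g x ≠ 1 then jump h.choose (θ h.choose x) else 1

theorem IsBouquetCoord.totalJump_eq {θ : S → X → ℂ} (hθ : IsBouquetCoord θ) {x : X} {g : S}
    (h : θ g x ≠ 1) : totalJump θ x = jump g (θ g x) := by
  have hex : ∃ g, θ g x ≠ 1 := ⟨g, h⟩
  have : hex.choose = g := by
    by_contra hne
    exact (hθ.disj x _ _ hne).elim hex.choose_spec h
  rw [totalJump, dif_pos hex, this]

theorem IsBouquetCoord.eventually_totalJump {θ : S → X → ℂ} (hθ : IsBouquetCoord θ) {x : X}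
    {g : S} (h : θ g x ≠ 1) (h' : θ g x ≠ -1) : ∀ᶠ y in 𝓝 x, totalJump θ y = totalJump θ x := by
  have him : Continuous fun y => (θ g y).im := Complex.continuous_im.comp (hθ.cont g)
  have h1 := (hθ.cont g).continuousAt.eventually_ne h
  rcases (unit_im_ne (hθ.norm g x) h h').lt_or_gt with hi | hi
  · filter_upwards [h1, him.continuousAt.eventually (gt_mem_nhds hi)] with y hy hy'
    rw [hθ.totalJump_eq h, hθ.totalJump_eq hy, jump, jump, if_pos hi.le, if_pos hy'.le]
  · filter_upwards [h1, him.continuousAt.eventually (lt_mem_nhds hi)] with y hy hy'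
    rw [hθ.totalJump_eq h, hθ.totalJump_eq hy, jump, jump, if_neg (not_le.2 hi),
      if_neg (not_le.2 hy')]

instance freeGroupTopology : TopologicalSpace (FreeGroup S) := ⊥

instance : DiscreteTopology (FreeGroup S) := ⟨rfl⟩

open Classical in
/-- The covering of a finite bouquet by the Cayley tree of the free group: the first chart is a
neighbourhood of the base point, and the second one is the complement of the base point. -/
def cayleyCore [Finite S] {θ : S → X → ℂ} (hθ : IsBouquetCoord θ) :
    FiberBundleCore Bool X (FreeGroup S) where
  baseSet i := if i then {x | ∀ g, θ g x ≠ -1} else {x | ∃ g, θ g x ≠ 1}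
  isOpen_baseSet i := by
    cases i
    · simp only [Bool.false_eq_true, if_false, Set.ofPred_exists]
      exact isOpen_iUnion fun g => isOpen_ne_fun (hθ.cont g) continuous_const
    · simp only [if_true, Set.ofPred_forall]
      exact isOpen_iInter_of_finite fun g => isOpen_ne_fun (hθ.cont g) continuous_const
  indexAt x := decide (∀ g, θ g x ≠ -1)
  mem_baseSet_at x := by
    by_cases h : ∀ g, θ g x ≠ -1
    · simp [h]
    · simp only [h, decide_false, Bool.false_eq_true, if_false]
      push Not at h
      obtain ⟨g, hg⟩ := h
      exact ⟨g, by rw [hg]; norm_num⟩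
  -- In the chart `false` the fibre coordinate is the initial vertex of the edge, in the chart
  -- `true` the nearest vertex; they differ by `totalJump`, which is locally constant on the overlap
  -- because a coordinate avoids both 1 and -1 there.
  coordChange i j x v := v * (if i then totalJump θ x else 1)⁻¹ * if j then totalJump θ x else 1
  coordChange_self i _ _ _ := by cases i <;> simp
  continuousOn_coordChange i j := by
    rintro ⟨x, v⟩ ⟨⟨hi, hj⟩, -⟩
    refine ContinuousAt.continuousWithinAt ?_
    by_cases hij : i = j
    · subst hij
      simp only [inv_mul_cancel_right]
      exact continuousAt_snd
    · have hx : (∀ g, θ g x ≠ -1) ∧ ∃ g, θ g x ≠ 1 := by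
        cases i <;> cases j <;> simp_all
      obtain ⟨h1, g, hg⟩ := hx
      have he : ∀ᶠ p : X × FreeGroup S in 𝓝 (x, v), totalJump θ p.1 = totalJump θ x :=
        continuousAt_fst.eventually (hθ.eventually_totalJump hg (h1 g))
      have hc : Continuous fun p : X × FreeGroup S =>
          p.2 * (if i then totalJump θ x else 1)⁻¹ * if j then totalJump θ x else 1 :=
        (continuous_of_discreteTopology (f := fun w : FreeGroup S =>
          w * (if i then totalJump θ x else 1)⁻¹ * if j then totalJump θ x else 1)).comp
          continuous_snd
      refine hc.continuousAt.congr ?_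
      filter_upwards [he] with p hp
      rw [hp]
  coordChange_comp i j k _ _ _ := by cases i <;> cases j <;> cases k <;> simp

theorem isCoveringMap_cayleyCore [Finite S] {θ : S → X → ℂ} (hθ : IsBouquetCoord θ) :
    IsCoveringMap (cayleyCore hθ).proj :=
  FiberBundle.isCoveringMap (F := FreeGroup S) (E := (cayleyCore hθ).Fiber)

/-- The vertex in the chart of a point of the Cayley covering. -/
def fiberVal [Finite S] {θ : S → X → ℂ} {hθ : IsBouquetCoord θ}
    (p : (cayleyCore hθ).TotalSpace) : FreeGroup S := p.2

theorem localTriv_true_of_forall [Finite S] {θ : S → X → ℂ} (hθ : IsBouquetCoord θ)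
    (p : (cayleyCore hθ).TotalSpace) (h : ∀ g, θ g p.1 ≠ -1) :
    ((cayleyCore hθ).localTriv true p).2 = fiberVal p := by
  have i1 : (cayleyCore hθ).indexAt p.1 = true := @decide_eq_true _ (Classical.propDecidable _) h
  rw [FiberBundleCore.localTriv_apply, i1]
  exact inv_mul_cancel_right _ _

/-- The preferred chart always shows the nearest vertex: at a midpoint the chart `false` is used,
but the jump is trivial there. -/
theorem fiberVal_eq [Finite S] {θ : S → X → ℂ} (hθ : IsBouquetCoord θ)
    (p : (cayleyCore hθ).TotalSpace) {g : S} (h : θ g p.1 ≠ 1) :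
    fiberVal p = ((cayleyCore hθ).localTriv false p).2 * jump g (θ g p.1) := by
  rw [FiberBundleCore.localTriv_apply, ← hθ.totalJump_eq h]
  by_cases hi : ∀ g, θ g p.1 ≠ -1
  · have i1 : (cayleyCore hθ).indexAt p.1 = true :=
      @decide_eq_true _ (Classical.propDecidable _) hi
    rw [i1]
    change _ = fiberVal p * (totalJump θ p.1)⁻¹ * 1 * totalJump θ p.1
    rw [mul_one, inv_mul_cancel_right]
  · have i1 : (cayleyCore hθ).indexAt p.1 = false :=
      @decide_eq_false _ (Classical.propDecidable _) hi
    rw [i1]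
    push Not at hi
    obtain ⟨k, hk⟩ := hi
    have : totalJump θ p.1 = 1 := by
      rw [hθ.totalJump_eq (g := k) (by rw [hk]; norm_num), hk, jump]
      simp
    rw [this]
    change _ = fiberVal p * 1⁻¹ * 1 * 1
    simp

theorem isLift_of_cayleyCore [Fintype S] {θ : S → X → ℂ} (hθ : IsBouquetCoord θ) {x y : X}
    (γ : Path x y) (Γ : C(unitInterval, (cayleyCore hθ).TotalSpace))
    (h : ∀ t, (Γ t).1 = γ t) :
    IsLift Finset.univ (fun g t => θ g (γ t)) fun t => fiberVal (Γ t) := by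
  have key : ∀ i t, γ t ∈ (cayleyCore hθ).baseSet i → ∀ᶠ s in 𝓝 t,
      ((cayleyCore hθ).localTriv i (Γ s)).2 = ((cayleyCore hθ).localTriv i (Γ t)).2 := by
    intro i t ht
    have hs : Γ t ∈ ((cayleyCore hθ).localTriv i).source := by
      rw [FiberBundleCore.mem_localTriv_source]
      rw [← h t] at ht
      exact ht
    have hc : ContinuousAt (fun s => ((cayleyCore hθ).localTriv i (Γ s)).2) t :=
      continuousAt_snd.comp ((((cayleyCore hθ).localTriv i).continuousAt hs).comp
        Γ.continuous.continuousAt)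
    exact hc.eventually (p := fun w => w = ((cayleyCore hθ).localTriv i (Γ t)).2)
      (mem_nhds_discrete.2 rfl)
  intro t
  constructor
  · intro h1
    have h0 : ∀ᶠ s in 𝓝 t, ∀ g, θ g (γ s) ≠ -1 := by
      rw [eventually_all]
      intro g
      refine ((hθ.cont g).comp γ.continuous).continuousAt.eventually_ne ?_
      have := h1 g (Finset.mem_univ g)
      simp only [Function.comp_apply, this]
      norm_num
    filter_upwards [h0, key true t h0.self_of_nhds] with s hs hs'
    rwa [localTriv_true_of_forall hθ _ (by rw [h]; exact hs),
      localTriv_true_of_forall hθ _ (by rw [h]; exact h0.self_of_nhds)] at hs'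
  · intro g _ h1
    have h0 : ∀ᶠ s in 𝓝 t, θ g (γ s) ≠ 1 :=
      ((hθ.cont g).comp γ.continuous).continuousAt.eventually_ne h1
    refine ⟨((cayleyCore hθ).localTriv false (Γ t)).2, ?_⟩
    filter_upwards [h0, key false t ⟨g, h1⟩] with s hs hs'
    rw [← hs', fiberVal_eq hθ (Γ s) (g := g) (by rw [h]; exact hs), h]

/-- Path lifting in the Cayley covering, read through `fiberVal`. -/
theorem exists_cayley_lift [Fintype S] {θ : S → X → ℂ} (hθ : IsBouquetCoord θ) {x y : X}
    (γ : Path x y) (w : FreeGroup S) :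
    ∃ v, IsLift Finset.univ (fun g t => θ g (γ t)) v ∧ v 0 = w := by
  set e : (cayleyCore hθ).TotalSpace := ⟨x, w⟩ with he
  have h0 : (γ : C(unitInterval, X)) 0 = (cayleyCore hθ).proj e := γ.source
  have h1 := (isCoveringMap_cayleyCore hθ).liftPath_lifts γ e h0
  have h2 := (isCoveringMap_cayleyCore hθ).liftPath_zero γ e h0
  refine ⟨_, isLift_of_cayleyCore hθ γ ((isCoveringMap_cayleyCore hθ).liftPath γ e h0)
    fun t => congrFun h1 t, ?_⟩
  rw [h2]
  rfl

/-- Uniqueness identifies `v` and `v'` with lifts in the covering, where homotopy lifting applies.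
-/
theorem lift_endpoint_eq [Fintype S] {θ : S → X → ℂ} (hθ : IsBouquetCoord θ) {x y : X}
    {γ γ' : Path x y} (h : γ.Homotopic γ') {v v' : unitInterval → FreeGroup S}
    (hv : IsLift Finset.univ (fun g t => θ g (γ t)) v)
    (hv' : IsLift Finset.univ (fun g t => θ g (γ' t)) v') (h0 : v 0 = v' 0) : v 1 = v' 1 := by
  set e : (cayleyCore hθ).TotalSpace := ⟨x, v 0⟩ with he
  have hcov := isCoveringMap_cayleyCore hθ
  have h1 : (γ : C(unitInterval, X)) 0 = (cayleyCore hθ).proj e := γ.source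
  have h1' : (γ' : C(unitInterval, X)) 0 = (cayleyCore hθ).proj e := γ'.source
  have l1 := isLift_of_cayleyCore hθ γ (hcov.liftPath γ e h1)
    fun t => congrFun (hcov.liftPath_lifts γ e h1) t
  have l2 := isLift_of_cayleyCore hθ γ' (hcov.liftPath γ' e h1')
    fun t => congrFun (hcov.liftPath_lifts γ' e h1') t
  have e1 := hv.unique l1 (s := 0) (by rw [hcov.liftPath_zero]; rfl) 1
  have e2 := hv'.unique l2 (s := 0) (by rw [hcov.liftPath_zero, ← h0]; rfl) 1
  exact e1.trans ((congrArg fiberVal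
    (hcov.liftPath_apply_one_eq_of_homotopicRel h e h1 h1')).trans e2.symm)

end Cover

section Free

variable {S : Type*} [Fintype S] [DecidableEq S] {X : Type*} [TopologicalSpace X] {x : X}
  {θ : S → X → ℂ}

/-- The endpoint of the lift of a loop is determined by its class. -/
theorem lift_endpoint (hθ : IsBouquetCoord θ) {l : S → Path x x}
    (hl : ∀ g h t, θ h (l g t) = if h = g then turn t else 1) (u : FreeGroup S) :
    ∀ {γ : Path x x}, loopClass γ = FreeGroup.lift (fun g => loopClass (l g)) u →
      ∀ {v}, IsLift Finset.univ (fun g t => θ g (γ t)) v → v 1 = v 0 * u := by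
  induction u using FreeGroup.induction_on with
  | C1 =>
    intro γ hγ v hv
    rw [map_one, ← loopClass_refl, loopClass_eq_iff] at hγ
    -- A generating loop shows that the base point has coordinates 1; without generators the free
    -- group is trivial.
    by_cases hS : Nonempty S
    · rw [mul_one]
      have hx : ∀ g, θ g x = 1 := fun g => by
        have := hl g g 0
        rwa [(l g).source, if_pos rfl, turn_zero] at this
      exact lift_endpoint_eq hθ hγ hv (isLift_const (fun g _ t => hx g) (v 0)) rfl
    · rw [not_nonempty_iff] at hS
      exact Subsingleton.elim _ _
  | of g =>
    intro γ hγ v hv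
    rw [FreeGroup.lift_apply_of, loopClass_eq_iff] at hγ
    have := lift_endpoint_eq hθ hγ hv (isLift_turn (g := g) (Finset.mem_univ g)
      (fun t => by rw [hl, if_pos rfl]) (fun h hh t => by rw [hl, if_neg hh]) (v 0)) (by norm_num)
    rw [this]; norm_num
  | inv_of g ih =>
    intro γ hγ v hv
    have h1 := ih (γ := γ.symm) (by rw [loopClass_symm, hγ, map_inv, inv_inv])
      (hv.comp unitInterval.continuous_symm)
    simp only [Function.comp_apply, unitInterval.symm_one, unitInterval.symm_zero] at h1
    rw [h1]; simp
  | mul u₁ u₂ h1 h2 =>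
    intro γ hγ v hv
    obtain ⟨γ₁, hγ₁⟩ := exists_loopClass (FreeGroup.lift (fun g => loopClass (l g)) u₁)
    obtain ⟨γ₂, hγ₂⟩ := exists_loopClass (FreeGroup.lift (fun g => loopClass (l g)) u₂)
    rw [map_mul, ← hγ₁, ← hγ₂, ← loopClass_trans, loopClass_eq_iff] at hγ
    obtain ⟨v', hv', h0⟩ := exists_cayley_lift hθ (γ₁.trans γ₂) (v 0)
    rw [lift_endpoint_eq hθ hγ hv hv' h0.symm, ← h0]
    obtain ⟨σ₁, σ₂, c1, c2, e1, e2, s0, s1, s2⟩ := exists_halves γ₁ γ₂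
    have l1 := hv'.comp c1
    have l2 := hv'.comp c2
    simp only [e1] at l1
    simp only [e2] at l2
    have r1 := h1 hγ₁ l1
    have r2 := h2 hγ₂ l2
    simp only [Function.comp_apply, s0, s1, s2] at r1 r2
    rw [r2, r1, mul_assoc]

/-- The fundamental group of a finite bouquet of circles is free. -/
theorem bijective_lift_loopClass (hθ : IsBouquetCoord θ) (hinj : ∀ y z, (∀ g, θ g y = θ g z) → y = z)
    (hx : ∀ g, θ g x = 1) {l : S → Path x x}
    (hl : ∀ g h t, θ h (l g t) = if h = g then turn t else 1) :
    Function.Bijective (FreeGroup.lift fun g => loopClass (l g)) := by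
  constructor
  -- A word representing the constant loop is the endpoint of the constant lift.
  · rw [injective_iff_map_eq_one]
    intro u hu
    have := lift_endpoint hθ hl u (γ := Path.refl x) (by rw [hu, loopClass_refl])
      (isLift_const (fun g _ t => hx g) 1)
    simpa using this.symm
  · intro y
    obtain ⟨γ, rfl⟩ := exists_loopClass y
    obtain ⟨v, hv, hv0⟩ := exists_cayley_lift hθ γ 1
    -- The endpoint of the lift of `γ` is the required word. Cancelling it from `γ` leaves a loop
    -- with a closed lift, to which the tree criterion applies; as `S` is finite, the full set of
    -- circles lies above every `A`.
    refine ⟨v 1, ?_⟩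
    obtain ⟨β, hβ⟩ := exists_loopClass (FreeGroup.lift (fun g => loopClass (l g)) (v 1))
    obtain ⟨v', hv', h0⟩ := exists_cayley_lift hθ (γ.trans β.symm) 1
    have hnull : (γ.trans β.symm).Homotopic (Path.refl x) := by
      refine nullhomotopic_of_lifts _ (hθ.isCoord _) (fun g => ?_) (fun g => ?_)
        (fun s t h => hinj _ _ h) (frequently_atTop.2 fun A => ⟨Finset.univ,
          Finset.subset_univ A, v', hv', h0, ?_⟩)
      · rw [Path.source]; exact hx g
      · rw [Path.target]; exact hx g
      · obtain ⟨σ₁, σ₂, c1, c2, e1, e2, s0, s1, s2⟩ := exists_halves γ β.symm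
        have l1 := hv'.comp c1
        have l2 := hv'.comp c2
        simp only [e1] at l1
        simp only [e2] at l2
        have r1 := l1.unique hv (s := 0) (by simp [s0, h0, hv0]) 1
        have r2 := lift_endpoint hθ hl (v 1)⁻¹ (γ := β.symm)
          (by rw [loopClass_symm, hβ, map_inv]) l2
        simp only [Function.comp_apply, s1, s2] at r1 r2
        rw [r2, r1, mul_inv_cancel]
    have := loopClass_eq_iff.2 hnull
    rw [loopClass_trans, loopClass_symm, hβ, loopClass_refl, mul_inv_eq_one] at this
    exact this.symm

end Free

end HawaiianPants

end

/-! ### Topology of ℙ, and coordinates along its circles -/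

noncomputable section

namespace HawaiianPants

open Filter Topology

/-! ### Points of the Hawaiian Pants -/

theorem turn_surjective {z : ℂ} (hz : ‖z‖ = 1) : ∃ t, turn t = z := by
  have hpi := Real.pi_pos
  have h1 := Complex.neg_pi_lt_arg z
  have h2 := Complex.arg_le_pi z
  have hz' : Complex.exp (Complex.arg z * Complex.I) = z := by
    have := Complex.norm_mul_exp_arg_mul_I z
    rwa [hz, Complex.ofReal_one, one_mul] at this
  by_cases h : Complex.arg z ≤ 0
  · refine ⟨⟨-Complex.arg z / (2 * Real.pi), by apply div_nonneg <;> linarith, by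
      rw [div_le_one (by positivity)]; linarith⟩, ?_⟩
    refine Eq.trans ?_ hz'
    rw [turn]
    congr 3
    field_simp
  · refine ⟨⟨1 - Complex.arg z / (2 * Real.pi), by
      rw [sub_nonneg, div_le_one (by positivity)]; linarith, by
      have : 0 ≤ Complex.arg z / (2 * Real.pi) := by
        push Not at h; positivity
      linarith⟩, ?_⟩
    refine Eq.trans ?_ hz'
    rw [turn, ← Complex.exp_periodic.sub_eq (Complex.arg z * Complex.I)]
    congr 1
    have : ((-(2 * Real.pi * (1 - Complex.arg z / (2 * Real.pi))) : ℝ) : ℂ)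
        = Complex.arg z - 2 * Real.pi := by
      rw [show -(2 * Real.pi * (1 - Complex.arg z / (2 * Real.pi)))
        = Complex.arg z - 2 * Real.pi by field_simp; ring]
      push_cast; ring
    rw [this]; ring

theorem exists_ell_eq {i : ℕ+} {p : earring} (hp : (p : ℂ) ∈ circ i) : ∃ t, ell i t = p := by
  have hi : (i : ℂ) ≠ 0 := by exact_mod_cast i.pos.ne'
  obtain ⟨t, ht⟩ := turn_surjective (z := 1 - i * p) (by
    rw [circ, mem_sphere_iff_norm] at hp
    have : (1 : ℂ) - i * p = -(i * (p - 1 / i)) := by field_simp; ring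
    rw [this, norm_neg, norm_mul, hp]
    have : (i : ℝ) ≠ 0 := by exact_mod_cast i.pos.ne'
    simp [this])
  refine ⟨t, Subtype.ext ?_⟩
  change (1 / (i : ℂ)) * (1 - turn t) = p
  rw [ht]; field_simp; ring

theorem turn_eq_one_of_ell_eq_origin {i : ℕ+} {t : unitInterval} (h : ell i t = origin) :
    turn t = 1 := by
  have h' : (1 / (i : ℂ)) * (1 - turn t) = 0 := congrArg Subtype.val h
  have hi : (i : ℂ) ≠ 0 := by exact_mod_cast i.pos.ne'
  have : (1 : ℂ) - turn t = 0 := by simpa [hi] using h'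
  linear_combination -this

/-- A common point of two different circles lies in the tail set of the smaller circle, which meets
the larger one only in the origin. -/
theorem ell_eq_ell {i j : ℕ+} {s t : unitInterval} (h : ell i s = ell j t) :
    (i = j ∧ turn s = turn t) ∨ (turn s = 1 ∧ turn t = 1) := by
  by_cases hij : i = j
  · subst hij
    have h' : (1 / (i : ℂ)) * (1 - turn s) = (1 / (i : ℂ)) * (1 - turn t) := congrArg Subtype.val h
    have hi : (i : ℂ) ≠ 0 := by exact_mod_cast i.pos.ne'
    have := mul_left_cancel₀ (one_div_ne_zero hi) h'
    exact Or.inl ⟨rfl, by linear_combination -this⟩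
  · have key : ∀ {i j : ℕ+} {s t : unitInterval}, (i : ℕ) < j → ell i s = ell j t →
        ell i s = origin := fun {i j s t} hlt h => eq_origin_of_mem_tail hlt (ell_mem i s)
          (h ▸ mem_tail_of_mem_circ le_rfl (ell_mem j t))
    have h0 : ell i s = origin := by
      rcases lt_or_gt_of_ne (fun e => hij (PNat.coe_injective e) : (i : ℕ) ≠ j) with hlt | hlt
      · exact key hlt h
      · rw [h]; exact key hlt h.symm
    exact Or.inr ⟨turn_eq_one_of_ell_eq_origin h0, turn_eq_one_of_ell_eq_origin (h ▸ h0)⟩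

theorem eq_of_turn_eq {s t : unitInterval} (h : turn s = turn t) :
    s = t ∨ (s = 0 ∧ t = 1) ∨ (s = 1 ∧ t = 0) := by
  rw [turn, turn, Complex.exp_eq_exp_iff_exists_int] at h
  obtain ⟨n, hn⟩ := h
  have h1 : -(2 * Real.pi * (s : ℝ)) = -(2 * Real.pi * (t : ℝ)) + n * (2 * Real.pi) := by
    have := congrArg Complex.im hn
    simpa using this
  have h2 : (t : ℝ) - s = n := by
    have : 2 * Real.pi * ((t : ℝ) - s - n) = 0 := by linarith
    have := (mul_eq_zero.1 this).resolve_left (by positivity)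
    linarith
  have hs := s.2
  have ht := t.2
  have e0 : ((0 : unitInterval) : ℝ) = 0 := rfl
  have e1 : ((1 : unitInterval) : ℝ) = 1 := rfl
  have h5 : n ≤ 1 := by exact_mod_cast (by linarith [hs.1, ht.2] : (n : ℝ) ≤ 1)
  have h6 : -1 ≤ n := by exact_mod_cast (by linarith [hs.2, ht.1] : (-1 : ℝ) ≤ n)
  rcases (by omega : n = 0 ∨ n = 1 ∨ n = -1) with rfl | rfl | rfl <;> push_cast at h2
  · exact Or.inl (Subtype.ext (by linarith))
  · exact Or.inr (Or.inl ⟨Subtype.ext (by linarith [hs.1, ht.2]),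
      Subtype.ext (by linarith [hs.1, ht.2])⟩)
  · exact Or.inr (Or.inr ⟨Subtype.ext (by linarith [hs.2, ht.1]),
      Subtype.ext (by linarith [hs.2, ht.1])⟩)

theorem turn_eq_one_iff {t : unitInterval} : turn t = 1 ↔ t = 0 ∨ t = 1 := by
  constructor
  · intro h
    rcases eq_of_turn_eq (h.trans turn_zero.symm) with h | h | h
    · exact Or.inl h
    · exact Or.inl h.1
    · exact Or.inr h.1
  · rintro (rfl | rfl)
    · exact turn_zero
    · exact turn_one

theorem arc_re (j : Fin 2) (s : unitInterval) : (arc j s : ℂ).re = -4 + 3 * s := by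
  change ((-4 : ℂ) + (s : ℝ) * (legCenter j + 3)).re = _
  simp [legCenter_re, mul_comm]

theorem arc_im (j : Fin 2) (s : unitInterval) :
    (arc j s : ℂ).im = if j = 0 then 2 * (s : ℝ) else -(2 * s) := by
  change ((-4 : ℂ) + (s : ℝ) * (legCenter j + 3)).im = _
  unfold legCenter
  split_ifs <;> simp [mul_comm]

theorem arc_eq_arc {i j : Fin 2} {s t : unitInterval} (h : arc i s = arc j t) :
    s = t ∧ (i = j ∨ s = 0) := by
  have h1 := congrArg (fun z : pants => (z : ℂ).re) h
  simp only [arc_re] at h1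
  have hst : s = t := Subtype.ext (by linarith)
  subst hst
  refine ⟨rfl, ?_⟩
  have h2 := congrArg (fun z : pants => (z : ℂ).im) h
  simp only [arc_im] at h2
  by_contra hc
  push Not at hc
  have h0 : (s : ℝ) ≠ 0 := fun h => hc.2 (Subtype.ext h)
  have hi : i = 0 ∨ i = 1 := by omega
  have hj : j = 0 ∨ j = 1 := by omega
  rcases hi with rfl | rfl <;> rcases hj with rfl | rfl <;> simp at hc h2 <;>
    exact h0 (by linarith)

theorem arc_eq_waist' {j : Fin 2} {s t : unitInterval} (h : arc j s = waist t) : s = 0 := by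
  have h1 : waist t = arc j 0 := by
    rw [(arc j).source]
    apply Subtype.ext
    change -(4 * turn t) = -4
    rw [arc_eq_waist h]; ring
  exact (arc_eq_arc (h.trans h1)).1

theorem arc_eq_leg' {i j : Fin 2} {s t : unitInterval} (h : arc i s = leg j t) : s = 1 := by
  have h1 : leg j t = arc j 1 := by
    rw [(arc j).target]
    apply Subtype.ext
    change legCenter j - turn t = legCenter j - 1
    rw [arc_eq_leg h]
  exact (arc_eq_arc (h.trans h1)).1

/-- The points of the boundary of the pair of pants. -/
def pantsBoundary : Set pants := Set.range waist ∪ ⋃ j, Set.range (leg j)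

theorem arc_mem_boundary {j : Fin 2} {s : unitInterval} (h : arc j s ∈ pantsBoundary) :
    s = 0 ∨ s = 1 := by
  rcases h with ⟨t, ht⟩ | h
  · exact Or.inl (arc_eq_waist' ht.symm)
  · obtain ⟨j', t, ht⟩ := Set.mem_iUnion.1 h
    exact Or.inr (arc_eq_leg' ht.symm)

open Classical in
/-- Normal forms of the points of the Hawaiian Pants. -/
def normalForm : (earring ⊕ (Σ _ : ℕ+, pants)) → (earring ⊕ (Σ _ : ℕ+, pants))
  | Sum.inl p => Sum.inl p
  | Sum.inr ⟨m, z⟩ =>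
    if h : ∃ t, waist t = z then Sum.inl (ell m h.choose)
    else if h : ∃ q : Fin 2 × unitInterval, leg q.1 q.2 = z then
      Sum.inl (ell (legIndex m h.choose.1) h.choose.2)
    else Sum.inr ⟨m, z⟩

theorem normalForm_waist (m : ℕ+) (t : unitInterval) :
    normalForm (Sum.inr ⟨m, waist t⟩) = Sum.inl (ell m t) := by
  have h : ∃ s, waist s = waist t := ⟨t, rfl⟩
  rw [normalForm, dif_pos h, ell_congr m (waist_eq h.choose_spec)]

theorem normalForm_leg (m : ℕ+) (j : Fin 2) (t : unitInterval) :
    normalForm (Sum.inr ⟨m, leg j t⟩) = Sum.inl (ell (legIndex m j) t) := by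
  have h : ¬ ∃ s, waist s = leg j t := fun ⟨s, hs⟩ => waist_ne_leg _ _ _ hs
  have h' : ∃ q : Fin 2 × unitInterval, leg q.1 q.2 = leg j t := ⟨(j, t), rfl⟩
  obtain ⟨h1, h2⟩ := leg_eq h'.choose_spec
  rw [normalForm, dif_neg h, dif_pos h', ell_congr _ h2, h1]

theorem normalForm_of_not_mem {m : ℕ+} {z : pants} (hz : z ∉ pantsBoundary) :
    normalForm (Sum.inr ⟨m, z⟩) = Sum.inr ⟨m, z⟩ := by
  rw [normalForm, dif_neg, dif_neg]
  · exact fun ⟨q, hq⟩ => hz (Or.inr (Set.mem_iUnion.2 ⟨q.1, q.2, hq⟩))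
  · exact fun ⟨t, ht⟩ => hz (Or.inl ⟨t, ht⟩)

/-- Normal forms respect the gluing and thus decide when two points of the disjoint union become
equal in the quotient. -/
theorem normalForm_eq {x y : earring ⊕ (Σ _ : ℕ+, pants)} (h : Quot.mk Glue x = Quot.mk Glue y) :
    normalForm x = normalForm y := by
  refine congrArg (Quot.lift normalForm fun x y h => ?_) h
  cases h with
  | waist m t => exact normalForm_waist m t
  | leg m j t => exact normalForm_leg m j t

theorem ofPants_waist (m : ℕ+) (t : unitInterval) : ofPants m (waist t) = ofEarring (ell m t) :=
  Quot.sound (Glue.waist m t)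

theorem ofPants_leg (m : ℕ+) (j : Fin 2) (t : unitInterval) :
    ofPants m (leg j t) = ofEarring (ell (legIndex m j) t) :=
  Quot.sound (Glue.leg m j t)

theorem ofEarring_injective : Function.Injective ofEarring := fun _ _ h =>
  Sum.inl_injective (normalForm_eq h)

theorem mem_boundary_of_eq {m : ℕ+} {z : pants} {p : earring} (h : ofPants m z = ofEarring p) :
    z ∈ pantsBoundary := by
  by_contra hz
  have := normalForm_eq h
  rw [normalForm_of_not_mem hz] at this
  exact Sum.inr_ne_inl this

theorem exists_ofEarring_of_mem_boundary (m : ℕ+) {z : pants} (h : z ∈ pantsBoundary) :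
    ∃ p, ofEarring p = ofPants m z := by
  rcases h with ⟨t, rfl⟩ | h
  · exact ⟨_, (ofPants_waist m t).symm⟩
  · obtain ⟨j, t, rfl⟩ := Set.mem_iUnion.1 h
    exact ⟨_, (ofPants_leg m j t).symm⟩

theorem ofPants_inj {m m' : ℕ+} {z z' : pants} (h : ofPants m z = ofPants m' z')
    (hz : z ∉ pantsBoundary) : m = m' ∧ z = z' := by
  have hz' : z' ∉ pantsBoundary := by
    intro hz'
    obtain ⟨p, hp⟩ := exists_ofEarring_of_mem_boundary m' hz'
    exact hz (mem_boundary_of_eq (h.trans hp.symm))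
  have := normalForm_eq h
  rw [normalForm_of_not_mem hz, normalForm_of_not_mem hz'] at this
  have h1 := Sum.inr_injective this
  simp only [Sigma.mk.injEq, heq_eq_eq] at h1
  exact h1

theorem isClosed_pantsSpace {K : Set PantsSpace} (h1 : IsClosed (ofEarring ⁻¹' K))
    (h2 : ∀ m, IsClosed (ofPants m ⁻¹' K)) : IsClosed K := by
  have hq : IsClosed (Quot.mk Glue ⁻¹' K) := by
    rw [isClosed_sum_iff]
    refine ⟨h1, ?_⟩
    rw [isClosed_sigma_iff]
    exact h2
  exact isQuotientMap_quot_mk.isClosed_preimage.1 hq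

theorem isClosed_path_image {X : Type*} [TopologicalSpace X] [T2Space X] {a b : X} (γ : Path a b)
    {T : Set unitInterval} (hT : IsClosed T) : IsClosed (γ '' T) :=
  (hT.isCompact.image γ.continuous).isClosed

/-- On a pair of pants, the image of a closed set is traced out by the boundary parametrizations on
closed sets of times, so it is a finite union of compact sets. -/
theorem isClosedMap_ofEarring : IsClosedMap ofEarring := by
  intro T hT
  refine isClosed_pantsSpace ?_ fun m => ?_
  · rwa [Set.preimage_image_eq _ ofEarring_injective]
  · have : ofPants m ⁻¹' (ofEarring '' T) = waist '' (ell m ⁻¹' T) ∪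
        ⋃ j : Fin 2, leg j '' (ell (legIndex m j) ⁻¹' T) := by
      ext z
      constructor
      · rintro ⟨p, hp, h⟩
        rcases mem_boundary_of_eq h.symm with ⟨t, rfl⟩ | hz
        · rw [ofPants_waist] at h
          exact Or.inl ⟨t, (ofEarring_injective h).subst (motive := (· ∈ T)) hp, rfl⟩
        · obtain ⟨j, t, rfl⟩ := Set.mem_iUnion.1 hz
          rw [ofPants_leg] at h
          exact Or.inr (Set.mem_iUnion.2 ⟨j, t, (ofEarring_injective h).subst (motive := (· ∈ T)) hp, rfl⟩)
      · rintro (⟨t, ht, rfl⟩ | hz)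
        · exact ⟨_, ht, (ofPants_waist m t).symm⟩
        · obtain ⟨j, t, ht, rfl⟩ := Set.mem_iUnion.1 hz
          exact ⟨_, ht, (ofPants_leg m j t).symm⟩
    rw [this]
    exact (isClosed_path_image _ (hT.preimage (ell m).continuous)).union
      (isClosed_iUnion_of_finite fun j => isClosed_path_image _ (hT.preimage (ell _).continuous))

theorem isClosedMap_ofPants (m : ℕ+) : IsClosedMap (ofPants m) := by
  intro T hT
  -- The trace on the earring of the boundary points of `T`; away from the boundary nothing is
  -- identified.
  set E : Set earring := ell m '' (waist ⁻¹' T) ∪ ⋃ j : Fin 2, ell (legIndex m j) '' (leg j ⁻¹' T)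
    with hE
  have hEc : IsClosed E := (isClosed_path_image _ (hT.preimage waist.continuous)).union
    (isClosed_iUnion_of_finite fun j => isClosed_path_image _ (hT.preimage (leg j).continuous))
  have key : ofPants m '' T = ofPants m '' (T \ pantsBoundary) ∪ ofEarring '' E := by
    ext x
    constructor
    · rintro ⟨z, hz, rfl⟩
      by_cases hb : z ∈ pantsBoundary
      · rcases hb with ⟨t, rfl⟩ | hb
        · exact Or.inr ⟨_, Or.inl ⟨t, hz, rfl⟩, (ofPants_waist m t).symm⟩
        · obtain ⟨j, t, rfl⟩ := Set.mem_iUnion.1 hb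
          exact Or.inr ⟨_, Or.inr (Set.mem_iUnion.2 ⟨j, t, hz, rfl⟩), (ofPants_leg m j t).symm⟩
      · exact Or.inl ⟨z, ⟨hz, hb⟩, rfl⟩
    · rintro (⟨z, hz, rfl⟩ | ⟨p, ⟨t, ht, rfl⟩ | hp, rfl⟩)
      · exact ⟨z, hz.1, rfl⟩
      · exact ⟨_, ht, ofPants_waist m t⟩
      · obtain ⟨j, t, ht, rfl⟩ := Set.mem_iUnion.1 hp
        exact ⟨_, ht, ofPants_leg m j t⟩
  refine isClosed_pantsSpace ?_ fun m' => ?_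
  · have : ofEarring ⁻¹' (ofPants m '' T) = E := by
      rw [key, Set.preimage_union, Set.preimage_image_eq _ ofEarring_injective,
        Set.union_eq_right]
      rintro p ⟨z, hz, h⟩
      exact absurd (mem_boundary_of_eq h) hz.2
    rwa [this]
  · by_cases hm : m = m'
    · subst hm
      have : ofPants m ⁻¹' (ofPants m '' T) = T ∪ ofPants m ⁻¹' (ofEarring '' E) := by
        apply Set.Subset.antisymm
        · rw [key]
          rintro z (⟨w, hw, h⟩ | h)
          · exact Or.inl ((ofPants_inj h hw.2).2 ▸ hw.1)
          · exact Or.inr h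
        · rintro z (hz | hz)
          · exact ⟨z, hz, rfl⟩
          · rw [key]; exact Or.inr hz
      rw [this]
      exact hT.union ((isClosedMap_ofEarring _ hEc).preimage (continuous_ofPants m))
    · have : ofPants m' ⁻¹' (ofPants m '' T) = ofPants m' ⁻¹' (ofEarring '' E) := by
        rw [key, Set.preimage_union, Set.union_eq_right]
        rintro z ⟨w, hw, h⟩
        exact absurd (ofPants_inj h hw.2).1 hm
      rw [this]
      exact (isClosedMap_ofEarring _ hEc).preimage (continuous_ofPants m')

/-- A closed map allows continuity on the image of a closed set to be tested upstairs. -/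
theorem continuousOn_image_of_isClosedMap {A B C : Type*} [TopologicalSpace A] [TopologicalSpace B]
    [TopologicalSpace C] {g : A → B} (hg : IsClosedMap g) {f : B → C} {T : Set A}
    (hT : IsClosed T) (h : ContinuousOn (f ∘ g) T) : ContinuousOn f (g '' T) := by
  rw [continuousOn_iff_isClosed]
  intro K hK
  refine ⟨g '' (T ∩ (f ∘ g) ⁻¹' K), hg _ (h.preimage_isClosed_of_isClosed hT hK), ?_⟩
  ext y
  constructor
  · rintro ⟨hy, x, hx, rfl⟩
    exact ⟨⟨x, ⟨hx, hy⟩, rfl⟩, x, hx, rfl⟩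
  · rintro ⟨⟨x, ⟨hx, hy⟩, rfl⟩, -⟩
    exact ⟨hy, x, hx, rfl⟩

/-! ### Coordinates -/

theorem rhoLoop_apply (m : ℕ+) (j : Fin 2) (t : unitInterval) :
    rhoLoop m j t = ofPants m (arc j t) := rfl

theorem ellLoop_apply (m : ℕ+) (t : unitInterval) : ellLoop m t = ofEarring (ell m t) := rfl

theorem rhoLoop_eq_ofEarring {m : ℕ+} {j : Fin 2} {t : unitInterval} {p : earring}
    (h : rhoLoop m j t = ofEarring p) : turn t = 1 ∧ p = origin := by
  have ht := arc_mem_boundary (mem_boundary_of_eq h)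
  refine ⟨turn_eq_one_iff.2 ht, ofEarring_injective ?_⟩
  rw [← h]
  rcases ht with rfl | rfl
  · exact (rhoLoop m j).source
  · exact (rhoLoop m j).target

theorem Gen.loop_eq_base (g : Gen) {t : unitInterval} (h : turn t = 1) : g.loop t = base := by
  rcases turn_eq_one_iff.1 h with rfl | rfl
  · exact g.loop.source
  · exact g.loop.target

/-- An arc meets the boundary of its pair of pants only at its ends, and these are glued to the base
point. This makes `coord` independent of the chosen time. -/
theorem Gen.loop_eq_loop {g h : Gen} {s t : unitInterval} (e : g.loop s = h.loop t) :
    (g = h ∧ turn s = turn t) ∨ (turn s = 1 ∧ turn t = 1) := by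
  cases g with
  | ell i =>
    cases h with
    | ell i' =>
      rcases ell_eq_ell (ofEarring_injective e) with ⟨rfl, h⟩ | h
      · exact Or.inl ⟨rfl, h⟩
      · exact Or.inr h
    | rho i' j' =>
      obtain ⟨h1, h2⟩ := rhoLoop_eq_ofEarring e.symm
      exact Or.inr ⟨turn_eq_one_of_ell_eq_origin h2, h1⟩
  | rho i j =>
    cases h with
    | ell i' =>
      obtain ⟨h1, h2⟩ := rhoLoop_eq_ofEarring e
      exact Or.inr ⟨h1, turn_eq_one_of_ell_eq_origin h2⟩
    | rho i' j' =>
      by_cases hb : arc j s ∈ pantsBoundary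
      · have hs := turn_eq_one_iff.2 (arc_mem_boundary hb)
        have : rhoLoop i' j' t = ofEarring origin :=
          e.symm.trans ((Gen.rho i j).loop_eq_base hs)
        exact Or.inr ⟨hs, (rhoLoop_eq_ofEarring this).1⟩
      · obtain ⟨rfl, h2⟩ := ofPants_inj e hb
        obtain ⟨rfl, h3⟩ := arc_eq_arc h2
        rcases h3 with rfl | rfl
        · exact Or.inl ⟨rfl, rfl⟩
        · exact Or.inr ⟨turn_zero, turn_zero⟩

open Classical in
/-- The coordinate of a point with respect to the circle denoted by a symbol. -/
def coord (g : Gen) (x : PantsSpace) : ℂ :=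
  if h : ∃ t, g.loop t = x then turn h.choose else 1

theorem coord_loop (g h : Gen) (t : unitInterval) :
    coord g (h.loop t) = if g = h then turn t else 1 := by
  unfold coord
  split_ifs with h1 h2 h2
  · subst h2
    rcases Gen.loop_eq_loop h1.choose_spec with h3 | h3
    · exact h3.2
    · rw [h3.1, h3.2]
  · rcases Gen.loop_eq_loop h1.choose_spec with h3 | h3
    · exact absurd h3.1 h2
    · exact h3.1
  · subst h2
    exact absurd ⟨t, rfl⟩ h1
  · rfl

theorem coord_base (g : Gen) : coord g base = 1 := by
  rw [← g.loop.source, coord_loop, if_pos rfl, turn_zero]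

theorem norm_coord (g : Gen) (x : PantsSpace) : ‖coord g x‖ = 1 := by
  unfold coord
  split_ifs
  · exact norm_turn _
  · exact norm_one

theorem exists_loop_of_coord_ne {g : Gen} {x : PantsSpace} (h : coord g x ≠ 1) :
    ∃ t, g.loop t = x := by
  by_contra h'
  exact h (dif_neg h')

theorem coord_disj (x : PantsSpace) (g h : Gen) (hgh : g ≠ h) : coord g x = 1 ∨ coord h x = 1 := by
  by_cases h1 : coord g x = 1
  · exact Or.inl h1
  · obtain ⟨t, rfl⟩ := exists_loop_of_coord_ne h1
    rw [coord_loop, coord_loop, if_neg (Ne.symm hgh)]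
    exact Or.inr rfl

theorem mem_bouquet_iff {n : ℕ} {J : Set ℕ+} {x : PantsSpace} :
    x ∈ bouquet n J ↔ x = base ∨ (∃ i : ℕ+, (i : ℕ) < n ∧ ∃ j t, rhoLoop i j t = x) ∨
      ∃ i ∈ J, ∃ t, ellLoop i t = x := by
  simp only [bouquet, Set.mem_union, Set.mem_singleton_iff, Set.mem_iUnion, or_assoc, arcCircle,
    Set.mem_image, Set.mem_range, exists_exists_eq_and, exists_prop, circle, Set.mem_ofPred_eq,
    rhoLoop_apply, ellLoop_apply]
  refine or_congr Iff.rfl (or_congr Iff.rfl (exists_congr fun i => and_congr Iff.rfl ?_))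
  constructor
  · rintro ⟨p, hp, rfl⟩
    obtain ⟨t, rfl⟩ := exists_ell_eq hp
    exact ⟨t, rfl⟩
  · rintro ⟨t, rfl⟩
    exact ⟨_, ell_mem i t, rfl⟩

theorem mem_HPlusFin_iff {n k : ℕ} {x : PantsSpace} :
    x ∈ HPlusFin n k ↔ x = base ∨ ∃ g : Gen, g.Mem n k ∧ ∃ t, g.loop t = x := by
  rw [HPlusFin, mem_bouquet_iff]
  refine or_congr Iff.rfl ⟨?_, ?_⟩
  · rintro (⟨i, hi, j, h⟩ | ⟨i, hi, h⟩)
    · exact ⟨.rho i j, hi, h⟩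
    · exact ⟨.ell i, hi, h⟩
  · rintro ⟨⟨i, j⟩ | i, hg, h⟩
    · exact Or.inl ⟨i, hg, j, h⟩
    · exact Or.inr ⟨i, hg, h⟩

theorem mem_HPlus_iff {n : ℕ} {x : PantsSpace} :
    x ∈ HPlus n ↔ ∃ k, x ∈ HPlusFin n k := by
  simp only [HPlus, HPlusFin, mem_bouquet_iff, exists_or, exists_const]
  refine or_congr Iff.rfl (or_congr Iff.rfl ?_)
  constructor
  · rintro ⟨i, hi, h⟩
    exact ⟨i, i, ⟨hi, le_rfl⟩, h⟩
  · rintro ⟨k, i, hi, h⟩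
    exact ⟨i, hi.1, h⟩

theorem HPlusFin_subset_HPlus (n k : ℕ) : HPlusFin n k ⊆ HPlus n := fun _ hx =>
  mem_HPlus_iff.2 ⟨k, hx⟩

theorem eq_of_coord_eq {n : ℕ} {x y : PantsSpace} (hx : x ∈ HPlus n) (hy : y ∈ HPlus n)
    (h : ∀ g, coord g x = coord g y) : x = y := by
  have key : ∀ {x : PantsSpace}, x ∈ HPlus n → x = base ∨ ∃ g, coord g x ≠ 1 := by
    intro x hx
    obtain ⟨k, hx⟩ := mem_HPlus_iff.1 hx
    rcases mem_HPlusFin_iff.1 hx with rfl | ⟨g, -, t, rfl⟩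
    · exact Or.inl rfl
    · by_cases ht : turn t = 1
      · exact Or.inl (g.loop_eq_base ht)
      · exact Or.inr ⟨g, by rwa [coord_loop, if_pos rfl]⟩
  rcases key hx with rfl | ⟨g, hg⟩
  · rcases key hy with rfl | ⟨g, hg⟩
    · rfl
    · exact absurd ((h g).symm.trans (coord_base g)) hg
  · obtain ⟨s, rfl⟩ := exists_loop_of_coord_ne hg
    rw [h] at hg
    obtain ⟨t, rfl⟩ := exists_loop_of_coord_ne hg
    have hst := h g
    rw [coord_loop, coord_loop, if_pos rfl, if_pos rfl] at hst
    rw [coord_loop, if_pos rfl] at hg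
    rcases eq_of_turn_eq hst with rfl | h1 | h1
    · rfl
    · exact absurd (turn_eq_one_iff.2 (Or.inr h1.2)) hg
    · exact absurd (turn_eq_one_iff.2 (Or.inl h1.2)) hg

theorem coord_ofEarring_rho (i : ℕ+) (j : Fin 2) (p : earring) :
    coord (.rho i j) (ofEarring p) = 1 := by
  obtain ⟨m, hm⟩ := Set.mem_iUnion.1 p.2
  obtain ⟨t, rfl⟩ := exists_ell_eq hm
  exact (coord_loop (.rho i j) (.ell m) t).trans (if_neg nofun)

theorem continuous_coord_ofEarring (g : Gen) : Continuous fun p => coord g (ofEarring p) := by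
  cases g with
  | rho i j => simp only [coord_ofEarring_rho]; exact continuous_const
  | ell i =>
    set A : Set earring := Set.range (ell i) with hA
    -- The rest of the earring: finitely many larger circles, and all smaller ones gathered in one
    -- closed tail. The coordinate is 1 on it.
    set B : Set earring := (⋃ j ∈ {j : ℕ+ | (j : ℕ) < i}, Set.range (ell j)) ∪ tailSet (i + 1)
    have hAc : IsClosed A := (isCompact_range (ell i).continuous).isClosed
    have hfin : {j : ℕ+ | (j : ℕ) < i}.Finite :=
      (Set.finite_Iio (i : ℕ)).preimage PNat.coe_injective.injOn
    have hBc : IsClosed B := (hfin.isClosed_biUnion fun j _ =>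
      (isCompact_range (ell j).continuous).isClosed).union (isClosed_tail _)
    have hcov : A ∪ B = Set.univ := by
      refine Set.eq_univ_of_forall fun p => ?_
      obtain ⟨m, hm⟩ := Set.mem_iUnion.1 p.2
      rcases lt_trichotomy (m : ℕ) i with h | h | h
      · exact Or.inr (Or.inl (Set.mem_biUnion (show m ∈ {j : ℕ+ | (j : ℕ) < i} from h)
          (exists_ell_eq hm)))
      · rw [PNat.coe_inj] at h
        subst h
        exact Or.inl (exists_ell_eq hm)
      · exact Or.inr (Or.inr (mem_tail_of_mem_circ h hm))
    have h1 : ContinuousOn (fun p => coord (.ell i) (ofEarring p)) A := by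
      rw [hA, ← Set.image_univ]
      refine continuousOn_image_of_isClosedMap (ell i).continuous.isClosedMap isClosed_univ
        (continuous_turn.continuousOn.congr fun t _ => ?_)
      exact (coord_loop (.ell i) (.ell i) t).trans (if_pos rfl)
    have h2 : ContinuousOn (fun p => coord (.ell i) (ofEarring p)) B := by
      refine (continuousOn_const (c := 1)).congr fun p hp => ?_
      rcases hp with hp | hp
      · obtain ⟨j, hj, t, rfl⟩ := Set.mem_iUnion₂.1 hp
        refine (coord_loop (.ell i) (.ell j) t).trans (if_neg fun e => ?_)
        cases e
        exact lt_irrefl (i : ℕ) hj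
      · by_contra hne
        obtain ⟨t, ht⟩ := exists_loop_of_coord_ne hne
        have ht' := ofEarring_injective ht
        have := eq_origin_of_mem_tail (Nat.lt_succ_self i) (ht' ▸ ell_mem i t) hp
        subst this
        exact hne (coord_base _)
    rw [← continuousOn_univ, ← hcov]
    exact h1.union_of_isClosed h2 hAc hBc

/-- ℍ⁺_n is covered by finitely many closed pieces, the earring and the arcs of index below n, on
which continuity is known. On all of ℙ the coordinates are not continuous. -/
theorem continuousOn_coord (n : ℕ) (g : Gen) : ContinuousOn (coord g) (HPlus n) := by
  have hfin : {i : ℕ+ | (i : ℕ) < n}.Finite :=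
    (Set.finite_Iio n).preimage PNat.coe_injective.injOn
  have hE : ContinuousOn (coord g) (Set.range ofEarring) := by
    rw [← Set.image_univ]
    exact continuousOn_image_of_isClosedMap isClosedMap_ofEarring isClosed_univ
      (continuous_coord_ofEarring g).continuousOn
  have hclosed : ∀ i j, IsClosedMap (rhoLoop i j) := fun i j =>
    (isClosedMap_ofPants i).comp (arc j).continuous.isClosedMap
  have hR : ∀ i j, ContinuousOn (coord g) (Set.range (rhoLoop i j)) := by
    intro i j
    rw [← Set.image_univ]
    refine continuousOn_image_of_isClosedMap (hclosed i j) isClosed_univ ?_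
    have : coord g ∘ rhoLoop i j = fun t => if g = .rho i j then turn t else 1 :=
      funext fun t => coord_loop g (.rho i j) t
    rw [this]
    split_ifs
    · exact continuous_turn.continuousOn
    · exact continuousOn_const
  have hFin : Finite {i : ℕ+ // (i : ℕ) < n} := hfin.to_subtype
  have hU : ContinuousOn (coord g)
      (⋃ q : {i : ℕ+ // (i : ℕ) < n} × Fin 2, Set.range (rhoLoop q.1 q.2)) :=
    (locallyFinite_of_finite _).continuousOn_iUnion
      (fun q => (hclosed _ _).isClosed_range) fun q => hR _ _
  refine (hE.union_of_isClosed hU isClosedMap_ofEarring.isClosed_range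
    (isClosed_iUnion_of_finite fun q => (hclosed _ _).isClosed_range)).mono fun x hx => ?_
  rcases mem_bouquet_iff.1 hx with rfl | ⟨i, hi, j, t, rfl⟩ | ⟨i, hi, t, rfl⟩
  · exact Or.inl ⟨_, rfl⟩
  · exact Or.inr (Set.mem_iUnion.2 ⟨(⟨i, hi⟩, j), t, rfl⟩)
  · exact Or.inl ⟨_, rfl⟩

end HawaiianPants

end

/-! ### Reduced words, their stabilization, and shape injectivity -/

noncomputable section

namespace HawaiianPants

open Filter Topology

/-! ### Words in the generators -/

instance (n k : ℕ) : Finite (Symb n k) := by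
  have h1 : {i : ℕ+ | (i : ℕ) < n}.Finite :=
    (Set.finite_Iio n).preimage PNat.coe_injective.injOn
  have h2 : {i : ℕ+ | (i : ℕ) ≤ k}.Finite :=
    (Set.finite_Iic k).preimage PNat.coe_injective.injOn
  have h3 : {g : Gen | g.Mem n k}.Finite := by
    refine (((h1.prod (Set.finite_univ (α := Fin 2))).image
      fun q : ℕ+ × Fin 2 => Gen.rho q.1 q.2).union (h2.image Gen.ell)).subset ?_
    rintro (⟨i, j⟩ | i) h
    · exact Or.inl ⟨(i, j), ⟨h, trivial⟩, rfl⟩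
    · exact Or.inr ⟨i, h.2, rfl⟩
  exact h3.to_subtype

instance (n k : ℕ) : Fintype (Symb n k) := Fintype.ofFinite _

instance : Countable Gen := by
  refine Function.Injective.countable (β := (ℕ+ × Fin 2) ⊕ ℕ+)
    (f := fun g => match g with | .rho i j => Sum.inl (i, j) | .ell i => Sum.inr i) ?_
  rintro (⟨i, j⟩ | i) (⟨i', j'⟩ | i') h <;> simp_all

/-- The symbols available at level `(n, k)`. -/
def symbs (n k : ℕ) : Finset Gen := Finset.univ.image (Subtype.val : Symb n k → Gen)

theorem mem_symbs {n k : ℕ} {g : Gen} : g ∈ symbs n k ↔ g.Mem n k := by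
  simp [symbs]

theorem Gen.Mem.mono {n k k' : ℕ} (h : k ≤ k') {g : Gen} (hg : g.Mem n k) : g.Mem n k' := by
  cases g with
  | rho i j => exact hg
  | ell i => exact ⟨hg.1, hg.2.trans h⟩

theorem symbs_mono (n : ℕ) {k k' : ℕ} (h : k ≤ k') : symbs n k ⊆ symbs n k' := fun _ hg =>
  mem_symbs.2 ((mem_symbs.1 hg).mono h)

theorem isBouquetCoord_HPlus (n : ℕ) :
    IsBouquetCoord fun (g : Gen) (x : HPlus n) => coord g (x : PantsSpace) :=
  ⟨fun g => (continuousOn_coord n g).domRestrict, fun g _ => norm_coord g _,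
    fun _ => coord_disj _⟩

theorem isBouquetCoord_HPlusFin (n k : ℕ) :
    IsBouquetCoord fun (g : Symb n k) (x : HPlusFin n k) => coord g.1 (x : PantsSpace) :=
  ⟨fun g => ((continuousOn_coord n g.1).mono (HPlusFin_subset_HPlus n k)).domRestrict,
    fun g _ => norm_coord g.1 _,
    fun _ _ _ h => coord_disj _ _ _ fun e => h (Subtype.ext e)⟩

theorem coord_genLoop {n k : ℕ} (g h : Symb n k) (t : unitInterval) :
    coord h.1 (restrictPath g.1.loop (Gen.loop_mem g) (base_mem_bouquet _ _) (base_mem_bouquet _ _) t :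
      HPlusFin n k) = if h = g then turn t else 1 :=
  (coord_loop h.1 g.1 t).trans (if_congr Subtype.ext_iff.symm rfl rfl)

theorem evalHom_bijective (n k : ℕ) : Function.Bijective (evalHom n k) :=
  bijective_lift_loopClass (isBouquetCoord_HPlusFin n k) (fun y z h => Subtype.ext <|
    eq_of_coord_eq (HPlusFin_subset_HPlus n k y.2) (HPlusFin_subset_HPlus n k z.2) fun g => by
      by_cases hg : g.Mem n k
      · exact h ⟨g, hg⟩
      · have key : ∀ x ∈ HPlusFin n k, coord g x = 1 := by
          intro x hx
          rcases mem_HPlusFin_iff.1 hx with rfl | ⟨h, hh, t, rfl⟩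
          · exact coord_base g
          · rw [coord_loop, if_neg]
            rintro rfl
            exact hg hh
        rw [key _ y.2, key _ z.2])
    (fun g => coord_base g.1) coord_genLoop

/-- The element of the free group that represents `r_{n,k#}(x)`. -/
def redHom (n k : ℕ) : PiOne (HPlus n) (HPlus.base n) →* FreeGroup Gen :=
  (FreeGroup.map Subtype.val).comp
    ((MulEquiv.ofBijective (evalHom n k) (evalHom_bijective n k)).symm.toMonoidHom.comp
      (retrHom n k))

theorem redHom_apply (n k : ℕ) (x : PiOne (HPlus n) (HPlus.base n)) :
    redHom n k x = FreeGroup.map Subtype.val (Function.invFun (evalHom n k) (retrHom n k x)) := by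
  change FreeGroup.map _ ((MulEquiv.ofBijective (evalHom n k) (evalHom_bijective n k)).symm _) = _
  congr 1
  rw [MulEquiv.symm_apply_eq]
  exact (Function.invFun_eq ((evalHom_bijective n k).2 _)).symm

/-- An injective renaming of letters creates no cancellation, so words of all levels can be compared
in the one alphabet `Gen`. -/
theorem toWord_map_of_injective {S T : Type*} [DecidableEq S] [DecidableEq T] {f : S → T}
    (hf : Function.Injective f) (w : FreeGroup S) :
    (FreeGroup.map f w).toWord = w.toWord.map fun l => (f l.1, l.2) := by
  conv_lhs => rw [← FreeGroup.mk_toWord (x := w), FreeGroup.map.mk, FreeGroup.toWord_mk]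
  refine FreeGroup.IsReduced.reduce_eq ?_
  exact (List.isChain_map _).2 ((FreeGroup.isReduced_toWord (x := w)).imp
    fun a b h e => h (hf e))

/-- The letters of a word. -/
def wordLetters {n k : ℕ} (w : Word n k) : List (Gen × Bool) :=
  w.toList.map fun l => (l.1.1, l.2)

theorem wordLetters_injective {n k : ℕ} : Function.Injective (wordLetters (n := n) (k := k)) := by
  intro w w' h
  refine FreeMonoid.toList.injective (List.map_injective_iff.2 ?_ h)
  rintro ⟨a, b⟩ ⟨a', b'⟩ h
  simp only [Prod.mk.injEq] at h
  exact Prod.ext (Subtype.ext h.1) h.2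

theorem wordLetters_gWord (n k : ℕ) (x : PiOne (HPlus n) (HPlus.base n)) :
    wordLetters (gWord n k x) = (redHom n k x).toWord := by
  rw [redHom_apply, toWord_map_of_injective Subtype.val_injective]
  rfl

/-- Restriction of a list of letters to the letters available at level `(n, k)`. -/
def keep (n k : ℕ) (L : List (Gen × Bool)) : List (Gen × Bool) :=
  L.filter fun l => l.1 ∈ symbs n k

theorem wordLetters_deleteLetters {n k n' k' : ℕ} (w : Word n k) :
    wordLetters (deleteLetters n k n' k' w) = keep n' k' (wordLetters w) := by
  induction w using FreeMonoid.inductionOn' with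
  | one => rw [map_one]; rfl
  | of_mul a w ih =>
    have h1 : ∀ {n k : ℕ} (u v : Word n k), wordLetters (u * v) = wordLetters u ++ wordLetters v :=
      fun u v => List.map_append
    rw [map_mul, h1, h1, ih, keep, keep, List.filter_append]
    congr 1
    rw [deleteLetters, FreeMonoid.lift_eval_of]
    by_cases h : a.1.1.Mem n' k'
    · rw [dif_pos h]
      simp [wordLetters, mem_symbs, h]
    · rw [dif_neg h]
      simp [wordLetters, mem_symbs, h]

/-! ### Killing letters -/

theorem IsLift.map {S T : Type*} [DecidableEq T] {A : Finset S} {c : S → unitInterval → ℂ}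
    {c' : T → unitInterval → ℂ} {v : unitInterval → FreeGroup S} (hv : IsLift A c v) {f : S → T}
    (h : ∀ g ∈ A, ∀ t, c' (f g) t = c g t) :
    IsLift (A.image f) c' fun t => FreeGroup.map f (v t) := by
  intro t
  refine ⟨fun h' => ?_, fun g' hg' h' => ?_⟩
  · filter_upwards [(hv t).1 fun g hg => by
      rw [← h g hg]; exact h' _ (Finset.mem_image_of_mem f hg)] with s hs
    rw [hs]
  · obtain ⟨g, hg, rfl⟩ := Finset.mem_image.1 hg'
    rw [h g hg] at h'
    obtain ⟨w, hw⟩ := (hv t).2 g hg h'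
    refine ⟨FreeGroup.map f w, ?_⟩
    filter_upwards [hw] with s hs
    rw [hs, map_mul, h g hg, jump, jump]
    split_ifs <;> simp

section Kill

variable {S : Type*} [DecidableEq S]

/-- The endomorphism of the free group that kills the letters outside `A`. -/
def killHom (A : Finset S) : FreeGroup S →* FreeGroup S :=
  FreeGroup.lift fun g => if g ∈ A then FreeGroup.of g else 1

theorem killHom_mk (A : Finset S) (L : List (S × Bool)) :
    killHom A (FreeGroup.mk L) = FreeGroup.mk (L.filter fun l => l.1 ∈ A) := by
  induction L with
  | nil => rfl
  | cons l L ih =>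
    have h : FreeGroup.mk (l :: L) = FreeGroup.mk [l] * FreeGroup.mk L := rfl
    rw [h, map_mul, ih]
    obtain ⟨g, b⟩ := l
    by_cases hg : g ∈ A
    · rw [List.filter_cons_of_pos (by simpa using hg)]
      cases b
      · simp [killHom, hg, FreeGroup.of]; rfl
      · simp [killHom, hg, FreeGroup.of]
    · rw [List.filter_cons_of_neg (by simpa using hg)]
      cases b <;> simp [killHom, hg]

/-- Killing letters deletes them and then cancels, and each of these operations leaves a sublist. -/
theorem toWord_killHom_sublist (A : Finset S) (w : FreeGroup S) :
    List.Sublist (killHom A w).toWord (w.toWord.filter fun l => l.1 ∈ A) := by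
  conv_lhs => rw [← FreeGroup.mk_toWord (x := w), killHom_mk, FreeGroup.toWord_mk]
  exact FreeGroup.reduce.red.sublist

theorem killHom_jump {A : Finset S} {g : S} (hg : g ∈ A) (z : ℂ) :
    killHom A (jump g z) = jump g z := by
  unfold jump killHom
  split_ifs <;> simp [hg]

/-- Forgetting circles contracts the edges with their labels, so the image of the lift is constant
while the path runs inside a forgotten circle. -/
theorem IsLift.kill {A A' : Finset S} (hA : A ⊆ A') {c : S → unitInterval → ℂ}
    {v : unitInterval → FreeGroup S} (hv : IsLift A' c v) :
    IsLift A c fun t => killHom A (v t) := by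
  intro t
  refine ⟨fun h => ?_, fun g hg h => ?_⟩
  · by_cases h' : ∀ g ∈ A', c g t = 1
    · filter_upwards [(hv t).1 h'] with s hs
      rw [hs]
    · push Not at h'
      obtain ⟨g, hg, h'⟩ := h'
      obtain ⟨w, hw⟩ := (hv t).2 g hg h'
      have hgA : g ∉ A := fun hgA => h' (h g hgA)
      have hk : ∀ z, killHom A (w * jump g z) = killHom A w := by
        intro z
        rw [map_mul, jump]
        split_ifs <;> simp [killHom, hgA]
      filter_upwards [hw] with s hs
      rw [hs, hw.self_of_nhds, hk, hk]
  · obtain ⟨w, hw⟩ := (hv t).2 g (hA hg) h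
    refine ⟨killHom A w, ?_⟩
    filter_upwards [hw] with s hs
    rw [hs, map_mul, killHom_jump hg]

theorem IsLift.superset {A A' : Finset S} {c : S → unitInterval → ℂ}
    {v : unitInterval → FreeGroup S} (hv : IsLift A c v) (hA : A ⊆ A')
    (h : ∀ g ∈ A', g ∉ A → ∀ t, c g t = 1) : IsLift A' c v := by
  intro t
  refine ⟨fun h' => (hv t).1 fun g hg => h' g (hA hg), fun g hg h' => ?_⟩
  by_cases hgA : g ∈ A
  · exact (hv t).2 g hgA h'
  · exact absurd (h g hg hgA t) h'

theorem countP_mem_eq_sum (A : Finset S) (L : List (S × Bool)) :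
    (L.countP fun l => l.1 ∈ A) = ∑ g ∈ A, L.countP fun l => l.1 = g := by
  induction L with
  | nil => simp
  | cons l L ih =>
    simp only [List.countP_cons, Finset.sum_add_distrib, ih]
    congr 1
    simp

end Kill

/-! ### Stabilization -/

theorem coord_retr {n k : ℕ} {g : Gen} (hg : g.Mem n k) (x : HPlus n) :
    coord g (retr n k x : PantsSpace) = coord g (x : PantsSpace) := by
  change coord g (retrFun n k x : PantsSpace) = _
  unfold retrFun
  split_ifs with h
  · rfl
  · refine (coord_base g).trans (Eq.symm ?_)
    by_contra hne
    obtain ⟨t, ht⟩ := exists_loop_of_coord_ne hne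
    exact h (mem_HPlusFin_iff.2 (Or.inr ⟨g, hg, t, ht⟩))

/-- The lift of r_{n,k} ∘ γ, with letters renamed: the retraction does not alter the coordinates of
level (n, k), and the endpoint is computed by `lift_endpoint`. -/
theorem exists_lift_redHom (n k : ℕ) (γ : Path (HPlus.base n) (HPlus.base n)) :
    ∃ v, IsLift (symbs n k) (fun g t => coord g (γ t : PantsSpace)) v ∧ v 0 = 1 ∧
      v 1 = redHom n k (loopClass γ) := by
  set δ : Path (HPlusFin.base n k) (HPlusFin.base n k) :=
    (γ.map (retr n k).continuous).cast (retr_base n k).symm (retr_base n k).symm with hδ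
  obtain ⟨v, hv, h0⟩ := exists_cayley_lift (isBouquetCoord_HPlusFin n k) δ 1
  refine ⟨_, hv.map (c' := fun g t => coord g (γ t : PantsSpace)) (f := Subtype.val)
    fun g _ t => (coord_retr g.2 (γ t)).symm, by simp [h0], ?_⟩
  have h1 := lift_endpoint (isBouquetCoord_HPlusFin n k) coord_genLoop
    (Function.invFun (evalHom n k) (retrHom n k (loopClass γ))) (γ := δ) ?_ hv
  · rw [redHom_apply, h1, h0, one_mul]
  · refine (PiOne.map_loopClass_cast (retr n k) (retr_base n k) γ).symm.trans ?_
    exact (Function.invFun_eq ((evalHom_bijective n k).2 _)).symm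

/-- Both sides are endpoints of lifts of the same loop over the circles of level (n, k), and lifts
are unique. -/
theorem redHom_eq_kill (n : ℕ) {k k' : ℕ} (h : k ≤ k') (x : PiOne (HPlus n) (HPlus.base n)) :
    redHom n k x = killHom (symbs n k) (redHom n k' x) := by
  obtain ⟨γ, rfl⟩ := exists_loopClass x
  obtain ⟨v, hv, h0, h1⟩ := exists_lift_redHom n k γ
  obtain ⟨v', hv', h0', h1'⟩ := exists_lift_redHom n k' γ
  rw [← h1, ← h1']
  exact hv.unique (hv'.kill (symbs_mono n h)) (s := 0) (by rw [h0, h0', map_one]) 1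

/-- Passing from k' down to k can only lose letters. Since m ≤ k no letter of level (n, m) is
killed; some may cancel. -/
theorem keep_toWord_sublist (n : ℕ) {m k k' : ℕ} (hm : m ≤ k) (h : k ≤ k')
    (x : PiOne (HPlus n) (HPlus.base n)) :
    List.Sublist (keep n m (redHom n k x).toWord) (keep n m (redHom n k' x).toWord) := by
  have h1 := toWord_killHom_sublist (symbs n k) (redHom n k' x)
  rw [← redHom_eq_kill n h] at h1
  have h2 := h1.filter fun l => decide (l.1 ∈ symbs n m)
  have e : (((redHom n k' x).toWord.filter fun l => l.1 ∈ symbs n k).filter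
      fun l => l.1 ∈ symbs n m) = keep n m (redHom n k' x).toWord := by
    rw [List.filter_filter]
    refine List.filter_congr fun l _ => ?_
    by_cases hl : l.1 ∈ symbs n m
    · simp [hl, symbs_mono n hm hl]
    · simp [hl]
  rw [e] at h2
  exact h2

/-- The length is a sum of letter counts, each bounded in terms of the loop alone. -/
theorem exists_keep_length_le (n m : ℕ) (x : PiOne (HPlus n) (HPlus.base n)) :
    ∃ B, ∀ k, (keep n m (redHom n k x).toWord).length ≤ B := by
  obtain ⟨γ, rfl⟩ := exists_loopClass x
  choose N hN using ((isBouquetCoord_HPlus n).isCoord γ).exists_bound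
  refine ⟨∑ g ∈ symbs n m, N g, fun k => ?_⟩
  obtain ⟨v, hv, h0, h1⟩ := exists_lift_redHom n k γ
  have : (keep n m (redHom n k (loopClass γ)).toWord).length
      = ∑ g ∈ symbs n m, letterCount g (redHom n k (loopClass γ)) := by
    rw [keep, ← List.countP_eq_length_filter, countP_mem_eq_sum]
    rfl
  rw [this]
  refine Finset.sum_le_sum fun g _ => ?_
  have := hN g _ v hv 0 1
  rwa [h0, h1, inv_one, one_mul] at this

/-- A chain of sublists of bounded length is constant from a member of maximal length on. -/
theorem exists_keep_eq (n m : ℕ) (x : PiOne (HPlus n) (HPlus.base n)) :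
    ∃ L, ∀ᶠ k in atTop, keep n m (redHom n k x).toWord = L := by
  obtain ⟨B, hB⟩ := exists_keep_length_le n m x
  set s : Set ℕ := {l | ∃ k, m ≤ k ∧ (keep n m (redHom n k x).toWord).length = l} with hs
  have hbdd : BddAbove s := ⟨B, by rintro _ ⟨k, -, rfl⟩; exact hB k⟩
  obtain ⟨k₀, hk₀, hmax⟩ := Nat.sSup_mem (s := s) ⟨_, m, le_rfl, rfl⟩ hbdd
  refine ⟨keep n m (redHom n k₀ x).toWord, ?_⟩
  filter_upwards [eventually_ge_atTop k₀] with k hk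
  refine ((keep_toWord_sublist n hk₀ hk x).eq_of_length_le ?_).symm
  rw [hmax]
  exact le_csSup hbdd ⟨k, hk₀.trans hk, rfl⟩

theorem eventually_eq_omega (n m : ℕ) (x : PiOne (HPlus n) (HPlus.base n)) :
    ∀ᶠ k in atTop, deleteLetters n k n m (gWord n k x) = omega n m x := by
  have hex : ∃ w, ∀ᶠ k in atTop, deleteLetters n k n m (gWord n k x) = w := by
    obtain ⟨L, hL⟩ := exists_keep_eq n m x
    obtain ⟨K, hK⟩ := eventually_atTop.1 hL
    refine ⟨deleteLetters n K n m (gWord n K x), ?_⟩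
    filter_upwards [hL] with k hk
    apply wordLetters_injective
    rw [wordLetters_deleteLetters, wordLetters_deleteLetters, wordLetters_gWord, wordLetters_gWord,
      hk, hK K le_rfl]
  exact Classical.epsilon_spec hex

/-- The letters of the stabilized word. -/
theorem eventually_keep_eq (n m : ℕ) (x : PiOne (HPlus n) (HPlus.base n)) :
    ∀ᶠ k in atTop, keep n m (redHom n k x).toWord = wordLetters (omega n m x) := by
  filter_upwards [eventually_eq_omega n m x] with k hk
  rw [← hk, wordLetters_deleteLetters, wordLetters_gWord]

/-! ### Shape injectivity -/

theorem coord_eq_one_of_not_mem {n : ℕ} {g : Gen} (hg : ∀ k, ¬ g.Mem n k) (x : HPlus n) :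
    coord g (x : PantsSpace) = 1 := by
  obtain ⟨k, hk⟩ := mem_HPlus_iff.1 x.2
  rcases mem_HPlusFin_iff.1 hk with h | ⟨h, hh, t, ht⟩
  · rw [h]; exact coord_base g
  · rw [← ht, coord_loop, if_neg]
    rintro rfl
    exact hg k hh

/-- The fundamental group of `ℍ⁺_n` embeds into the inverse limit of the groups of its finite
subbouquets. -/
theorem eq_one_of_redHom (n : ℕ) (x : PiOne (HPlus n) (HPlus.base n))
    (h : ∃ᶠ k in atTop, redHom n k x = 1) : x = 1 := by
  obtain ⟨γ, rfl⟩ := exists_loopClass x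
  rw [← loopClass_refl, loopClass_eq_iff]
  refine nullhomotopic_of_lifts γ ((isBouquetCoord_HPlus n).isCoord γ) (fun g => ?_) (fun g => ?_)
    (fun s t h => Subtype.ext (eq_of_coord_eq (γ s).2 (γ t).2 h)) ?_
  · rw [γ.source]; exact coord_base g
  · rw [γ.target]; exact coord_base g
  · refine frequently_atTop.2 fun A => ?_
    -- Beyond level `K`, every letter of `A` that occurs at some level of ℍ⁺_n is available.
    have hK : ∃ K : ℕ, ∀ g ∈ A, ∀ k, g.Mem n k → ∀ k' ≥ K, g.Mem n k' := by
      have : ∀ g : Gen, ∃ K : ℕ, ∀ k, g.Mem n k → ∀ k' ≥ K, g.Mem n k' := by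
        rintro (⟨i, j⟩ | i)
        · exact ⟨0, fun k hk _ _ => hk⟩
        · exact ⟨i, fun k hk k' hk' => ⟨hk.1, hk'⟩⟩
      choose K hK using this
      exact ⟨A.sup K, fun g hg k hk k' hk' => hK g k hk k' ((Finset.le_sup hg).trans hk')⟩
    obtain ⟨K, hK⟩ := hK
    obtain ⟨k, hk, hx⟩ := frequently_atTop.1 h K
    obtain ⟨v, hv, h0, h1⟩ := exists_lift_redHom n k γ
    -- The remaining letters of `A` denote circles outside ℍ⁺_n, so adding them leaves the lift
    -- unchanged.
    refine ⟨A ∪ symbs n k, Finset.subset_union_left, v,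
      hv.superset Finset.subset_union_right fun g hg hg' t => ?_, h0, h1.trans hx⟩
    refine coord_eq_one_of_not_mem (fun k' hk' => hg' (mem_symbs.2 ?_)) _
    rcases Finset.mem_union.1 hg with hg | hg
    · exact hK g hg k' hk' k hk
    · exact mem_symbs.1 hg

end HawaiianPants

end

/-! ### Deforming loops and homotopies of ℙ into ℍ⁺_n -/

noncomputable section

namespace HawaiianPants

open Filter Topology

/-! ### The retraction of the pair of pants onto its arcs and legs -/

/-- By symmetry in the real line only the removed disk on the side of `z` matters, the other centre
being at least as far away. -/
theorem mem_pants_iff {z : ℂ} :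
    z ∈ pants ↔ z.re ^ 2 + z.im ^ 2 ≤ 16 ∧ 1 ≤ z.re ^ 2 + (|z.im| - 2) ^ 2 := by
  have h1 : ‖z‖ ≤ 4 ↔ z.re ^ 2 + z.im ^ 2 ≤ 16 := by
    rw [← sq_le_sq₀ (norm_nonneg _) (by norm_num), ← Complex.normSq_eq_norm_sq,
      Complex.normSq_apply, ← sq, ← sq]
    norm_num
  have h2 : ∀ w : ℂ, 1 ≤ ‖z - w‖ ↔ 1 ≤ (z.re - w.re) ^ 2 + (z.im - w.im) ^ 2 := by
    intro w
    rw [← sq_le_sq₀ zero_le_one (norm_nonneg _), ← Complex.normSq_eq_norm_sq,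
      Complex.normSq_apply, ← sq, ← sq, Complex.sub_re, Complex.sub_im]
    norm_num
  change (‖z‖ ≤ 4 ∧ ∀ j, 1 ≤ ‖z - legCenter j‖) ↔ _
  rw [h1, Fin.forall_fin_two, h2, h2]
  refine and_congr Iff.rfl ?_
  simp only [legCenter, if_true, one_ne_zero, if_false, Complex.mul_re, Complex.mul_im,
    Complex.neg_re, Complex.neg_im, Complex.re_ofNat, Complex.im_ofNat, Complex.I_re, Complex.I_im]
  norm_num
  rcases abs_cases z.im with ⟨h, h'⟩ | ⟨h, h'⟩ <;> rw [h]
  · exact ⟨fun h => h.1, fun h => ⟨h, by nlinarith⟩⟩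
  · exact ⟨fun h => by nlinarith [h.2], fun h => ⟨by nlinarith, by nlinarith⟩⟩

/-- The abscissa of the retract of a point. -/
def foldX (z : ℂ) : ℝ := min (min z.re 1) (5 * |z.im| - 4)

/-- The centre of the interval that is removed from the vertical half line with abscissa `X`. -/
def foldM (X : ℝ) : ℝ := min (2 * (X + 4) / 3) 2

/-- Projection of the vertical half line with abscissa `X` to the boundary of the removed
interval. -/
def foldR (X r : ℝ) : ℝ := max (foldM X - √(1 - X ^ 2)) (min (foldM X + √(1 - X ^ 2)) r)

theorem continuous_foldX : Continuous foldX := by unfold foldX; fun_prop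

theorem continuous_foldR : Continuous fun q : ℝ × ℝ => foldR q.1 q.2 := by
  unfold foldR foldM; fun_prop

theorem foldR_of_le {X : ℝ} (h : X ≤ -1) (r : ℝ) : foldR X r = 2 * (X + 4) / 3 := by
  -- The root of a negative number is 0 by convention, so to the left of the disk the removed
  -- interval shrinks to a point of the arc.
  have h1 : √(1 - X ^ 2) = 0 := Real.sqrt_eq_zero_of_nonpos (by nlinarith)
  have h2 : foldM X = 2 * (X + 4) / 3 := min_eq_left (by linarith)
  rw [foldR, h1, h2, sub_zero, add_zero]
  exact max_eq_left (min_le_left _ _)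

theorem foldM_of_ge {X : ℝ} (h : -1 ≤ X) : foldM X = 2 := min_eq_right (by linarith)

theorem foldR_cases {X r : ℝ} (h : -1 ≤ X) (h' : X ≤ 1) (hr : 1 ≤ X ^ 2 + (r - 2) ^ 2) :
    (2 + √(1 - X ^ 2) ≤ r ∧ foldR X r = 2 + √(1 - X ^ 2)) ∨
      (r ≤ 2 - √(1 - X ^ 2) ∧ foldR X r = 2 - √(1 - X ^ 2)) := by
  have hs : √(1 - X ^ 2) ^ 2 = 1 - X ^ 2 := Real.sq_sqrt (by nlinarith)
  have hs0 := Real.sqrt_nonneg (1 - X ^ 2)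
  set s := √(1 - X ^ 2)
  have h3 : 0 ≤ (r - 2 - s) * (r - 2 + s) := by nlinarith
  rw [foldR, foldM_of_ge h]
  rcases le_or_gt (2 + s) r with h4 | h4
  · exact Or.inl ⟨h4, by rw [min_eq_left h4, max_eq_right (by linarith)]⟩
  · right
    have h5 : r ≤ 2 - s := by
      by_contra h5
      push Not at h5
      nlinarith
    exact ⟨h5, by rw [min_eq_right (by linarith), max_eq_left h5]⟩

theorem foldR_leg {X r : ℝ} (h : -1 ≤ X) (h' : X ≤ 1) (hr : 1 ≤ X ^ 2 + (r - 2) ^ 2) :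
    X ^ 2 + (foldR X r - 2) ^ 2 = 1 := by
  have hs : √(1 - X ^ 2) ^ 2 = 1 - X ^ 2 := Real.sq_sqrt (by nlinarith)
  rcases foldR_cases h h' hr with ⟨-, h1⟩ | ⟨-, h1⟩ <;> rw [h1] <;> nlinarith

theorem foldX_le_one (z : ℂ) : foldX z ≤ 1 := (min_le_left _ _).trans (min_le_right _ _)

theorem foldX_le_re (z : ℂ) : foldX z ≤ z.re := (min_le_left _ _).trans (min_le_left _ _)

theorem foldX_le_im (z : ℂ) : foldX z ≤ 5 * |z.im| - 4 := min_le_right _ _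

theorem le_foldX {z : ℂ} (hz : z ∈ pants) : -4 ≤ foldX z := by
  have h1 := (mem_pants_iff.1 hz).1
  refine le_min (le_min ?_ (by norm_num)) (by linarith [abs_nonneg z.im])
  nlinarith [sq_nonneg z.im]

theorem foldX_sq_add {z : ℂ} (hz : z ∈ pants) : foldX z ^ 2 + |z.im| ^ 2 ≤ 16 := by
  obtain ⟨h1, h2⟩ := mem_pants_iff.1 hz
  rw [← sq_abs z.im] at h1
  have hr := abs_nonneg z.im
  set r := |z.im| with hr'
  have key : foldX z = z.re ∨ (foldX z = 1 ∧ 1 ≤ z.re) ∨ (foldX z = 5 * r - 4 ∧ 5 * r - 4 ≤ 1) := by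
    unfold foldX
    rcases min_cases (min z.re 1) (5 * r - 4) with ⟨h, h'⟩ | ⟨h, h'⟩ <;>
      rcases min_cases z.re 1 with ⟨h3, h3'⟩ | ⟨h3, h3'⟩
    · left; linarith
    · right; left; constructor <;> linarith
    · right; right; constructor <;> linarith
    · right; right; constructor <;> linarith
  rcases key with h | ⟨h, h'⟩ | ⟨h, h'⟩ <;> rw [h]
  · exact h1
  · nlinarith
  · nlinarith

/-- The line 5r - 4 takes the value -4 at r = 0, so the real line is folded to the point a, and the
value 1 at r = 1, the least height of the removed disk. At greater heights only the cut-off at 1 is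
active. -/
theorem foldX_eq_re_or {z : ℂ} (h : 1 ≤ |z.im|) : foldX z = min z.re 1 :=
  min_eq_left ((min_le_right _ _).trans (by linarith))

/-- The horizontal segment avoids the disk: it either has height at most 1, or does not move, or
stays at abscissas at least 1. -/
theorem one_le_foldX_sq_add {z : ℂ} (hz : z ∈ pants) {x : ℝ} (h1 : foldX z ≤ x) (h2 : x ≤ z.re) :
    1 ≤ x ^ 2 + (|z.im| - 2) ^ 2 := by
  obtain ⟨-, h3⟩ := mem_pants_iff.1 hz
  rcases le_or_gt |z.im| 1 with h | h
  · nlinarith [sq_nonneg x]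
  · rw [foldX_eq_re_or h.le] at h1
    rcases min_cases z.re 1 with ⟨h4, h4'⟩ | ⟨h4, h4'⟩ <;> rw [h4] at h1
    · rwa [le_antisymm h2 h1]
    · nlinarith [sq_nonneg (|z.im| - 2)]

/-- The point with abscissa `x` and with an ordinate of absolute value `r`, on the same side of the
real line as `z`. -/
def unfoldPt (z : ℂ) (x r : ℝ) : ℂ := ⟨x, if 0 ≤ z.im then r else -r⟩

theorem unfoldPt_self (z : ℂ) : unfoldPt z z.re |z.im| = z := by
  apply Complex.ext
  · rfl
  · change (if 0 ≤ z.im then |z.im| else -|z.im|) = z.im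
    split_ifs with h
    · exact abs_of_nonneg h
    · rw [abs_of_neg (not_le.1 h), neg_neg]

theorem abs_unfoldPt_im (z : ℂ) (x : ℝ) {r : ℝ} (hr : 0 ≤ r) : |(unfoldPt z x r).im| = r := by
  change |if 0 ≤ z.im then r else -r| = r
  split_ifs
  · exact abs_of_nonneg hr
  · rw [abs_neg, abs_of_nonneg hr]

theorem unfoldPt_mem {z : ℂ} {x r : ℝ} (hr : 0 ≤ r) (h1 : x ^ 2 + r ^ 2 ≤ 16)
    (h2 : 1 ≤ x ^ 2 + (r - 2) ^ 2) : unfoldPt z x r ∈ pants := by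
  rw [mem_pants_iff, ← sq_abs (unfoldPt z x r).im, abs_unfoldPt_im z x hr]
  exact ⟨h1, h2⟩

/-- The sign flips across the real line, so the ordinate has to vanish there. -/
theorem continuous_unfoldPt {Y : Type*} [TopologicalSpace Y] {z : Y → ℂ} {x r : Y → ℝ}
    (hz : Continuous z) (hx : Continuous x) (hr : Continuous r) (h : ∀ y, (z y).im = 0 → r y = 0) :
    Continuous fun y => unfoldPt (z y) (x y) (r y) := by
  have h1 : Continuous fun y => if 0 ≤ (z y).im then r y else -r y :=
    Continuous.if_le hr hr.neg continuous_const (Complex.continuous_im.comp hz)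
      fun y hy => by rw [h y hy.symm, neg_zero]
  have : (fun y => unfoldPt (z y) (x y) (r y))
      = fun y => (x y : ℂ) + (if 0 ≤ (z y).im then r y else -r y : ℝ) * Complex.I := by
    funext y
    apply Complex.ext <;> simp [unfoldPt]
  rw [this]
  fun_prop

theorem foldR_bounds {z : ℂ} (hz : z ∈ pants) : 0 ≤ foldR (foldX z) |z.im| ∧
    foldX z ^ 2 + foldR (foldX z) |z.im| ^ 2 ≤ 16 := by
  have h1 := le_foldX hz
  have h2 := foldX_le_one z
  have h3 := one_le_foldX_sq_add hz le_rfl (foldX_le_re z)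
  rcases le_or_gt (foldX z) (-1) with h | h
  · rw [foldR_of_le h]
    constructor
    · linarith
    · nlinarith
  · have h4 := foldR_leg h.le h2 h3
    constructor
    · nlinarith [sq_nonneg (foldX z)]
    · nlinarith [sq_nonneg (foldX z)]

/-- A point above the disk is projected to its upper half circle and a point below to its lower one,
so the vertical segment does not enter the disk. -/
theorem foldR_between {z : ℂ} (hz : z ∈ pants) {t : ℝ} (h1 : t ≤ 1) :
    1 ≤ foldX z ^ 2 + ((1 - t) * |z.im| + t * foldR (foldX z) |z.im| - 2) ^ 2 := by
  have h2 := foldX_le_one z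
  have h3 := one_le_foldX_sq_add hz le_rfl (foldX_le_re z)
  rcases le_or_gt (foldX z) (-1) with h | h
  · nlinarith [sq_nonneg ((1 - t) * |z.im| + t * foldR (foldX z) |z.im| - 2)]
  · have hs : √(1 - foldX z ^ 2) ^ 2 = 1 - foldX z ^ 2 := Real.sq_sqrt (by nlinarith)
    have hs0 := Real.sqrt_nonneg (1 - foldX z ^ 2)
    set s := √(1 - foldX z ^ 2) with hs'
    rcases foldR_cases h.le h2 h3 with ⟨h4, h5⟩ | ⟨h4, h5⟩ <;> rw [h5]
    · have : s ≤ (1 - t) * |z.im| + t * (2 + s) - 2 := by nlinarith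
      nlinarith
    · have : s ≤ 2 - ((1 - t) * |z.im| + t * (2 - s)) := by nlinarith
      nlinarith

/-- On the real line the abscissa is folded to -4, where the arcs start at height 0; this glues the
two sides continuously. -/
theorem foldR_eq_zero {z : ℂ} (hz : z ∈ pants) (h : z.im = 0) : foldR (foldX z) |z.im| = 0 := by
  have h1 := foldX_le_im z
  have h2 := le_foldX hz
  rw [h, abs_zero] at h1
  have h3 : foldX z = -4 := by linarith
  rw [h3, foldR_of_le (by norm_num)]
  norm_num

/-- The union of the arcs and of the legs. -/
def arcsLegs : Set pants := (⋃ j, Set.range (arc j)) ∪ ⋃ j, Set.range (leg j)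

theorem fold_of_mem_arcsLegs {z : pants} (hz : z ∈ arcsLegs) :
    foldX z = (z : ℂ).re ∧ foldR (z : ℂ).re |(z : ℂ).im| = |(z : ℂ).im| := by
  rcases hz with hz | hz
  · obtain ⟨j, s, rfl⟩ := Set.mem_iUnion.1 hz
    have h0 := s.2.1
    have h1 := s.2.2
    have e : |(arc j s : ℂ).im| = 2 * s := by
      rw [arc_im]
      split_ifs
      · exact abs_of_nonneg (by linarith)
      · rw [abs_neg]; exact abs_of_nonneg (by linarith)
    rw [foldX, e, arc_re, foldR_of_le (by linarith)]
    constructor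
    · rw [min_eq_left (by linarith : (-4 : ℝ) + 3 * s ≤ 1), min_eq_left (by linarith)]
    · ring
  · obtain ⟨j, t, rfl⟩ := Set.mem_iUnion.1 hz
    have hu := unit_eq (norm_turn t)
    have hre : (leg j t : ℂ).re = -(turn t).re := by
      change (legCenter j - turn t).re = _
      rw [Complex.sub_re, legCenter_re, zero_sub]
    have him : |(leg j t : ℂ).im| - 2 = if j = 0 then -(turn t).im else (turn t).im := by
      change |(legCenter j - turn t).im| - 2 = _
      have hb : -1 ≤ (turn t).im ∧ (turn t).im ≤ 1 := by
        constructor <;> nlinarith [sq_nonneg (turn t).re]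
      unfold legCenter
      split_ifs <;> simp
      · rw [abs_of_nonneg (by linarith)]; ring
      · rw [abs_of_nonpos (by linarith)]; ring
    have hsq : (leg j t : ℂ).re ^ 2 + (|(leg j t : ℂ).im| - 2) ^ 2 = 1 := by
      rw [hre, him]
      split_ifs <;> nlinarith
    set x := (leg j t : ℂ).re
    set r := |(leg j t : ℂ).im|
    have hx : -1 ≤ x ∧ x ≤ 1 := by constructor <;> nlinarith [sq_nonneg (r - 2)]
    have hr : 1 ≤ r := by nlinarith [sq_nonneg x]
    refine ⟨?_, ?_⟩
    · rw [foldX_eq_re_or hr]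
      exact min_eq_left hx.2
    · have hs : √(1 - x ^ 2) ^ 2 = 1 - x ^ 2 := Real.sq_sqrt (by nlinarith)
      have hs0 := Real.sqrt_nonneg (1 - x ^ 2)
      rcases foldR_cases hx.1 hx.2 hsq.ge with ⟨h4, h5⟩ | ⟨h4, h5⟩ <;> rw [h5] <;> nlinarith

/-- The horizontal part of the retraction. -/
def pantsShift : C(pants, pants) where
  toFun z := ⟨unfoldPt z (foldX z) |(z : ℂ).im|, unfoldPt_mem (abs_nonneg _) (foldX_sq_add z.2)
    (one_le_foldX_sq_add z.2 le_rfl (foldX_le_re _))⟩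
  continuous_toFun := Continuous.subtype_mk (continuous_unfoldPt continuous_subtype_val
    (continuous_foldX.comp continuous_subtype_val) (by fun_prop) fun z h => by rw [h, abs_zero]) _

/-- The retraction of the pair of pants onto the union of its arcs and legs. -/
def pantsRetr : C(pants, pants) where
  toFun z := ⟨unfoldPt z (foldX z) (foldR (foldX z) |(z : ℂ).im|), unfoldPt_mem (foldR_bounds z.2).1
    (foldR_bounds z.2).2 (by have := foldR_between z.2 le_rfl; simpa using this)⟩
  continuous_toFun := Continuous.subtype_mk (continuous_unfoldPt continuous_subtype_val
    (continuous_foldX.comp continuous_subtype_val)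
    (continuous_foldR.comp ((continuous_foldX.comp continuous_subtype_val).prodMk (by fun_prop)))
    fun z h => foldR_eq_zero z.2 h) _

theorem unfoldPt_eq_self {z : pants} {x r : ℝ} (hx : x = (z : ℂ).re)
    (hr : r = |(z : ℂ).im|) {h : unfoldPt z x r ∈ pants} : (⟨unfoldPt z x r, h⟩ : pants) = z := by
  subst hx hr
  exact Subtype.ext (unfoldPt_self _)

theorem shift_mem (t : unitInterval) (z : pants) :
    unfoldPt z ((1 - t) * (z : ℂ).re + t * foldX z) |(z : ℂ).im| ∈ pants := by
  obtain ⟨t, h0, h1⟩ := t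
  have h2 := foldX_le_re z
  have h3 := foldX_sq_add z.2
  have h4 := (mem_pants_iff.1 z.2).1
  rw [← sq_abs (z : ℂ).im] at h4
  refine unfoldPt_mem (abs_nonneg _) ?_ (one_le_foldX_sq_add z.2 ?_ ?_)
  · change ((1 - t) * (z : ℂ).re + t * foldX z) ^ 2 + _ ≤ _
    nlinarith [mul_nonneg (mul_nonneg h0 (sub_nonneg.2 h1)) (sq_nonneg ((z : ℂ).re - foldX z))]
  · change _ ≤ (1 - t) * (z : ℂ).re + t * foldX z
    nlinarith
  · change (1 - t) * (z : ℂ).re + t * foldX z ≤ _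
    nlinarith

/-- The straight line homotopy from the identity to the horizontal part of the retraction. -/
def pantsHomotopyShift : (ContinuousMap.id pants).HomotopyRel pantsShift arcsLegs where
  toFun q := ⟨unfoldPt q.2 ((1 - q.1) * (q.2 : ℂ).re + q.1 * foldX q.2) |(q.2 : ℂ).im|,
    shift_mem q.1 q.2⟩
  continuous_toFun := Continuous.subtype_mk (continuous_unfoldPt (by fun_prop) (by
      have := continuous_foldX
      fun_prop) (by fun_prop) fun z h => by rw [h, abs_zero]) _
  map_zero_left z := Subtype.ext (by simp [unfoldPt_self])
  map_one_left z := Subtype.ext (by simp [pantsShift])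
  prop' _ _ hz := unfoldPt_eq_self (by rw [(fold_of_mem_arcsLegs hz).1]; ring) rfl

theorem retr_mem (t : unitInterval) (z : pants) :
    unfoldPt z (foldX z) ((1 - t) * |(z : ℂ).im| + t * foldR (foldX z) |(z : ℂ).im|) ∈ pants := by
  obtain ⟨t, h0, h1⟩ := t
  have h2 := abs_nonneg (z : ℂ).im
  have h3 := foldX_sq_add z.2
  obtain ⟨h4, h5⟩ := foldR_bounds z.2
  refine unfoldPt_mem ?_ ?_ (foldR_between z.2 h1)
  · have := sub_nonneg.2 h1
    positivity
  · change _ + ((1 - t) * |(z : ℂ).im| + t * foldR (foldX z) |(z : ℂ).im|) ^ 2 ≤ _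
    nlinarith [mul_nonneg (mul_nonneg h0 (sub_nonneg.2 h1))
      (sq_nonneg (|(z : ℂ).im| - foldR (foldX z) |(z : ℂ).im|))]

/-- The straight line homotopy for the vertical part of the retraction. -/
def pantsHomotopyRetr : pantsShift.HomotopyRel pantsRetr arcsLegs where
  toFun q := ⟨unfoldPt q.2 (foldX q.2) ((1 - q.1) * |(q.2 : ℂ).im| +
      q.1 * foldR (foldX q.2) |(q.2 : ℂ).im|), retr_mem q.1 q.2⟩
  continuous_toFun := Continuous.subtype_mk (continuous_unfoldPt (by fun_prop) (by
      have := continuous_foldX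
      fun_prop) (by
      have := continuous_foldX
      have h : Continuous fun q : unitInterval × pants => foldR (foldX q.2) |(q.2 : ℂ).im| :=
        continuous_foldR.comp ((continuous_foldX.comp (by fun_prop)).prodMk (by fun_prop))
      fun_prop) fun q h => by rw [foldR_eq_zero q.2.2 h, h, abs_zero]; ring) _
  map_zero_left z := Subtype.ext (by simp [pantsShift])
  map_one_left z := Subtype.ext (by simp [pantsRetr]; rfl)
  prop' t z hz := by
    obtain ⟨h1, h2⟩ := fold_of_mem_arcsLegs hz
    refine (unfoldPt_eq_self h1 ?_).trans
      (unfoldPt_eq_self h1 rfl).symm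
    rw [h1, h2]; ring

/-- The retraction is homotopic to the identity. -/
def pantsHomotopy : (ContinuousMap.id pants).HomotopyRel pantsRetr arcsLegs :=
  pantsHomotopyShift.trans pantsHomotopyRetr

theorem pantsHomotopy_of_mem {z : pants} (hz : z ∈ arcsLegs) (t : unitInterval) :
    pantsHomotopy (t, z) = z := pantsHomotopy.eq_fst t hz

/-- The side on which a point lies. -/
def sideOf (z : ℂ) : Fin 2 := if 0 ≤ z.im then 0 else 1

theorem pantsRetr_eq_arc {z : pants} (h : foldX z ≤ -1) {s : unitInterval}
    (hs : (s : ℝ) = (foldX z + 4) / 3) : pantsRetr z = arc (sideOf z) s := by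
  apply Subtype.ext
  apply Complex.ext
  · rw [arc_re, hs]
    change foldX z = _
    ring
  · rw [arc_im, hs]
    change (if 0 ≤ (z : ℂ).im then foldR (foldX z) |(z : ℂ).im|
      else -foldR (foldX z) |(z : ℂ).im|) = _
    rw [foldR_of_le h, sideOf]
    split_ifs
    · ring
    · simp_all
    · simp_all
    · ring

/-- The position on a leg of the retract of a point. -/
def legCoord (z : ℂ) : ℂ :=
  ⟨-foldX z, if 0 ≤ z.im then 2 - foldR (foldX z) |z.im| else foldR (foldX z) |z.im| - 2⟩

theorem norm_legCoord {z : pants} (h : -1 ≤ foldX z) : ‖legCoord z‖ = 1 := by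
  have h3 := foldR_leg h (foldX_le_one z) (one_le_foldX_sq_add z.2 le_rfl (foldX_le_re z))
  rw [← sq_eq_sq₀ (norm_nonneg _) zero_le_one, ← Complex.normSq_eq_norm_sq, Complex.normSq_apply]
  simp only [legCoord]
  split_ifs <;> nlinarith

theorem pantsRetr_eq_leg {z : pants} {t : unitInterval} (ht : turn t = legCoord z) :
    pantsRetr z = leg (sideOf z) t := by
  apply Subtype.ext
  change unfoldPt _ _ _ = legCenter _ - turn t
  rw [ht]
  apply Complex.ext
  · rw [Complex.sub_re, legCenter_re]
    simp [unfoldPt, legCoord]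
  · rw [Complex.sub_im]
    simp only [unfoldPt, legCoord, legCenter, sideOf]
    split_ifs <;> simp_all
    ring

theorem pantsRetr_mem (z : pants) : pantsRetr z ∈ arcsLegs := by
  rcases le_total (foldX z) (-1) with h | h
  · have h1 := le_foldX z.2
    rw [pantsRetr_eq_arc h (s := ⟨(foldX z + 4) / 3, by constructor <;> linarith⟩) rfl]
    exact Or.inl (Set.mem_iUnion.2 ⟨_, _, rfl⟩)
  · obtain ⟨t, ht⟩ := turn_surjective (norm_legCoord h)
    rw [pantsRetr_eq_leg ht]
    exact Or.inr (Set.mem_iUnion.2 ⟨_, _, rfl⟩)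

end HawaiianPants

end

noncomputable section

namespace HawaiianPants

open Filter Topology

/-! ### Collapsing a pair of pants -/

instance : T1Space PantsSpace where
  t1 x := by
    obtain ⟨p | ⟨m, z⟩, rfl⟩ := Quot.exists_rep x
    · have := isClosedMap_ofEarring _ (isClosed_singleton (x := p))
      rwa [Set.image_singleton] at this
    · have := isClosedMap_ofPants m _ (isClosed_singleton (x := z))
      rwa [Set.image_singleton] at this

theorem isClosed_HPlus (n : ℕ) : IsClosed (HPlus n) := by
  have : HPlus n = unionArcs n (tailSet n) := by
    rw [HPlus, bouquet_eq_union]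
    congr 1
    ext p
    constructor
    · rintro (rfl | ⟨i, hi, hp⟩)
      · exact origin_mem_tail n
      · exact mem_tail_of_mem_circ hi hp
    · intro hp
      obtain ⟨i, hi⟩ := Set.mem_iUnion.1 p.2
      rcases lt_or_ge (i : ℕ) n with h | h
      · exact Or.inl (eq_origin_of_mem_tail h hi hp)
      · exact Or.inr ⟨i, h, hi⟩
  rw [this]
  exact isClosed_union _ _ (origin_mem_tail n) (isClosed_tail n)

theorem isCompact_pants : IsCompact pants := by
  refine Metric.isCompact_of_isClosed_isBounded ?_
    ((Metric.isBounded_closedBall (x := (0 : ℂ)) (r := 4)).subset fun z hz => by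
      simpa using hz.1)
  have : pants = {z | ‖z‖ ≤ 4} ∩ ⋂ j, {z | 1 ≤ ‖z - legCenter j‖} := by
    ext z; simp [pants]
  rw [this]
  exact (isClosed_le (by fun_prop) (by fun_prop)).inter
    (isClosed_iInter fun j => isClosed_le (by fun_prop) (by fun_prop))

instance : CompactSpace pants := isCompact_iff_compactSpace.1 isCompact_pants

/-- Properness keeps the map closed after taking the product with the unit interval, as needed for
homotopies. -/
theorem isProperMap_ofPants (m : ℕ+) : IsProperMap (ofPants m) :=
  isProperMap_iff_isClosedMap_and_compact_fibers.2 ⟨continuous_ofPants m, isClosedMap_ofPants m,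
    fun _ => (isClosed_singleton.preimage (continuous_ofPants m)).isCompact⟩

theorem waist_mem_arcsLegs {t : unitInterval} (h : turn t = 1) : waist t ∈ arcsLegs := by
  have : waist t = arc 0 0 := by
    rw [(arc 0).source]
    rcases turn_eq_one_iff.1 h with rfl | rfl
    · exact waist.source
    · exact waist.target
  rw [this]
  exact Or.inl (Set.mem_iUnion.2 ⟨0, 0, rfl⟩)

theorem exists_waist_of_mem_boundary {z : pants} (h : z ∈ pantsBoundary) (h' : z ∉ arcsLegs) :
    ∃ t, waist t = z ∧ turn t ≠ 1 := by
  rcases h with ⟨t, rfl⟩ | h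
  · exact ⟨t, rfl, fun ht => h' (waist_mem_arcsLegs ht)⟩
  · exact absurd (Or.inr h) h'

theorem lt_legIndex (n : ℕ+) (j : Fin 2) : (n : ℕ) < legIndex n j := by
  change (n : ℕ) < 2 * n + j
  have := n.pos
  omega

theorem turn_eq_one_of_ell_eq {i j : ℕ+} {s t : unitInterval} (h : ell i s = ell j t)
    (hij : (i : ℕ) ≠ j) : turn s = 1 ∧ turn t = 1 := by
  rcases ell_eq_ell h with h | h
  · exact absurd (congrArg PNat.val h.1) hij
  · exact h

/-- Off the arcs and legs only interior points and points of the outer circle other than a remain;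
as ℓ_m is different from both leg circles, these are not identified with anything in the same pair
of pants. -/
theorem eq_of_ofPants_eq {m : ℕ+} {z z' : pants} (h : ofPants m z = ofPants m z')
    (hz : z ∉ arcsLegs) : z = z' := by
  by_cases hb : z ∈ pantsBoundary
  · obtain ⟨t, rfl, ht⟩ := exists_waist_of_mem_boundary hb hz
    rw [ofPants_waist] at h
    rcases mem_boundary_of_eq h.symm with ⟨t', rfl⟩ | h'
    · rw [ofPants_waist] at h
      rcases ell_eq_ell (ofEarring_injective h) with h1 | h1
      · apply Subtype.ext
        change -(4 * turn t) = -(4 * turn t')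
        rw [h1.2]
      · exact absurd h1.1 ht
    · obtain ⟨j, t', rfl⟩ := Set.mem_iUnion.1 h'
      rw [ofPants_leg] at h
      exact absurd (turn_eq_one_of_ell_eq (ofEarring_injective h) (lt_legIndex m j).ne).1 ht
  · exact (ofPants_inj h hb).2

/-- The homotopy fixes the arcs and legs, and elsewhere `ofPants m` is injective, so the homotopy
descends to the image. -/
theorem ofPants_pantsHomotopy_congr {m : ℕ+} {z z' : pants} (h : ofPants m z = ofPants m z')
    (t : unitInterval) : ofPants m (pantsHomotopy (t, z)) = ofPants m (pantsHomotopy (t, z')) := by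
  by_cases hz : z ∈ arcsLegs
  · by_cases hz' : z' ∈ arcsLegs
    · rwa [pantsHomotopy_of_mem hz, pantsHomotopy_of_mem hz']
    · rw [eq_of_ofPants_eq h.symm hz']
  · rw [eq_of_ofPants_eq h hz]

open Classical in
/-- The homotopy which collapses the pair of pants with the number `m + 1`. -/
def collapseHomotopy (m : ℕ) (q : PantsSpace × unitInterval) : PantsSpace :=
  if h : ∃ z, ofPants m.succPNat z = q.1 then ofPants m.succPNat (pantsHomotopy (q.2, h.choose))
  else q.1

/-- The collapse of the pair of pants with the number `m + 1`. -/
def collapse (m : ℕ) (x : PantsSpace) : PantsSpace := collapseHomotopy m (x, 1)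

theorem collapseHomotopy_ofPants (m : ℕ) (z : pants) (t : unitInterval) :
    collapseHomotopy m (ofPants m.succPNat z, t) = ofPants m.succPNat (pantsHomotopy (t, z)) := by
  have h : ∃ w, ofPants m.succPNat w = ofPants m.succPNat z := ⟨z, rfl⟩
  rw [collapseHomotopy, dif_pos h]
  exact ofPants_pantsHomotopy_congr h.choose_spec t

theorem collapse_ofPants (m : ℕ) (z : pants) :
    collapse m (ofPants m.succPNat z) = ofPants m.succPNat (pantsRetr z) := by
  rw [collapse, collapseHomotopy_ofPants, pantsHomotopy.apply_one]

theorem collapseHomotopy_of_not_mem {m : ℕ} {x : PantsSpace} (h : x ∉ Set.range (ofPants m.succPNat))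
    (t : unitInterval) : collapseHomotopy m (x, t) = x := dif_neg h

theorem collapseHomotopy_zero (m : ℕ) (x : PantsSpace) : collapseHomotopy m (x, 0) = x := by
  by_cases h : x ∈ Set.range (ofPants m.succPNat)
  · obtain ⟨z, rfl⟩ := h
    rw [collapseHomotopy_ofPants, pantsHomotopy.apply_zero]
    rfl
  · exact collapseHomotopy_of_not_mem h 0

/-- The union of `ℍ⁺_{m+1}` and of the pairs of pants with the numbers `m + 1, …, N`. -/
def partialPants (m N : ℕ) : Set PantsSpace :=
  HPlus (m + 1) ∪ ⋃ i : {i : ℕ+ // m < (i : ℕ) ∧ (i : ℕ) ≤ N}, Set.range (ofPants i)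

theorem mem_partialPants_iff {m N : ℕ} {x : PantsSpace} : x ∈ partialPants m N ↔
    x ∈ HPlus (m + 1) ∨ ∃ i : ℕ+, m < (i : ℕ) ∧ (i : ℕ) ≤ N ∧ x ∈ Set.range (ofPants i) := by
  simp [partialPants, and_assoc]

theorem partialPants_self (N : ℕ) : partialPants N N = HPlus (N + 1) := by
  ext x
  rw [mem_partialPants_iff]
  refine or_iff_left ?_
  rintro ⟨i, h1, h2, -⟩
  omega

theorem isClosed_partialPants (m N : ℕ) : IsClosed (partialPants m N) := by
  have hfin : {i : ℕ+ | m < (i : ℕ) ∧ (i : ℕ) ≤ N}.Finite :=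
    ((Set.finite_Iic N).preimage PNat.coe_injective.injOn).subset fun i hi => hi.2
  have : Finite {i : ℕ+ // m < (i : ℕ) ∧ (i : ℕ) ≤ N} := hfin.to_subtype
  exact (isClosed_HPlus _).union
    (isClosed_iUnion_of_finite fun i => (isClosedMap_ofPants i).isClosed_range)

/-- The interior and the outer circle of the pair of pants number m + 1 are not shared: later pairs
of pants have boundary circles of index at least their own number, and ℍ⁺_{m+2} omits ℓ_{m+1}. So
the collapse is the identity on what remains. -/
theorem mem_arcsLegs_of_mem_partialPants {m N : ℕ} {z : pants}
    (h : ofPants m.succPNat z ∈ partialPants (m + 1) N) : z ∈ arcsLegs := by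
  by_contra hz
  have hm : (m.succPNat : ℕ) = m + 1 := rfl
  by_cases hb : z ∈ pantsBoundary
  · obtain ⟨t, rfl, ht⟩ := exists_waist_of_mem_boundary hb hz
    rw [ofPants_waist] at h
    rcases mem_partialPants_iff.1 h with h | ⟨i, hi, -, z', hz'⟩
    · rcases mem_bouquet_iff.1 h with h | ⟨i, hi, j, s, h⟩ | ⟨i, hi, s, h⟩
      · exact ht (turn_eq_one_of_ell_eq_origin (ofEarring_injective h))
      · exact ht (turn_eq_one_of_ell_eq_origin (rhoLoop_eq_ofEarring h).2)
      · refine ht (turn_eq_one_of_ell_eq (ofEarring_injective h) ?_).2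
        have : m + 1 + 1 ≤ (i : ℕ) := hi
        omega
    · rcases mem_boundary_of_eq hz' with ⟨s, rfl⟩ | hb'
      · rw [ofPants_waist] at hz'
        exact ht (turn_eq_one_of_ell_eq (ofEarring_injective hz') (by omega)).2
      · obtain ⟨j, s, rfl⟩ := Set.mem_iUnion.1 hb'
        rw [ofPants_leg] at hz'
        have := lt_legIndex i j
        exact ht (turn_eq_one_of_ell_eq (ofEarring_injective hz') (by omega)).2
  · rcases mem_partialPants_iff.1 h with h | ⟨i, hi, -, z', hz'⟩
    · rcases mem_bouquet_iff.1 h with h | ⟨i, hi, j, s, h⟩ | ⟨i, hi, s, h⟩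
      · exact hb (mem_boundary_of_eq h)
      · obtain ⟨-, rfl⟩ := ofPants_inj h.symm hb
        exact hz (Or.inl (Set.mem_iUnion.2 ⟨j, s, rfl⟩))
      · exact hb (mem_boundary_of_eq h.symm)
    · obtain ⟨rfl, -⟩ := ofPants_inj hz'.symm hb
      omega

theorem collapseHomotopy_of_mem {m N : ℕ} {x : PantsSpace} (h : x ∈ partialPants (m + 1) N)
    (t : unitInterval) : collapseHomotopy m (x, t) = x := by
  by_cases hx : x ∈ Set.range (ofPants m.succPNat)
  · obtain ⟨z, rfl⟩ := hx
    rw [collapseHomotopy_ofPants, pantsHomotopy_of_mem (mem_arcsLegs_of_mem_partialPants h)]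
  · exact collapseHomotopy_of_not_mem hx t

theorem base_mem_partialPants (m N : ℕ) : base ∈ partialPants m N :=
  Or.inl (base_mem_bouquet _ _)

theorem collapseHomotopy_base (m : ℕ) (t : unitInterval) : collapseHomotopy m (base, t) = base :=
  collapseHomotopy_of_mem (base_mem_partialPants _ 0) t

theorem mem_of_mem_partialPants {m N : ℕ} {x : PantsSpace} (h : x ∈ partialPants m N) :
    x ∈ Set.range (ofPants m.succPNat) ∨ x ∈ partialPants (m + 1) N := by
  have hm : (m.succPNat : ℕ) = m + 1 := rfl
  rcases mem_partialPants_iff.1 h with h | ⟨i, hi, hi', h⟩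
  · rcases mem_bouquet_iff.1 h with rfl | ⟨i, hi, j, s, h⟩ | ⟨i, hi, s, h⟩
    · exact Or.inr (base_mem_partialPants _ _)
    · exact Or.inr (Or.inl (mem_bouquet_iff.2 (Or.inr (Or.inl ⟨i, by omega, j, s, h⟩))))
    · have hi : m + 1 ≤ (i : ℕ) := hi
      rcases eq_or_lt_of_le hi with hi | hi
      · have : i = m.succPNat := PNat.coe_injective (by omega)
        subst this
        exact Or.inl ⟨waist s, (ofPants_waist _ _).trans h⟩
      · exact Or.inr (Or.inl (mem_bouquet_iff.2 (Or.inr (Or.inr ⟨i, hi, s, h⟩))))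
  · rcases eq_or_lt_of_le (Nat.succ_le_of_lt hi) with hi | hi
    · have : i = m.succPNat := PNat.coe_injective (by omega)
      subst this
      exact Or.inl h
    · exact Or.inr (mem_partialPants_iff.2 (Or.inr ⟨i, hi, hi', h⟩))

/-- The legs of the pair of pants number m + 1 are circles of index above m + 1, and its arcs belong
to the next level. -/
theorem collapse_mem {m N : ℕ} {x : PantsSpace} (h : x ∈ partialPants m N) :
    collapse m x ∈ partialPants (m + 1) N := by
  have hm : (m.succPNat : ℕ) = m + 1 := rfl
  rcases mem_of_mem_partialPants h with ⟨z, rfl⟩ | h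
  · rw [collapse_ofPants]
    refine Or.inl (mem_bouquet_iff.2 (Or.inr ?_))
    rcases pantsRetr_mem z with h | h
    · obtain ⟨j, s, hs⟩ := Set.mem_iUnion.1 h
      rw [← hs]
      exact Or.inl ⟨_, by omega, j, s, rfl⟩
    · obtain ⟨j, s, hs⟩ := Set.mem_iUnion.1 h
      rw [← hs, ofPants_leg]
      refine Or.inr ⟨_, ?_, s, rfl⟩
      have := lt_legIndex m.succPNat j
      change m + 1 + 1 ≤ _
      omega
  · rw [collapse, collapseHomotopy_of_mem h]
    exact h

theorem continuousOn_collapseHomotopy (m N : ℕ) :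
    ContinuousOn (collapseHomotopy m) (partialPants m N ×ˢ Set.univ) := by
  have h1 : ContinuousOn (collapseHomotopy m) (Set.range (ofPants m.succPNat) ×ˢ Set.univ) := by
    have e : Set.range (ofPants m.succPNat) ×ˢ (Set.univ : Set unitInterval)
        = Prod.map (ofPants m.succPNat) id '' Set.univ := by
      rw [Set.image_univ, Set.range_prodMap, Set.range_id]
    rw [e]
    refine continuousOn_image_of_isClosedMap
      ((isProperMap_ofPants m.succPNat).universally_closed _) isClosed_univ ?_
    have : collapseHomotopy m ∘ Prod.map (ofPants m.succPNat) id
        = fun q => ofPants m.succPNat (pantsHomotopy (q.2, q.1)) :=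
      funext fun q => collapseHomotopy_ofPants m q.1 q.2
    rw [this]
    exact ((continuous_ofPants _).comp (pantsHomotopy.continuous.comp continuous_swap)).continuousOn
  have h2 : ContinuousOn (collapseHomotopy m) (partialPants (m + 1) N ×ˢ Set.univ) :=
    continuousOn_fst.congr fun q hq => collapseHomotopy_of_mem hq.1 q.2
  refine (h1.union_of_isClosed h2
    ((isClosedMap_ofPants _).isClosed_range.prod isClosed_univ)
    ((isClosed_partialPants _ _).prod isClosed_univ)).mono ?_
  rintro ⟨x, t⟩ ⟨hx, -⟩
  exact (mem_of_mem_partialPants hx).imp (fun h => ⟨h, trivial⟩) fun h => ⟨h, trivial⟩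

theorem continuousOn_collapse (m N : ℕ) : ContinuousOn (collapse m) (partialPants m N) :=
  (continuousOn_collapseHomotopy m N).comp (by fun_prop) fun _ hx => ⟨hx, trivial⟩

/-! ### Compact sets -/

/-- Choose an interior point of `K` in each pair of pants whose interior meets `K`. The sets of
chosen points with index above N are closed, since each piece contains at most one of them, and they
decrease to the empty set; by compactness some set misses `K`. -/
theorem exists_subset_partialPants {K : Set PantsSpace} (hK : IsCompact K) :
    ∃ N₀, ∀ N ≥ N₀, K ⊆ partialPants 0 N := by
  set P : ℕ+ → Prop := fun i => ∃ z, z ∉ pantsBoundary ∧ ofPants i z ∈ K with hP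
  have : Nonempty pants := ⟨waistPt⟩
  choose! z hzb hzK using fun (i : ℕ+) (h : P i) => h
  set T : ℕ → Set PantsSpace := fun N => {x | ∃ i, P i ∧ N < (i : ℕ) ∧ ofPants i (z i) = x} with hT
  have hTc : ∀ N, IsClosed (T N) := by
    intro N
    refine isClosed_pantsSpace ?_ fun m => ?_
    · have : ofEarring ⁻¹' T N = ∅ := by
        rw [Set.eq_empty_iff_forall_notMem]
        rintro p ⟨i, hi, -, h⟩
        exact hzb i hi (mem_boundary_of_eq h)
      rw [this]
      exact isClosed_empty
    · refine (Set.subsingleton_of_subset_singleton (a := z m) ?_).finite.isClosed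
      rintro w ⟨i, hi, -, h⟩
      obtain ⟨rfl, h'⟩ := ofPants_inj h (hzb i hi)
      exact h'.symm
  obtain ⟨N₀, hN₀⟩ := hK.elim_directed_cover (fun N => (T N)ᶜ) (fun N => (hTc N).isOpen_compl) (by
    intro x _
    by_contra hx
    simp only [Set.mem_iUnion, Set.mem_compl_iff, not_exists, not_not] at hx
    obtain ⟨i, hi, -, h⟩ := hx 0
    obtain ⟨i', hi', hlt, h'⟩ := hx i
    obtain ⟨rfl, -⟩ := ofPants_inj (h.trans h'.symm) (hzb i hi)
    exact lt_irrefl _ hlt) (Monotone.directed_le fun N N' h => by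
      refine Set.compl_subset_compl.2 ?_
      rintro x ⟨i, hi, hlt, h'⟩
      exact ⟨i, hi, lt_of_le_of_lt h hlt, h'⟩)
  refine ⟨N₀, fun N hN x hx => ?_⟩
  have hE : ∀ p, ofEarring p ∈ partialPants 0 N := by
    intro p
    obtain ⟨i, hi⟩ := Set.mem_iUnion.1 p.2
    obtain ⟨t, rfl⟩ := exists_ell_eq hi
    exact Or.inl (mem_bouquet_iff.2 (Or.inr (Or.inr ⟨i, i.pos, t, rfl⟩)))
  obtain ⟨p | ⟨m, w⟩, rfl⟩ := Quot.exists_rep x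
  · exact hE p
  · change ofPants m w ∈ _
    change ofPants m w ∈ K at hx
    by_cases hb : w ∈ pantsBoundary
    · obtain ⟨p, hp⟩ := exists_ofEarring_of_mem_boundary m hb
      rw [← hp]
      exact hE p
    · have hm : P m := ⟨w, hb, hx⟩
      refine mem_partialPants_iff.2 (Or.inr ⟨m, m.pos, ?_, w, rfl⟩)
      by_contra hlt
      push Not at hlt
      exact hN₀ (hzK m hm) ⟨m, hm, by omega, rfl⟩

/-! ### The fundamental group of the Hawaiian Pants -/

/-- A loop in `ℍ⁺_n` as a loop in `ℙ`. -/
def inclPath {n : ℕ} (γ : Path (HPlus.base n) (HPlus.base n)) : Path base base :=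
  γ.map continuous_subtype_val

theorem inclHom_loopClass {n : ℕ} (γ : Path (HPlus.base n) (HPlus.base n)) :
    inclHom n (loopClass γ) = loopClass (inclPath γ) :=
  PiOne.map_loopClass _ γ

/-- Every path in `ℙ` can be pushed into `ℍ⁺_n` for all sufficiently large `n`. -/
theorem exists_inclHom_eq (a : PiOne PantsSpace base) :
    ∃ N : ℕ, ∀ n : ℕ, N ≤ n → ∃ x : PiOne (HPlus n) (HPlus.base n), inclHom n x = a := by
  obtain ⟨α, rfl⟩ := exists_loopClass a
  obtain ⟨N₀, hN₀⟩ := exists_subset_partialPants (isCompact_range α.continuous)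
  refine ⟨N₀ + 1, fun n hn => ?_⟩
  obtain ⟨N, rfl⟩ : ∃ N, n = N + 1 := ⟨n - 1, by omega⟩
  -- The pairs of pants 1, …, m have been collapsed; for m = N only ℍ⁺_{N+1} is left.
  have key : ∀ m, ∃ α' : Path base base, α.Homotopic α' ∧ ∀ t, α' t ∈ partialPants m N := by
    intro m
    induction m with
    | zero => exact ⟨α, Path.Homotopic.refl α, fun t => hN₀ N (by omega) ⟨t, rfl⟩⟩
    | succ m ih =>
      obtain ⟨α', h1, h2⟩ := ih
      have hc : Continuous fun q : unitInterval × unitInterval =>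
          collapseHomotopy m (α' q.2, q.1) :=
        (continuousOn_collapseHomotopy m N).comp_continuous (by fun_prop)
          fun q => ⟨h2 q.2, trivial⟩
      have hp : Continuous fun t => collapse m (α' t) :=
        (continuousOn_collapse m N).comp_continuous α'.continuous h2
      refine ⟨⟨⟨_, hp⟩, ?_, ?_⟩, h1.trans ⟨⟨⟨⟨_, hc⟩, ?_, ?_⟩, ?_⟩⟩, fun t => collapse_mem (h2 t)⟩
      · change collapse m (α' 0) = base
        rw [α'.source]; exact collapseHomotopy_base m 1
      · change collapse m (α' 1) = base
        rw [α'.target]; exact collapseHomotopy_base m 1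
      · exact fun t => collapseHomotopy_zero m _
      · exact fun t => rfl
      · rintro t s (rfl | rfl)
        · change collapseHomotopy m (α' 0, t) = α' 0
          rw [α'.source]; exact collapseHomotopy_base m t
        · change collapseHomotopy m (α' 1, t) = α' 1
          rw [α'.target]; exact collapseHomotopy_base m t
  obtain ⟨α', h1, h2⟩ := key N
  rw [partialPants_self] at h2
  refine ⟨loopClass (x := HPlus.base (N + 1)) (restrictPath α' h2 _ _), ?_⟩
  exact (inclHom_loopClass _).trans (loopClass_eq_iff.2 h1.symm)

/-- The restriction of the collapse to `ℍ⁺_{m+1}`. -/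
def collapseMap (m : ℕ) : C(HPlus (m + 1), HPlus (m + 1 + 1)) where
  toFun x := ⟨collapse m x, by
    have := collapse_mem (N := m + 1) (Or.inl x.2 : (x : PantsSpace) ∈ partialPants m (m + 1))
    rwa [partialPants_self] at this⟩
  continuous_toFun := Continuous.subtype_mk
    ((continuousOn_collapse m (m + 1)).comp_continuous continuous_subtype_val
      fun x => Or.inl x.2) _

theorem collapseMap_base (m : ℕ) : collapseMap m (HPlus.base (m + 1)) = HPlus.base (m + 1 + 1) :=
  Subtype.ext (collapseHomotopy_base m 1)

/-- The homomorphism induced by the collapse. -/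
def collapseHom (m : ℕ) : PiOne (HPlus (m + 1)) (HPlus.base (m + 1)) →*
    PiOne (HPlus (m + 1 + 1)) (HPlus.base (m + 1 + 1)) :=
  PiOne.map (collapseMap m) (collapseMap_base m)

/-- The homotopy from the inclusion to the collapse runs through the pair of pants number m + 1, so
it exists in ℙ. -/
theorem inclHom_collapseHom (m : ℕ) (x : PiOne (HPlus (m + 1)) (HPlus.base (m + 1))) :
    inclHom (m + 1 + 1) (collapseHom m x) = inclHom (m + 1) x := by
  obtain ⟨γ, rfl⟩ := exists_loopClass x
  rw [collapseHom, PiOne.map_loopClass_cast, inclHom_loopClass, inclHom_loopClass, loopClass_eq_iff]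
  refine Path.Homotopic.symm ⟨⟨⟨⟨fun q => collapseHomotopy m (γ q.2, q.1), ?_⟩, ?_, ?_⟩, ?_⟩⟩
  · exact (continuousOn_collapseHomotopy m m).comp_continuous (by fun_prop)
      fun q => ⟨Or.inl (γ q.2).2, trivial⟩
  · exact fun t => collapseHomotopy_zero m _
  · exact fun t => rfl
  · rintro t s (rfl | rfl)
    · change collapseHomotopy m (γ 0, t) = γ 0
      rw [γ.source]; exact collapseHomotopy_base m t
    · change collapseHomotopy m (γ 1, t) = γ 1
      rw [γ.target]; exact collapseHomotopy_base m t

/-- The composition of the collapses with the numbers `m, …, m + d - 1`. -/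
def collapseIter (m : ℕ) : ℕ → PantsSpace → PantsSpace
  | 0 => id
  | d + 1 => collapse (m + d) ∘ collapseIter m d

/-- The composition of the homomorphisms induced by collapses. -/
def collapseHomIter (m : ℕ) : (d : ℕ) → PiOne (HPlus (m + 1)) (HPlus.base (m + 1)) →*
    PiOne (HPlus (m + d + 1)) (HPlus.base (m + d + 1))
  | 0 => MonoidHom.id _
  | d + 1 => (collapseHom (m + d)).comp (collapseHomIter m d)

theorem inclHom_collapseHomIter (m d : ℕ) (x : PiOne (HPlus (m + 1)) (HPlus.base (m + 1))) :
    inclHom (m + d + 1) (collapseHomIter m d x) = inclHom (m + 1) x := by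
  induction d with
  | zero => rfl
  | succ d ih => exact (inclHom_collapseHom (m + d) _).trans ih

theorem exists_collapseHomIter_eq (m d : ℕ) (γ : Path (HPlus.base (m + 1)) (HPlus.base (m + 1))) :
    ∃ δ : Path (HPlus.base (m + d + 1)) (HPlus.base (m + d + 1)),
      collapseHomIter m d (loopClass γ) = loopClass δ ∧
        ∀ t, (δ t : PantsSpace) = collapseIter m d (γ t) := by
  induction d with
  | zero => exact ⟨γ, rfl, fun t => rfl⟩
  | succ d ih =>
    obtain ⟨δ, h1, h2⟩ := ih
    refine ⟨(δ.map (collapseMap (m + d)).continuous).cast (collapseMap_base _).symm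
      (collapseMap_base _).symm, ?_, fun t => ?_⟩
    · change collapseHom (m + d) (collapseHomIter m d (loopClass γ)) = _
      rw [h1]
      exact PiOne.map_loopClass_cast _ _ _
    · exact congrArg (collapse (m + d)) (h2 t)

/-- The first `d` collapses fix ℍ⁺_{m+d+1}: its circles have larger indices, and its arcs are either
already present or lie in a pair of pants still to be collapsed. -/
theorem collapseIter_of_mem {m d d' : ℕ} {x : PantsSpace} (h : x ∈ HPlus (m + d + 1)) :
    collapseIter m (d + d') x = collapseIter (m + d) d' x := by
  have hfix : ∀ e ≤ d, collapseIter m e x = x := by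
    intro e he
    induction e with
    | zero => rfl
    | succ e ih =>
      change collapse (m + e) (collapseIter m e x) = x
      rw [ih (by omega)]
      refine collapseHomotopy_of_mem (N := m + d) (mem_partialPants_iff.2 ?_) 1
      rcases mem_bouquet_iff.1 h with rfl | ⟨i, hi, j, s, h⟩ | ⟨i, hi, s, h⟩
      · exact Or.inl (base_mem_bouquet _ _)
      · by_cases hi' : (i : ℕ) < m + e + 1 + 1
        · exact Or.inl (mem_bouquet_iff.2 (Or.inr (Or.inl ⟨i, hi', j, s, h⟩)))
        · exact Or.inr ⟨i, by omega, by omega, arc j s, h⟩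
      · refine Or.inl (mem_bouquet_iff.2 (Or.inr (Or.inr ⟨i, ?_, s, h⟩)))
        have : m + d + 1 ≤ (i : ℕ) := hi
        change m + e + 1 + 1 ≤ (i : ℕ)
        omega
  induction d' with
  | zero => exact hfix d le_rfl
  | succ d' ih =>
    change collapse (m + (d + d')) (collapseIter m (d + d') x)
      = collapse (m + d + d') (collapseIter (m + d) d' x)
    rw [ih, add_assoc]

/-- Elements with the same image in `π₁(ℙ, b₀)` become equal after sufficiently many collapses. -/
theorem exists_collapseHomIter_eq_of_inclHom_eq {m : ℕ}
    {x y : PiOne (HPlus (m + 1)) (HPlus.base (m + 1))} (h : inclHom (m + 1) x = inclHom (m + 1) y) :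
    ∃ d, collapseHomIter m d x = collapseHomIter m d y := by
  obtain ⟨γ, rfl⟩ := exists_loopClass x
  obtain ⟨γ', rfl⟩ := exists_loopClass y
  rw [inclHom_loopClass, inclHom_loopClass, loopClass_eq_iff] at h
  obtain ⟨F⟩ := h
  obtain ⟨N₀, hN₀⟩ := exists_subset_partialPants (isCompact_range F.continuous)
  refine ⟨N₀, ?_⟩
  -- The homotopy may meet every pair of pants up to `N₀`, so all collapses from number 0 on are
  -- applied to it.
  have key : ∀ e, ContinuousOn (collapseIter 0 e) (partialPants 0 (m + N₀)) ∧
      Set.MapsTo (collapseIter 0 e) (partialPants 0 (m + N₀)) (partialPants e (m + N₀)) := by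
    intro e
    induction e with
    | zero => exact ⟨continuousOn_id, Set.mapsTo_id _⟩
    | succ e ih =>
      simp only [collapseIter, Nat.zero_add]
      exact ⟨(continuousOn_collapse e (m + N₀)).comp ih.1 ih.2,
        fun x hx => collapse_mem (ih.2 hx)⟩
  obtain ⟨δ, h1, h2⟩ := exists_collapseHomIter_eq m N₀ γ
  obtain ⟨δ', h1', h2'⟩ := exists_collapseHomIter_eq m N₀ γ'
  have hbase : ∀ e, collapseIter 0 e base = base := by
    intro e
    induction e with
    | zero => rfl
    | succ e ih => exact (congrArg _ ih).trans (collapseHomotopy_base _ 1)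
  have hF : ∀ q, F q ∈ partialPants 0 (m + N₀) := fun q => hN₀ _ (by omega) ⟨q, rfl⟩
  have hmem : ∀ q, collapseIter 0 (m + N₀) (F q) ∈ HPlus (m + N₀ + 1) := by
    intro q
    rw [← partialPants_self]
    exact (key _).2 (hF q)
  -- On ℍ⁺_{m+1} the first `m` of these collapses do nothing, so the boundary of the homotopy is as
  -- required.
  have hval : ∀ x ∈ HPlus (m + 1), collapseIter 0 (m + N₀) x = collapseIter m N₀ x := by
    intro x hx
    have := collapseIter_of_mem (m := 0) (d := m) (d' := N₀) (x := x) (by rwa [Nat.zero_add])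
    rwa [Nat.zero_add] at this
  rw [h1, h1', loopClass_eq_iff]
  refine ⟨⟨⟨⟨fun q => ⟨collapseIter 0 (m + N₀) (F q), hmem q⟩, ?_⟩, ?_, ?_⟩, ?_⟩⟩
  · exact Continuous.subtype_mk ((key _).1.comp_continuous F.continuous hF) _
  · intro t
    apply Subtype.ext
    change collapseIter 0 (m + N₀) (F (0, t)) = δ t
    rw [F.apply_zero, h2]
    exact hval _ (γ t).2
  · intro t
    apply Subtype.ext
    change collapseIter 0 (m + N₀) (F (1, t)) = δ' t
    rw [F.apply_one, h2']
    exact hval _ (γ' t).2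
  · rintro t s (rfl | rfl)
    · apply Subtype.ext
      change collapseIter 0 (m + N₀) (F (t, 0)) = δ 0
      rw [F.source, δ.source]
      exact hbase _
    · apply Subtype.ext
      change collapseIter 0 (m + N₀) (F (t, 1)) = δ 1
      rw [F.target, δ.target]
      exact hbase _

end HawaiianPants

end

/-! ### The substitution induced by a collapse, and the labelling χ -/

noncomputable section

namespace HawaiianPants

open Filter Topology

/-! ### The effect of a collapse on words -/

/-- The word `ρ_{n,j} ℓ_{2n+j} ρ_{n,j}⁻¹`. -/
def legConj (n : ℕ+) (j : Fin 2) : FreeGroup Gen :=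
  .of (.rho n j) * .of (.ell (legIndex n j)) * (.of (.rho n j))⁻¹

/-- The substitution that expresses the boundary circle `ℓ_n` of a pair of pants in terms of the
other ones. -/
def subHom (n : ℕ+) : FreeGroup Gen →* FreeGroup Gen :=
  FreeGroup.lift fun g => if g = .ell n then legConj n 0 * legConj n 1 else .of g

theorem subHom_jump {n : ℕ+} {g : Gen} (hg : g ≠ .ell n) (z : ℂ) :
    subHom n (jump g z) = jump g z := by
  unfold jump subHom
  split_ifs <;> simp [hg]

/-- The unit circle. -/
abbrev UnitCircle : Type := {z : ℂ // ‖z‖ = 1}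

/-- The point of the outer boundary of the pair of pants that corresponds to a point of the unit
circle. -/
def waistAt (u : UnitCircle) : pants := ⟨-(4 * (u : ℂ)), waist_mem u u.2⟩

theorem continuous_waistAt : Continuous waistAt := Continuous.subtype_mk (by fun_prop) _

/-- The value of `waistLift` on the arcs, up to the position on the arc. -/
def arcStart (n : ℕ+) (w : ℂ) : FreeGroup Gen :=
  if w.re ≤ 0 then (if sideOf w = 0 then 1 else legConj n 0 * legConj n 1) else legConj n 0

/-- The lift of the retract of the outer boundary of the pair of pants. -/
def waistLift (n : ℕ+) (w : ℂ) : FreeGroup Gen :=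
  if foldX w ≤ -1 then
    arcStart n w * if foldX w ≤ -(5 / 2) then 1 else .of (.rho n (sideOf w))
  else (if sideOf w = 0 then 1 else legConj n 0) * .of (.rho n (sideOf w)) *
    jump (.ell (legIndex n (sideOf w))) (legCoord w)

theorem coord_pantsRetr_arc (n : ℕ+) (g : Gen) {z : pants} (h : foldX z ≤ -1) {s : unitInterval}
    (hs : (s : ℝ) = (foldX z + 4) / 3) :
    coord g (ofPants n (pantsRetr z)) = if g = .rho n (sideOf z) then turn s else 1 := by
  rw [pantsRetr_eq_arc h hs]
  exact coord_loop g (.rho n (sideOf z)) s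

theorem coord_pantsRetr_leg (n : ℕ+) (g : Gen) {z : pants} (h : -1 ≤ foldX z) :
    coord g (ofPants n (pantsRetr z)) =
      if g = .ell (legIndex n (sideOf z)) then legCoord z else 1 := by
  obtain ⟨t, ht⟩ := turn_surjective (norm_legCoord h)
  rw [pantsRetr_eq_leg ht, ofPants_leg, ← ht]
  exact coord_loop g (.ell (legIndex n (sideOf z))) t

theorem waistAt_sq (u : UnitCircle) : (waistAt u : ℂ).re ^ 2 + |(waistAt u : ℂ).im| ^ 2 = 16 := by
  have h := unit_eq u.2
  change (-(4 * (u : ℂ))).re ^ 2 + |(-(4 * (u : ℂ))).im| ^ 2 = 16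
  rw [sq_abs]
  simp
  nlinarith

theorem eventually_sideOf {w : ℂ} (h : w.im ≠ 0) : ∀ᶠ w' in 𝓝 w, sideOf w' = sideOf w := by
  rcases lt_or_gt_of_ne h with h | h
  · filter_upwards [Complex.continuous_im.continuousAt.eventually (gt_mem_nhds h)] with w' hw'
    rw [sideOf, sideOf, if_neg (not_le.2 h), if_neg (not_le.2 hw')]
  · filter_upwards [Complex.continuous_im.continuousAt.eventually (lt_mem_nhds h)] with w' hw'
    rw [sideOf, sideOf, if_pos h.le, if_pos (le_of_lt hw')]

theorem eventually_arcStart (n : ℕ+) {w : ℂ} (h : w.im ≠ 0) (h' : w.re ≠ 0) :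
    ∀ᶠ w' in 𝓝 w, arcStart n w' = arcStart n w := by
  rcases lt_or_gt_of_ne h' with h' | h'
  · filter_upwards [eventually_sideOf h,
      Complex.continuous_re.continuousAt.eventually (gt_mem_nhds h')] with w' h1 h2
    rw [arcStart, arcStart, if_pos h'.le, if_pos (le_of_lt h2), h1]
  · filter_upwards [Complex.continuous_re.continuousAt.eventually (lt_mem_nhds h')] with w' h2
    rw [arcStart, arcStart, if_neg (not_le.2 h'), if_neg (not_le.2 h2)]

theorem foldX_eq (w : ℂ) : foldX w = w.re ∨ foldX w = 1 ∨ foldX w = 5 * |w.im| - 4 := by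
  unfold foldX
  rcases min_choice (min w.re 1) (5 * |w.im| - 4) with h | h <;> rw [h]
  · rcases min_choice w.re 1 with h | h <;> rw [h] <;> simp
  · simp

theorem im_ne_zero_of_foldX {w : ℂ} (h : -4 < foldX w) : w.im ≠ 0 := by
  intro h0
  have := foldX_le_im w
  rw [h0, abs_zero] at this
  linarith

theorem re_ne_zero_of_foldX {u : UnitCircle} (h : foldX (waistAt u) ≤ -1) :
    (waistAt u : ℂ).re ≠ 0 := by
  intro h0
  have h1 := waistAt_sq u
  have h2 := abs_nonneg (waistAt u : ℂ).im
  rcases foldX_eq (waistAt u : ℂ) with h3 | h3 | h3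
  · linarith
  · linarith
  · rw [h0] at h1
    nlinarith

/-- Near the end of an arc, the side of the point of the leg is determined. -/
theorem legCoord_im_of_near {w : ℂ} (hw : w ∈ pants) (h1 : -1 < foldX w) (h2 : foldX w < 1) :
    (3 < |w.im| → 2 < foldR (foldX w) |w.im|) ∧ (|w.im| < 1 → foldR (foldX w) |w.im| < 2) := by
  have hs : 0 < √(1 - foldX w ^ 2) := Real.sqrt_pos.2 (by nlinarith)
  have hs1 : √(1 - foldX w ^ 2) ≤ 1 := by
    rw [Real.sqrt_le_one]
    nlinarith [sq_nonneg (foldX w)]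
  rcases foldR_cases h1.le h2.le (one_le_foldX_sq_add hw le_rfl (foldX_le_re w)) with
    ⟨h3, h4⟩ | ⟨h3, h4⟩ <;> rw [h4]
  · exact ⟨fun _ => by linarith, fun h => by linarith⟩
  · exact ⟨fun h => by linarith, fun _ => by linarith⟩

/-- Near the junction of an arc with a leg, the formulas of `waistLift` for the two sides agree. -/
theorem waistLift_of_leg_start {n : ℕ+} {w : ℂ} (hw : w ∈ pants) (h1 : -(5 / 2) < foldX w)
    (h2 : foldX w < 1) (h3 : (3 < |w.im| ∧ w.re ≤ 0) ∨ (|w.im| < 1 ∧ 0 < w.re)) :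
    waistLift n w = arcStart n w * .of (.rho n (sideOf w)) := by
  unfold waistLift
  split_ifs with h4 h5 h6
  · exact absurd h5 (not_le.2 h1)
  · rfl
  · push Not at h4
    obtain ⟨h7, h8⟩ := legCoord_im_of_near hw h4 h2
    have him : (legCoord w).im = 2 - foldR (foldX w) |w.im| := by
      have : 0 ≤ w.im := by
        by_contra hc
        simp [sideOf, hc] at h6
      simp [legCoord, this]
    rw [h6, jump, him, arcStart]
    rcases h3 with ⟨h3, h3'⟩ | ⟨h3, h3'⟩
    · rw [if_pos (by linarith [h7 h3]), if_pos h3', if_pos h6, mul_one]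
    · rw [if_neg (by linarith [h8 h3]), if_neg (not_le.2 h3'), legConj]
      simp
  · push Not at h4
    obtain ⟨h7, h8⟩ := legCoord_im_of_near hw h4 h2
    have hside : sideOf w = 1 := by omega
    have him : (legCoord w).im = foldR (foldX w) |w.im| - 2 := by
      have : ¬ 0 ≤ w.im := fun hc => by simp [sideOf, hc] at h6
      simp [legCoord, this]
    rw [hside, jump, him, arcStart]
    rcases h3 with ⟨h3, h3'⟩ | ⟨h3, h3'⟩
    · rw [if_neg (by linarith [h7 h3]), if_pos h3', if_neg h6, legConj, legConj]
      simp [mul_assoc]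
    · rw [if_pos (by linarith [h8 h3]), if_neg (not_le.2 h3'), mul_one]

/-- `waistLift` is a lift of the retract of the outer boundary. -/
theorem waistLift_spec {n : ℕ+} {k : ℕ} (hk : 2 * (n : ℕ) + 1 ≤ k) {u : UnitCircle}
    (hu : (u : ℂ) ≠ 1) :
    ((∀ g ∈ symbs (n + 1) k, coord g (ofPants n (pantsRetr (waistAt u))) = 1) →
      ∀ᶠ u' in 𝓝 u, waistLift n (waistAt u') = waistLift n (waistAt u)) ∧
    ∀ g ∈ symbs (n + 1) k, coord g (ofPants n (pantsRetr (waistAt u))) ≠ 1 →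
      ∃ a, ∀ᶠ u' in 𝓝 u, waistLift n (waistAt u') =
        a * jump g (coord g (ofPants n (pantsRetr (waistAt u')))) := by
  have hcw : Continuous fun u => (waistAt u : ℂ) := continuous_subtype_val.comp continuous_waistAt
  have hcX : Continuous fun u => foldX (waistAt u) := continuous_foldX.comp hcw
  have hcr : Continuous fun u => |(waistAt u : ℂ).im| := by fun_prop
  have hre : -4 < (waistAt u : ℂ).re := by
    change -4 < (-(4 * (u : ℂ))).re
    have := unit_re_lt u.2 hu
    simp
    linarith
  have hsq := waistAt_sq u
  have hr0 := abs_nonneg (waistAt u : ℂ).im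
  rcases lt_trichotomy (foldX (waistAt u)) (-1) with hX | hX | hX
  · have hre0 := re_ne_zero_of_foldX hX.le
    have harc : ∀ u', foldX (waistAt u') < -1 → ∃ s : unitInterval,
        (s : ℝ) = (foldX (waistAt u') + 4) / 3 ∧ ∀ g, coord g (ofPants n (pantsRetr (waistAt u'))) =
          if g = .rho n (sideOf (waistAt u')) then turn s else 1 := by
      intro u' h
      have h1 := le_foldX (waistAt u').2
      refine ⟨⟨(foldX (waistAt u') + 4) / 3, by constructor <;> linarith⟩, rfl, fun g => ?_⟩
      exact coord_pantsRetr_arc n g h.le rfl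
    rcases (le_foldX (waistAt u).2).lt_or_eq with h4 | h4
    · have him := im_ne_zero_of_foldX h4
      obtain ⟨s, hs, hc⟩ := harc u hX
      have hs1 : turn s ≠ 1 := by
        rw [Ne, turn_eq_one_iff]
        rintro (h | h) <;> rw [h] at hs <;> simp at hs <;> linarith
      refine ⟨fun h => ?_, fun g _ h => ⟨arcStart n (waistAt u), ?_⟩⟩
      · have := h (.rho n (sideOf (waistAt u))) (mem_symbs.2 (Nat.lt_succ_self _))
        rw [hc, if_pos rfl] at this
        exact absurd this hs1
      · have hg : g = .rho n (sideOf (waistAt u)) := by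
          by_contra hg
          exact h (by rw [hc, if_neg hg])
        filter_upwards [hcX.continuousAt.eventually (gt_mem_nhds hX),
          hcX.continuousAt.eventually (lt_mem_nhds h4),
          hcw.continuousAt.eventually (eventually_sideOf him),
          hcw.continuousAt.eventually (eventually_arcStart n him hre0)] with u' h5 h5' h6 h7
        obtain ⟨s', hs', hc'⟩ := harc u' h5
        have hs1' : turn s' ≠ 1 := by
          rw [Ne, turn_eq_one_iff]
          rintro (h | h) <;> rw [h] at hs' <;> simp at hs' <;> linarith
        rw [hc', h6, hg, if_pos rfl, waistLift, if_pos h5.le, h6, h7, jump]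
        congr 1
        refine if_congr ?_ rfl rfl
        rw [turn_im_nonpos_iff hs1', hs']
        constructor <;> intro h <;> linarith
    -- Abscissa -4 means that the point is on the real line, and `u ≠ 1` leaves only the right end
    -- of the outer circle. There the retract passes from one arc to the other through the base
    -- point, at the vertex `legConj n 0`.
    · obtain ⟨s, hs, hc⟩ := harc u hX
      have hs0 : s = 0 := Subtype.ext (by rw [hs, ← h4]; simp)
      rw [hs0, turn_zero] at hc
      simp only [ite_self] at hc
      refine ⟨fun _ => ?_, fun g _ h => absurd (hc g) h⟩
      have hpos : 0 < (waistAt u : ℂ).re := by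
        have h0 : |(waistAt u : ℂ).im| = 0 := by
          rcases foldX_eq (waistAt u : ℂ) with h3 | h3 | h3 <;> linarith
        rw [h0] at hsq
        nlinarith
      have key : ∀ u', 0 < (waistAt u' : ℂ).re → foldX (waistAt u') < -(5 / 2) →
          waistLift n (waistAt u') = legConj n 0 := by
        intro u' h1 h2
        rw [waistLift, if_pos (by linarith), if_pos h2.le, arcStart, if_neg (not_le.2 h1), mul_one]
      have h4' : foldX (waistAt u) < -(5 / 2) := by linarith
      filter_upwards [hcX.continuousAt.eventually (gt_mem_nhds h4'),
        (Complex.continuous_re.comp hcw).continuousAt.eventually (lt_mem_nhds hpos)] with u' h5 h6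
      rw [key u' h6 h5, key u hpos h4']
  · have h4 : -4 < foldX (waistAt u) := by linarith
    have him := im_ne_zero_of_foldX h4
    have hre0 := re_ne_zero_of_foldX hX.le
    have hc : ∀ g, coord g (ofPants n (pantsRetr (waistAt u))) = 1 := by
      intro g
      rw [coord_pantsRetr_arc n g hX.le (s := 1) (by rw [hX]; norm_num), turn_one, ite_self]
    refine ⟨fun _ => ?_, fun g _ h => absurd (hc g) h⟩
    -- On the circle of radius 4 the folded abscissa -1 is either the true one, at height √15 > 3,
    -- or it is 5r - 4 with r = 3/5, on the right half.
    have hcase : (3 < |(waistAt u : ℂ).im| ∧ (waistAt u : ℂ).re < 0) ∨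
        (|(waistAt u : ℂ).im| < 1 ∧ 0 < (waistAt u : ℂ).re) := by
      have h1 := foldX_le_re (waistAt u : ℂ)
      rcases foldX_eq (waistAt u : ℂ) with h3 | h3 | h3
      · refine Or.inl ⟨?_, by linarith⟩
        rw [← h3, hX] at hsq
        nlinarith
      · linarith
      · refine Or.inr ⟨by linarith, ?_⟩
        by_contra hneg
        have : |(waistAt u : ℂ).im| = 3 / 5 := by linarith
        rw [this] at hsq
        nlinarith
    have hev : ∀ᶠ u' in 𝓝 u, (3 < |(waistAt u' : ℂ).im| ∧ (waistAt u' : ℂ).re ≤ 0) ∨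
        (|(waistAt u' : ℂ).im| < 1 ∧ 0 < (waistAt u' : ℂ).re) := by
      have hcre := Complex.continuous_re.comp hcw
      rcases hcase with ⟨h1, h2⟩ | ⟨h1, h2⟩
      · filter_upwards [hcr.continuousAt.eventually (lt_mem_nhds h1),
          hcre.continuousAt.eventually (gt_mem_nhds h2)] with u' h3 h4
        exact Or.inl ⟨h3, le_of_lt h4⟩
      · filter_upwards [hcr.continuousAt.eventually (gt_mem_nhds h1),
          hcre.continuousAt.eventually (lt_mem_nhds h2)] with u' h3 h4
        exact Or.inr ⟨h3, h4⟩
    have h5 : -(5 / 2) < foldX (waistAt u) := by linarith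
    have h6 : foldX (waistAt u) < 1 := by linarith
    filter_upwards [hev, hcX.continuousAt.eventually (lt_mem_nhds h5),
      hcX.continuousAt.eventually (gt_mem_nhds h6),
      hcw.continuousAt.eventually (eventually_sideOf him),
      hcw.continuousAt.eventually (eventually_arcStart n him hre0)] with u' h7 h8 h9 h10 h11
    rw [waistLift_of_leg_start (waistAt u').2 h8 h9 h7,
      waistLift_of_leg_start (waistAt u).2 h5 h6 hev.self_of_nhds, h10, h11]
  · have him := im_ne_zero_of_foldX (w := waistAt u) (by linarith)
    refine ⟨fun h => ?_, fun g _ h => ?_⟩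
    -- The bound 2n + 1 ≤ k ensures that both leg circles are letters of level k.
    · have hmem : Gen.ell (legIndex n (sideOf (waistAt u))) ∈ symbs (n + 1) k := by
        refine mem_symbs.2 ⟨lt_legIndex n _, ?_⟩
        change 2 * (n : ℕ) + (sideOf (waistAt u) : ℕ) ≤ k
        omega
      have := h _ hmem
      rw [coord_pantsRetr_leg n _ hX.le, if_pos rfl] at this
      have := congrArg Complex.re this
      simp [legCoord] at this
      linarith
    · have hg : g = .ell (legIndex n (sideOf (waistAt u))) := by
        by_contra hg
        exact h (by rw [coord_pantsRetr_leg n _ hX.le, if_neg hg])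
      refine ⟨(if sideOf (waistAt u) = 0 then 1 else legConj n 0) * .of (.rho n (sideOf (waistAt u))),
        ?_⟩
      filter_upwards [hcX.continuousAt.eventually (lt_mem_nhds hX),
        hcw.continuousAt.eventually (eventually_sideOf him)] with u' h1 h2
      rw [coord_pantsRetr_leg n _ (le_of_lt h1), h2, hg, if_pos rfl, waistLift,
        if_neg (not_le.2 h1), h2]

/-- Crossing the starting point of the outer circle, `waistLift` jumps by the whole boundary word;
this matches the substituted jump of ℓ_n. -/
theorem waistLift_near_one (n : ℕ+) : ∀ᶠ u : UnitCircle in 𝓝 ⟨1, norm_one⟩,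
    waistLift n (waistAt u) = subHom n (jump (.ell n) u) := by
  have hcw : Continuous fun u => (waistAt u : ℂ) := continuous_subtype_val.comp continuous_waistAt
  have h1 : foldX (waistAt ⟨1, norm_one⟩) < -(5 / 2) :=
    (foldX_le_re _).trans_lt (by change (-(4 * (1 : ℂ))).re < _; norm_num)
  have h2 : (waistAt ⟨1, norm_one⟩ : ℂ).re < 0 := by change (-(4 * (1 : ℂ))).re < _; norm_num
  filter_upwards [(continuous_foldX.comp hcw).continuousAt.eventually (gt_mem_nhds h1),
    (Complex.continuous_re.comp hcw).continuousAt.eventually (gt_mem_nhds h2)] with u h3 h4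
  have h3' : foldX (waistAt u) < -(5 / 2) := h3
  have h4' : (waistAt u : ℂ).re < 0 := h4
  have him : (waistAt u : ℂ).im = -(4 * (u : ℂ).im) := by
    change (-(4 * (u : ℂ))).im = _
    simp
  rw [waistLift, if_pos (by linarith), if_pos h3'.le, arcStart, if_pos h4'.le, mul_one, jump]
  by_cases h : (u : ℂ).im ≤ 0
  · rw [if_pos (show sideOf (waistAt u) = 0 from if_pos (by linarith)), if_pos h, map_one]
  · have hs : sideOf (waistAt u) = 1 := if_neg (by linarith)
    rw [hs, if_neg one_ne_zero, if_neg h]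
    simp [subHom]

theorem collapse_of_coord_ne {m : ℕ} {x : PantsSpace} (h : coord (.ell m.succPNat) x ≠ 1) :
    collapse m x = ofPants m.succPNat (pantsRetr (waistAt ⟨_, norm_coord (.ell m.succPNat) x⟩)) := by
  obtain ⟨t, rfl⟩ := exists_loop_of_coord_ne h
  have h1 : waistAt ⟨_, norm_coord (.ell m.succPNat) ((Gen.ell m.succPNat).loop t)⟩ = waist t := by
    apply Subtype.ext
    change -(4 * coord _ _) = -(4 * turn t)
    rw [coord_loop, if_pos rfl]
  rw [h1, ← collapse_ofPants, ofPants_waist]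
  rfl

theorem collapse_of_coord_eq {m : ℕ} {x : PantsSpace} (hx : x ∈ HPlus (m + 1))
    (h : coord (.ell m.succPNat) x = 1) : collapse m x = x := by
  have hm : (m.succPNat : ℕ) = m + 1 := rfl
  refine collapseHomotopy_of_mem (N := 0) (Or.inl ?_) 1
  rcases mem_bouquet_iff.1 hx with rfl | ⟨i, hi, j, s, hs⟩ | ⟨i, hi, s, hs⟩
  · exact base_mem_bouquet _ _
  · exact mem_bouquet_iff.2 (Or.inr (Or.inl ⟨i, by omega, j, s, hs⟩))
  · have hi : m + 1 ≤ (i : ℕ) := hi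
    rcases eq_or_lt_of_le hi with hi | hi
    · have : i = m.succPNat := PNat.coe_injective (by omega)
      subst this
      have h1 := coord_loop (.ell m.succPNat) (.ell m.succPNat) s
      rw [if_pos rfl] at h1
      rw [← hs] at h ⊢
      have h2 := (Gen.ell m.succPNat).loop_eq_base (h1.symm.trans h)
      change (Gen.ell m.succPNat).loop s ∈ _
      rw [h2]
      exact base_mem_bouquet _ _
    · exact mem_bouquet_iff.2 (Or.inr (Or.inr ⟨i, hi, s, hs⟩))

/-- A lift of the collapsed loop is assembled from a lift `v` of the loop: vertices are mapped by
`subHom`, and each passage along ℓ_n is replaced by the lift of the retracted outer circle.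
Uniqueness of lifts then compares the endpoints. -/
theorem redHom_collapseHom {m k : ℕ} (hk : 2 * (m + 1) + 1 ≤ k)
    (x : PiOne (HPlus (m + 1)) (HPlus.base (m + 1))) :
    redHom (m + 1 + 1) k (collapseHom m x) = subHom m.succPNat (redHom (m + 1) k x) := by
  have hm : (m.succPNat : ℕ) = m + 1 := rfl
  obtain ⟨γ, rfl⟩ := exists_loopClass x
  obtain ⟨v, hv, h0, h1⟩ := exists_lift_redHom (m + 1) k γ
  rw [collapseHom, PiOne.map_loopClass_cast]
  set δ : Path (HPlus.base (m + 1 + 1)) (HPlus.base (m + 1 + 1)) :=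
    (γ.map (collapseMap m).continuous).cast (collapseMap_base m).symm (collapseMap_base m).symm
  have hδ : ∀ t, (δ t : PantsSpace) = collapse m (γ t) := fun t => rfl
  obtain ⟨v', hv', h0', h1'⟩ := exists_lift_redHom (m + 1 + 1) k δ
  set n := m.succPNat with hn
  set c : unitInterval → UnitCircle := fun t => ⟨_, norm_coord (.ell n) (γ t)⟩ with hc
  have hcc : Continuous c := Continuous.subtype_mk
    (((isBouquetCoord_HPlus (m + 1)).cont (.ell n)).comp γ.continuous) _
  have hcoord : ∀ g, Continuous fun t => coord g (γ t : PantsSpace) := fun g =>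
    ((isBouquetCoord_HPlus (m + 1)).cont g).comp γ.continuous
  have hone : ∀ t, coord (.ell n) (γ t : PantsSpace) = 1 → c t = ⟨1, norm_one⟩ := fun t ht =>
    Subtype.ext ht
  -- Dividing by the substituted jump returns to the image of the initial vertex of the current
  -- ℓ_n-edge; at the base point the two correction factors cancel.
  set w : unitInterval → FreeGroup Gen := fun t =>
    subHom n (v t) * ((subHom n (jump (.ell n) (c t)))⁻¹ * waistLift n (waistAt (c t))) with hw
  have hlift : IsLift (symbs (m + 1 + 1) k) (fun g t => coord g (δ t : PantsSpace)) w := by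
    intro t
    by_cases ht : coord (.ell n) (γ t : PantsSpace) = 1
    · have hnear : ∀ᶠ s in 𝓝 t, w s = subHom n (v s) := by
        have h2 := hcc.continuousAt (x := t)
        rw [ContinuousAt, hone t ht] at h2
        filter_upwards [h2.eventually (waistLift_near_one n)] with s hs
        rw [hw]
        simp only [hs, inv_mul_cancel, mul_one]
      have hδt : (δ t : PantsSpace) = γ t := collapse_of_coord_eq (γ t).2 ht
      refine ⟨fun h => ?_, fun g hg h => ?_⟩
      · have h3 : ∀ g ∈ symbs (m + 1) k, coord g (γ t : PantsSpace) = 1 := by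
          intro g hg
          by_cases hgn : g = .ell n
          · rw [hgn]; exact ht
          · rw [← hδt]
            refine h g (mem_symbs.2 ?_)
            have hg := mem_symbs.1 hg
            cases g with
            | rho i j => exact Nat.lt_succ_of_lt hg
            | ell i =>
              refine ⟨lt_of_le_of_ne hg.1 fun hi => hgn ?_, hg.2⟩
              rw [hn, PNat.coe_injective (show (i : ℕ) = m.succPNat from hi.symm)]
        filter_upwards [hnear, (hv t).1 h3] with s h4 h5
        rw [h4, h5, hnear.self_of_nhds]
      · simp only [hδt] at h
        have hgn : g ≠ .ell n := by
          rintro rfl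
          exact h ht
        have hmem : g ∈ symbs (m + 1) k := by
          have h2 : ∃ k', g.Mem (m + 1) k' := by
            by_contra h2
            push Not at h2
            exact h (coord_eq_one_of_not_mem h2 (γ t))
          obtain ⟨k', h2⟩ := h2
          have hg := mem_symbs.1 hg
          refine mem_symbs.2 ?_
          cases g with
          | rho i j => exact h2
          | ell i => exact ⟨h2.1, hg.2⟩
        obtain ⟨a, ha⟩ := (hv t).2 g hmem h
        refine ⟨subHom n a, ?_⟩
        filter_upwards [hnear, ha, (hcoord g).continuousAt.eventually_ne h] with s h4 h5 h6
        have h7 : coord (.ell n) (γ s : PantsSpace) = 1 :=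
          (coord_disj _ _ _ hgn).resolve_left h6
        rw [h4, h5, map_mul, subHom_jump hgn, hδ, collapse_of_coord_eq (γ s).2 h7]
    · obtain ⟨a, ha⟩ := (hv t).2 (.ell n) (mem_symbs.2 ⟨le_rfl, by omega⟩) ht
      have hne := (hcoord (.ell n)).continuousAt.eventually_ne ht
      have hws : ∀ᶠ s in 𝓝 t, w s = subHom n a * waistLift n (waistAt (c s)) := by
        filter_upwards [ha] with s hs
        rw [hw]
        simp only [hs, map_mul, hc]
        group
      have hδs : ∀ᶠ s in 𝓝 t, (δ s : PantsSpace) = ofPants n (pantsRetr (waistAt (c s))) := by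
        filter_upwards [hne] with s hs
        exact collapse_of_coord_ne hs
      obtain ⟨s1, s2⟩ := waistLift_spec (n := n) (k := k) (by omega) (u := c t) ht
      refine ⟨fun h => ?_, fun g hg h => ?_⟩
      · have h2 := s1 fun g hg => by rw [← hδs.self_of_nhds]; exact h g hg
        filter_upwards [hws, hcc.continuousAt.eventually h2] with s h3 h4
        rw [h3, h4, hws.self_of_nhds]
      · simp only [hδs.self_of_nhds] at h
        obtain ⟨b, hb⟩ := s2 g hg h
        refine ⟨subHom n a * b, ?_⟩
        filter_upwards [hws, hδs, hcc.continuousAt.eventually hb] with s h3 h4 h5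
        rw [h3, h5, h4, mul_assoc]
  have hend : ∀ t, (γ t : PantsSpace) = base → w t = subHom n (v t) := by
    intro t ht
    have h2 : c t = ⟨1, norm_one⟩ := hone t (by rw [ht]; exact coord_base _)
    rw [hw]
    simp only [h2, (waistLift_near_one n).self_of_nhds, inv_mul_cancel, mul_one]
  have e0 : w 0 = 1 := by
    rw [hend 0 (by rw [γ.source]; rfl), h0, map_one]
  have e1 : w 1 = subHom n (v 1) := hend 1 (by rw [γ.target]; rfl)
  rw [← h1', ← h1, ← e1]
  exact hv'.unique hlift (s := 0) (by rw [h0', e0]) 1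

end HawaiianPants

end

noncomputable section

namespace HawaiianPants

open Filter Topology

/-! ### Substitution in words -/

/-- The substitution `subHom` on letters. -/
def subWord (n : ℕ+) (l : Gen × Bool) : List (Gen × Bool) :=
  if l.1 = .ell n then
    if l.2 then [(.rho n 0, true), (.ell (legIndex n 0), true), (.rho n 0, false),
      (.rho n 1, true), (.ell (legIndex n 1), true), (.rho n 1, false)]
    else [(.rho n 1, true), (.ell (legIndex n 1), false), (.rho n 1, false),
      (.rho n 0, true), (.ell (legIndex n 0), false), (.rho n 0, false)]
  else [l]

/-- The first letter of `subWord n l`. -/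
def subHead (n : ℕ+) (l : Gen × Bool) : Gen × Bool :=
  if l.1 = .ell n then if l.2 then (.rho n 0, true) else (.rho n 1, true) else l

/-- The last letter of `subWord n l`. -/
def subLast (n : ℕ+) (l : Gen × Bool) : Gen × Bool :=
  if l.1 = .ell n then if l.2 then (.rho n 1, false) else (.rho n 0, false) else l

theorem exists_subWord_eq_cons (n : ℕ+) (l : Gen × Bool) : ∃ t, subWord n l = subHead n l :: t := by
  unfold subWord subHead
  split_ifs <;> exact ⟨_, rfl⟩

theorem getLast?_subWord (n : ℕ+) (l : Gen × Bool) :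
    (subWord n l).getLast? = some (subLast n l) := by
  unfold subWord subLast
  split_ifs <;> rfl

theorem subHom_mk (n : ℕ+) (L : List (Gen × Bool)) :
    subHom n (FreeGroup.mk L) = FreeGroup.mk (L.flatMap (subWord n)) := by
  induction L with
  | nil => rfl
  | cons l L ih =>
    have h1 : FreeGroup.mk (l :: L) = FreeGroup.mk [l] * FreeGroup.mk L := rfl
    rw [h1, map_mul, ih, List.flatMap_cons, ← FreeGroup.mul_mk]
    congr 1
    obtain ⟨g, b⟩ := l
    by_cases hg : g = .ell n
    · subst hg
      cases b
      · have h2 : FreeGroup.mk [(Gen.ell n, false)] = (FreeGroup.of (Gen.ell n))⁻¹ := rfl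
        rw [h2, map_inv]
        simp only [subHom, FreeGroup.lift_apply_of, if_true, legConj, subWord]
        simp only [mul_inv_rev, inv_inv, mul_assoc]
        rfl
      · have h2 : FreeGroup.mk [(Gen.ell n, true)] = FreeGroup.of (Gen.ell n) := rfl
        rw [h2]
        simp only [subHom, FreeGroup.lift_apply_of, if_true, legConj, subWord]
        simp only [mul_assoc]
        rfl
    · cases b
      · have h2 : FreeGroup.mk [(g, false)] = (FreeGroup.of g)⁻¹ := rfl
        rw [h2, map_inv]
        simp [subHom, subWord, hg, ← h2]
      · have h2 : FreeGroup.mk [(g, true)] = FreeGroup.of g := rfl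
        rw [h2]
        simp [subHom, subWord, hg, ← h2]

theorem isReduced_subWord (n : ℕ+) (l : Gen × Bool) : FreeGroup.IsReduced (subWord n l) := by
  unfold subWord FreeGroup.IsReduced
  split_ifs <;> simp

/-- An inserted block starts and ends with letters `rho n j`, which do not occur in `L`. Two
adjacent blocks have the same sign, and then the last letter of one and the first letter of the next
have different `j`, so they do not cancel. -/
theorem isReduced_flatMap_subWord (n : ℕ+) {L : List (Gen × Bool)} (hL : FreeGroup.IsReduced L)
    (h : ∀ l ∈ L, ∀ j, l.1 ≠ .rho n j) : FreeGroup.IsReduced (L.flatMap (subWord n)) := by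
  induction L with
  | nil => exact List.IsChain.nil
  | cons a L ih =>
    rw [List.flatMap_cons, FreeGroup.IsReduced, List.isChain_append]
    refine ⟨isReduced_subWord n a, ih hL.tail fun l hl => h l (List.mem_cons_of_mem a hl), ?_⟩
    intro x hx y hy
    rw [getLast?_subWord, Option.mem_def, Option.some_inj] at hx
    cases L with
    | nil => simp at hy
    | cons b L =>
      obtain ⟨t, ht⟩ := exists_subWord_eq_cons n b
      rw [List.flatMap_cons, ht, List.cons_append, List.head?_cons, Option.mem_def,
        Option.some_inj] at hy
      have hab : a.1 = b.1 → a.2 = b.2 := (List.isChain_cons_cons.1 hL).1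
      have ha := h a (by simp)
      have hb := h b (by simp)
      rw [← hx, ← hy]
      obtain ⟨g, s⟩ := a
      obtain ⟨g', s'⟩ := b
      simp only at ha hb hab
      unfold subLast subHead
      by_cases hg : g = .ell n <;> by_cases hg' : g' = .ell n
      · subst hg hg'
        have := hab rfl
        subst this
        cases s <;> simp
      · cases s <;> simp [hg, hg', fun j => (hb j).symm]
      · cases s' <;> simp [hg, hg', ha]
      · simpa [hg, hg'] using hab

theorem toWord_subHom (n : ℕ+) {w : FreeGroup Gen} (h : ∀ l ∈ w.toWord, ∀ j, l.1 ≠ .rho n j) :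
    (subHom n w).toWord = w.toWord.flatMap (subWord n) := by
  conv_lhs => rw [← FreeGroup.mk_toWord (x := w), subHom_mk, FreeGroup.toWord_mk]
  exact (isReduced_flatMap_subWord n FreeGroup.isReduced_toWord h).reduce_eq

theorem mem_of_mem_toWord_redHom {n k : ℕ} {x : PiOne (HPlus n) (HPlus.base n)} {l : Gen × Bool}
    (hl : l ∈ (redHom n k x).toWord) : l.1.Mem n k := by
  rw [redHom_apply, toWord_map_of_injective Subtype.val_injective] at hl
  obtain ⟨l', -, rfl⟩ := List.mem_map.1 hl
  exact l'.1.2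

theorem toWord_redHom_collapseHom {m k : ℕ} (hk : 2 * (m + 1) + 1 ≤ k)
    (x : PiOne (HPlus (m + 1)) (HPlus.base (m + 1))) :
    (redHom (m + 1 + 1) k (collapseHom m x)).toWord
      = (redHom (m + 1) k x).toWord.flatMap (subWord m.succPNat) := by
  rw [redHom_collapseHom hk, toWord_subHom]
  intro l hl j hj
  have := mem_of_mem_toWord_redHom hl
  rw [hj] at this
  exact lt_irrefl _ this

/-- The substitution turns nonempty reduced words into nonempty reduced words, so a trivial image
makes all late reduced words empty, and shape injectivity applies. -/
theorem collapseHom_injective (m : ℕ) : Function.Injective (collapseHom m) := by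
  rw [injective_iff_map_eq_one]
  intro x hx
  refine eq_one_of_redHom _ x (Eventually.frequently ?_)
  filter_upwards [eventually_ge_atTop (2 * (m + 1) + 1)] with k hk
  have h := toWord_redHom_collapseHom hk x
  rw [hx, map_one, FreeGroup.toWord_one] at h
  rw [← FreeGroup.toWord_eq_nil_iff, List.eq_nil_iff_forall_not_mem]
  intro l hl
  obtain ⟨t, ht⟩ := exists_subWord_eq_cons m.succPNat l
  have := (List.flatMap_eq_nil_iff.1 h.symm) l hl
  rw [ht] at this
  exact List.cons_ne_nil _ _ this

/-- The inclusion of `ℍ⁺_n` into `ℙ` induces an injective homomorphism. -/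
theorem inclHom_injective (m : ℕ) : Function.Injective (inclHom (m + 1)) := by
  intro x y h
  obtain ⟨d, hd⟩ := exists_collapseHomIter_eq_of_inclHom_eq h
  have : ∀ d, Function.Injective (collapseHomIter m d) := by
    intro d
    induction d with
    | zero => exact Function.injective_id
    | succ d ih => exact (collapseHom_injective _).comp ih
  exact this d hd

/-! ### Stabilized words -/

theorem keep_keep {n k n' k' : ℕ} (h : ∀ g : Gen, g.Mem n' k' → g.Mem n k) (L : List (Gen × Bool)) :
    keep n' k' (keep n k L) = keep n' k' L := by
  rw [keep, keep, List.filter_filter]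
  refine List.filter_congr fun l _ => ?_
  by_cases hl : l.1.Mem n' k'
  · simp [mem_symbs, hl, h _ hl]
  · simp [mem_symbs, hl]

theorem keep_of_forall {n k : ℕ} {L : List (Gen × Bool)} (h : ∀ l ∈ L, l.1.Mem n k) :
    keep n k L = L := by
  rw [keep, List.filter_eq_self]
  intro l hl
  simpa [mem_symbs] using h l hl

theorem mem_of_mem_wordLetters {n k : ℕ} {w : Word n k} {l : Gen × Bool} (hl : l ∈ wordLetters w) :
    l.1.Mem n k := by
  obtain ⟨l', -, rfl⟩ := List.mem_map.1 hl
  exact l'.1.2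

/-- The letters of `ω_{m+1,m}(x)`. -/
def label (m : ℕ) (x : PiOne (HPlus (m + 1)) (HPlus.base (m + 1))) : List (Gen × Bool) :=
  wordLetters (omega (m + 1) m x)

theorem Gen.Mem.of_le {n m : ℕ} (h : n ≤ m) {g : Gen} (hg : g.Mem (n + 1) n) : g.Mem (m + 1) m := by
  cases g with
  | rho i j =>
    have : (i : ℕ) < n + 1 := hg
    change (i : ℕ) < m + 1
    omega
  | ell i => exact absurd (hg.1.trans hg.2) (by omega)

/-- At level (m + 1, m) only the letters ρ_{i,j} with i ≤ m remain; the substitution neither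
replaces nor creates any of these. -/
theorem keep_subWord_of_succ {m : ℕ} (l : Gen × Bool) :
    keep (m + 1) m (subWord m.succPNat l) = keep (m + 1) m [l] := by
  have hell : ∀ i : ℕ+, ¬ (Gen.ell i).Mem (m + 1) m := fun i hi =>
    absurd (hi.1.trans hi.2) (by omega)
  have hrho : ∀ j, ¬ (Gen.rho m.succPNat j).Mem (m + 1) m := fun j => lt_irrefl (m + 1)
  obtain ⟨g, s⟩ := l
  by_cases hg : g = .ell m.succPNat
  · subst hg
    cases s <;> simp [subWord, keep, mem_symbs, hell, hrho]
  · simp [subWord, hg]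

theorem keep_flatMap (n k : ℕ) (f : Gen × Bool → List (Gen × Bool)) (L : List (Gen × Bool)) :
    keep n k (L.flatMap f) = L.flatMap fun l => keep n k (f l) :=
  List.filter_flatMap ..

theorem keep_eq_flatMap (n k : ℕ) (L : List (Gen × Bool)) :
    keep n k L = L.flatMap fun l => keep n k [l] := by
  rw [← keep_flatMap]
  simp

theorem keep_label_collapseHom (m : ℕ) (x : PiOne (HPlus (m + 1)) (HPlus.base (m + 1))) :
    keep (m + 1) m (label (m + 1) (collapseHom m x)) = label m x := by
  obtain ⟨k, hk, h1, h2⟩ := ((eventually_ge_atTop (2 * (m + 1) + 1)).and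
    ((eventually_keep_eq (m + 1 + 1) (m + 1) (collapseHom m x)).and
      (eventually_keep_eq (m + 1) m x))).exists
  rw [label, label, ← h1, ← h2, keep_keep fun g hg => hg.of_le (Nat.le_succ m),
    toWord_redHom_collapseHom hk, keep_flatMap, keep_eq_flatMap]
  simp only [keep_subWord_of_succ]

theorem keep_label_collapseHomIter {n m : ℕ} (h : n ≤ m) (d : ℕ)
    (x : PiOne (HPlus (m + 1)) (HPlus.base (m + 1))) :
    keep (n + 1) n (label (m + d) (collapseHomIter m d x)) = keep (n + 1) n (label m x) := by
  induction d with
  | zero => rfl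
  | succ d ih =>
    have e := congrArg (keep (n + 1) n) (keep_label_collapseHom (m + d) (collapseHomIter m d x))
    rw [keep_keep fun g hg => hg.of_le (h.trans (Nat.le_add_right m d))] at e
    exact e.trans ih

/-- By injectivity of `inclHom`, the representative at the higher level is the iterated collapse of
the other one. Hence the labels do not depend on representatives. -/
theorem keep_label_eq {n m m' : ℕ} (h : n ≤ m) (h' : n ≤ m')
    {x : PiOne (HPlus (m + 1)) (HPlus.base (m + 1))}
    {x' : PiOne (HPlus (m' + 1)) (HPlus.base (m' + 1))}
    (e : inclHom (m + 1) x = inclHom (m' + 1) x') :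
    keep (n + 1) n (label m x) = keep (n + 1) n (label m' x') := by
  wlog hm : m ≤ m' generalizing m m'
  · exact (this h' h e.symm (le_of_not_ge hm)).symm
  obtain ⟨d, rfl⟩ := Nat.exists_eq_add_of_le hm
  have : collapseHomIter m d x = x' :=
    inclHom_injective (m + d) ((inclHom_collapseHomIter m d x).trans e)
  rw [← this, keep_label_collapseHomIter h]

/-- Decoding from left to right: the first letter of a block identifies its source letter, and then
the whole block can be removed. -/
theorem flatMap_inj_of_head {A B : Type*} {f : A → List B} {P : A → Prop} {h : A → B}
    (hf : ∀ a, P a → ∃ t, f a = h a :: t) (hinj : ∀ a b, P a → P b → h a = h b → a = b)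
    {L M : List A} (hL : ∀ a ∈ L, P a) (hM : ∀ a ∈ M, P a) (e : L.flatMap f = M.flatMap f) :
    L = M := by
  induction L generalizing M with
  | nil =>
    cases M with
    | nil => rfl
    | cons b M =>
      obtain ⟨t, ht⟩ := hf b (hM b (by simp))
      simp [ht] at e
  | cons a L ih =>
    obtain ⟨t, ht⟩ := hf a (hL a (by simp))
    cases M with
    | nil => simp [ht] at e
    | cons b M =>
      obtain ⟨t', ht'⟩ := hf b (hM b (by simp))
      have hab : a = b := by
        refine hinj a b (hL a (by simp)) (hM b (by simp)) ?_
        rw [List.flatMap_cons, List.flatMap_cons, ht, ht', List.cons_append, List.cons_append] at e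
        exact (List.cons.inj e).1
      subst hab
      rw [List.flatMap_cons, List.flatMap_cons] at e
      rw [ih (fun a ha => hL a (List.mem_cons_of_mem _ ha))
        (fun a ha => hM a (List.mem_cons_of_mem _ ha)) (List.append_cancel_left e)]

/-- The stabilized words of the image of `x` under a collapse. -/
theorem omega_collapseHom {m q : ℕ} (hq : m + 1 ≤ q)
    (x : PiOne (HPlus (m + 1)) (HPlus.base (m + 1))) :
    wordLetters (omega (m + 1 + 1) q (collapseHom m x)) =
      (wordLetters (omega (m + 1) q x)).flatMap
        fun l => keep (m + 1 + 1) q (subWord m.succPNat l) := by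
  obtain ⟨k, hk, h1, h2⟩ := ((eventually_ge_atTop (2 * (m + 1) + 1)).and
    ((eventually_keep_eq (m + 1 + 1) q (collapseHom m x)).and
      (eventually_keep_eq (m + 1) q x))).exists
  rw [← h1, ← h2, toWord_redHom_collapseHom hk, keep_flatMap]
  have hmem : ∀ l ∈ (redHom (m + 1) k x).toWord, l.1.Mem (m + 1) k := fun l hl =>
    mem_of_mem_toWord_redHom hl
  generalize (redHom (m + 1) k x).toWord = L at hmem
  induction L with
  | nil => rfl
  | cons l L ih =>
    have hl := hmem l (by simp)
    have ih := ih fun l hl => hmem l (List.mem_cons_of_mem _ hl)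
    by_cases h : l.1.Mem (m + 1) q
    · rw [keep, List.filter_cons_of_pos (by simpa [mem_symbs] using h), ← keep, List.flatMap_cons,
        List.flatMap_cons, ih]
    -- A letter deleted at level (m + 1, q) is a circle of index above q ≥ m + 1, so it is not
    -- substituted and is deleted afterwards as well.
    · have h3 : keep (m + 1 + 1) q (subWord m.succPNat l) = [] := by
        obtain ⟨g, s⟩ := l
        cases g with
        | rho i j => exact absurd hl h
        | ell i =>
          have hi : ¬ (i : ℕ) ≤ q := fun hi => h ⟨hl.1, hi⟩
          have hne : i ≠ m.succPNat := by
            rintro rfl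
            exact hi hq
          have hi' : ¬ (Gen.ell i).Mem (m + 1 + 1) q := fun h' => hi h'.2
          simp [subWord, keep, mem_symbs, hne, hi']
      rw [List.flatMap_cons, h3, List.nil_append, ih, keep, keep,
        List.filter_cons_of_neg (by simpa [mem_symbs] using h)]

/-- Blocks replacing ℓ_{m+1} or its inverse start with a letter ρ_{m+1,j}, which survives the
deletion and occurs in no word of the old level; `j` reveals the sign. So the substitution stays
decodable after deletion. -/
theorem omega_eq_of_collapseHom_eq {m q : ℕ} (hq : m + 1 ≤ q)
    {x y : PiOne (HPlus (m + 1)) (HPlus.base (m + 1))}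
    (h : wordLetters (omega (m + 1 + 1) q (collapseHom m x)) =
      wordLetters (omega (m + 1 + 1) q (collapseHom m y))) :
    wordLetters (omega (m + 1) q x) = wordLetters (omega (m + 1) q y) := by
  rw [omega_collapseHom hq, omega_collapseHom hq] at h
  have hrho : ∀ j, ¬ (Gen.rho m.succPNat j).Mem (m + 1) q := fun j => lt_irrefl (m + 1)
  have hrho' : ∀ j, (Gen.rho m.succPNat j).Mem (m + 1 + 1) q := fun j => Nat.lt_succ_self (m + 1)
  refine flatMap_inj_of_head (P := fun l => l.1.Mem (m + 1) q) (h := subHead m.succPNat)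
    ?_ ?_ (fun _ => mem_of_mem_wordLetters) (fun _ => mem_of_mem_wordLetters) h
  · intro l hl
    obtain ⟨t, ht⟩ := exists_subWord_eq_cons m.succPNat l
    have hmem : (subHead m.succPNat l).1.Mem (m + 1 + 1) q := by
      obtain ⟨g, s⟩ := l
      by_cases hg : g = .ell m.succPNat
      · cases s <;> simp [subHead, hg, hrho']
      · simp only [subHead, hg, if_false]
        cases g with
        | rho i j => exact Nat.lt_succ_of_lt hl
        | ell i =>
          refine ⟨Nat.lt_of_le_of_ne hl.1 fun hi => hg ?_, hl.2⟩
          rw [PNat.coe_injective (show (i : ℕ) = m.succPNat from hi.symm)]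
    exact ⟨keep (m + 1 + 1) q t, by
      rw [ht, keep, List.filter_cons_of_pos (by simpa [mem_symbs] using hmem)]; rfl⟩
  · rintro ⟨g, s⟩ ⟨g', s'⟩ hl hl' e
    simp only at hl hl'
    unfold subHead at e
    by_cases hg : g = .ell m.succPNat <;> by_cases hg' : g' = .ell m.succPNat
    · subst hg hg'
      cases s <;> cases s' <;> simp_all
    · exfalso
      simp only [hg, hg', if_true, if_false] at e
      obtain ⟨j, hj⟩ : ∃ j, Gen.rho m.succPNat j = g' := by
        split_ifs at e <;> exact ⟨_, congrArg Prod.fst e⟩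
      exact hrho j (hj ▸ hl')
    · exfalso
      simp only [hg, hg', if_true, if_false] at e
      obtain ⟨j, hj⟩ : ∃ j, Gen.rho m.succPNat j = g := by
        split_ifs at e <;> exact ⟨_, (congrArg Prod.fst e).symm⟩
      exact hrho j (hj ▸ hl)
    · simpa only [hg, hg', if_false] using e

theorem omega_eq_of_collapseHomIter_eq {m q : ℕ} (d : ℕ) (hq : m + d ≤ q)
    {x y : PiOne (HPlus (m + 1)) (HPlus.base (m + 1))}
    (h : wordLetters (omega (m + d + 1) q (collapseHomIter m d x)) =
      wordLetters (omega (m + d + 1) q (collapseHomIter m d y))) :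
    wordLetters (omega (m + 1) q x) = wordLetters (omega (m + 1) q y) := by
  induction d with
  | zero => exact h
  | succ d ih => exact ih (by omega) (omega_eq_of_collapseHom_eq hq h)

/-- The stabilized word is an unreduced form of g_{n,q}: cancelling it amounts to killing the
letters beyond q. -/
theorem redHom_eq_mk_omega (n q : ℕ) (x : PiOne (HPlus n) (HPlus.base n)) :
    redHom n q x = FreeGroup.mk (wordLetters (omega n q x)) := by
  obtain ⟨k, hk, h⟩ := ((eventually_ge_atTop q).and (eventually_keep_eq n q x)).exists
  rw [redHom_eq_kill n hk, ← h]
  conv_lhs => rw [← FreeGroup.mk_toWord (x := redHom n k x), killHom_mk]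
  rfl

/-- With q = m + d, the label after d collapses decodes to ω_{m+1,q}. So all late reduced words of
`x` and `y` agree, and shape injectivity applies. -/
theorem eq_of_label_eq {m : ℕ} {x y : PiOne (HPlus (m + 1)) (HPlus.base (m + 1))}
    (h : ∀ d, label (m + d) (collapseHomIter m d x) = label (m + d) (collapseHomIter m d y)) :
    x = y := by
  rw [← div_eq_one]
  refine eq_one_of_redHom _ _ (Eventually.frequently ?_)
  filter_upwards [eventually_ge_atTop m] with q hq
  obtain ⟨d, rfl⟩ := Nat.exists_eq_add_of_le hq
  rw [map_div, div_eq_one, redHom_eq_mk_omega, redHom_eq_mk_omega,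
    omega_eq_of_collapseHomIter_eq d le_rfl (h d)]

/-! ### The labelling -/

/-- Each bond computes an entry from the next one, so late entries determine all others. -/
theorem WordLimit.ext_of_eventually {w w' : WordLimit} {N : ℕ}
    (h : ∀ n : ℕ+, N ≤ (n : ℕ) → w.1 n = w'.1 n) : w = w' := by
  apply Subtype.ext
  funext n
  have key : ∀ d : ℕ, ∀ n : ℕ+, N ≤ (n : ℕ) + d → w.1 n = w'.1 n := by
    intro d
    induction d with
    | zero => exact h
    | succ d ih =>
      intro n hn
      rw [← w.2 n, ← w'.2 n, ih (n + 1) (by rw [PNat.add_coe, PNat.one_coe]; omega)]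
  exact key N n (Nat.le_add_left _ _)

theorem exists_preimage (a : PiOne PantsSpace base) (n : ℕ) :
    ∃ q : (m : ℕ) × PiOne (HPlus (m + 1)) (HPlus.base (m + 1)), n ≤ q.1 ∧
      inclHom (q.1 + 1) q.2 = a := by
  obtain ⟨N, hN⟩ := exists_inclHom_eq a
  obtain ⟨x, hx⟩ := hN (max n N + 1) (by omega)
  exact ⟨⟨max n N, x⟩, le_max_left _ _, hx⟩

/-- The labelling of the elements of `π₁(ℙ, b₀)` by words. -/
def labelling (a : PiOne PantsSpace base) : WordLimit :=
  ⟨fun n => deleteLetters ((exists_preimage a n).choose.1 + 1) (exists_preimage a n).choose.1 (n + 1) n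
    (omega ((exists_preimage a n).choose.1 + 1) (exists_preimage a n).choose.1
      (exists_preimage a n).choose.2), fun n => by
    apply wordLetters_injective
    rw [bond, wordLetters_deleteLetters, wordLetters_deleteLetters, wordLetters_deleteLetters]
    obtain ⟨h1, h2⟩ := (exists_preimage a n).choose_spec
    obtain ⟨h3, h4⟩ := (exists_preimage a ((n + 1 : ℕ+) : ℕ)).choose_spec
    rw [PNat.add_coe, PNat.one_coe] at h3
    rw [keep_keep fun g hg => hg.of_le (by rw [PNat.add_coe, PNat.one_coe]; omega)]
    exact keep_label_eq ((Nat.le_succ _).trans h3) h1 (h4.trans h2.symm)⟩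

theorem isLabelling_labelling : IsLabelling labelling := by
  intro n x
  apply wordLetters_injective
  obtain ⟨h1, h2⟩ := (exists_preimage (inclHom (n + 1) x) n).choose_spec
  change wordLetters (deleteLetters _ _ _ _ _) = _
  rw [wordLetters_deleteLetters]
  refine (keep_label_eq h1 le_rfl h2).trans ?_
  exact keep_of_forall fun l => mem_of_mem_wordLetters

theorem IsLabelling.unique {χ χ' : PiOne PantsSpace base → WordLimit} (h : IsLabelling χ)
    (h' : IsLabelling χ') : χ' = χ := by
  funext a
  obtain ⟨N, hN⟩ := exists_inclHom_eq a
  refine WordLimit.ext_of_eventually (N := N) fun n hn => ?_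
  obtain ⟨x, rfl⟩ := hN (n + 1) (by omega)
  rw [h, h']

/-- Represent both elements at one level; the labels of their iterated collapses are entries of χ
and determine the representatives. -/
theorem IsLabelling.injective {χ : PiOne PantsSpace base → WordLimit} (h : IsLabelling χ) :
    Function.Injective χ := by
  intro a b hab
  obtain ⟨N, hN⟩ := exists_inclHom_eq a
  obtain ⟨N', hN'⟩ := exists_inclHom_eq b
  -- The summand 1 makes all indices `m + d` positive, as indices of the inverse limit must be.
  set m := max N N' + 1 with hm
  obtain ⟨x, rfl⟩ := hN (m + 1) (by omega)
  obtain ⟨y, rfl⟩ := hN' (m + 1) (by omega)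
  rw [eq_of_label_eq (x := x) (y := y) fun d => ?_]
  obtain ⟨n, hn⟩ : ∃ n : ℕ+, (n : ℕ) = m + d := ⟨⟨m + d, by omega⟩, rfl⟩
  have key : ∀ z : PiOne (HPlus (m + 1)) (HPlus.base (m + 1)),
      wordLetters ((χ (inclHom (m + 1) z)).1 n) = label (m + d) (collapseHomIter m d z) := by
    intro z
    rw [← inclHom_collapseHomIter m d z]
    generalize collapseHomIter m d z = z
    generalize m + d = m' at hn z
    subst hn
    rw [h]
    rfl
  rw [← key, ← key, hab]

end HawaiianPants

end

open HawaiianPants Filter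
theorem mainTheorem4 :
    -- the classes of the loops `ρ_{i,j}` and `ℓ_i` freely generate `π₁(ℍ⁺_{n,k}, b₀)`
    (∀ n k : ℕ, 1 ≤ n → n ≤ k + 1 → Function.Bijective (evalHom n k)) ∧
    -- the words from which `ω_{n,m}` is defined are eventually constant, with value `ω_{n,m}`
    (∀ n m : ℕ, 1 ≤ n → n ≤ m + 1 → ∀ x : PiOne (HPlus n) (HPlus.base n),
      ∀ᶠ k in atTop, deleteLetters n k n m (gWord n k x) = omega n m x) ∧
    -- every element of `π₁(ℙ, b₀)` comes from `π₁(ℍ⁺_n, b₀)` for all sufficiently large `n`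
    (∀ a : PiOne PantsSpace base, ∃ N : ℕ, ∀ n : ℕ, N ≤ n →
      ∃ x : PiOne (HPlus n) (HPlus.base n), inclHom n x = a) ∧
    -- `χ` is well defined by its values on these elements, and it is injective
    ∃ χ : PiOne PantsSpace base → WordLimit,
      IsLabelling χ ∧ (∀ χ' : PiOne PantsSpace base → WordLimit,
        IsLabelling χ' → χ' = χ) ∧ Function.Injective χ :=
  ⟨fun n k _ _ => evalHom_bijective n k, fun n m _ _ x => eventually_eq_omega n m x,
    exists_inclHom_eq, labelling, isLabelling_labelling,
    fun _ h => isLabelling_labelling.unique h, isLabelling_labelling.injective⟩
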